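/- Fix $m\ge 1$. Let $(X,D,Y(0),Y(1))$ have law $P$ on $\mathbb R^m\times\{0,1\}\times\mathbb R\times\mathbb R$, let $Y=DY(1)+(1-D)Y(0)$, $e(X)=\mathbb P(D=1\mid X)$, $\mu_\omega(x)=\mathbb E(Y\mid X=x,D=\omega)$, $\sigma_\omega^2(x)=\mathbb E[(Y(\omega)-\mu_\omega(X))^2\mid X=x]$, $\varepsilon=Y-\mu_D(X)$, $\sigma_\varepsilon^2=\mathrm{Var}(\varepsilon)$. Let $\mathbb X$ be the support of $X$, $S_\omega$ the support of $X$ given $D=\omega$, $\lambda$ Lebesgue measure, and $B(z,\delta)$ the closed Euclidean ball. Assume, with positive constants $g_{\min},g_{\max},g_{\omega,\min},g_{\omega,\max},L,a<1,H,B,M_l,M_u$ (the structural constants): (A1) $\mathbb X$ is compact and convex. (A2) $X$ has a density $g$ with $g_{\min}\le g\le g_{\max}$ on $\mathbb X$. (A3) $D$ is independent of $(Y(0),Y(1))$ given $X$, and $\eta\le e(X)\le 1-\eta$ a.s., where $\eta\in(0,1/2]$. (A4) For $\omega=0,1$, $X$ given $D=\omega$ has a density $g_\omega$ with $g_{\omega,\min}\le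 g_\omega\le g_{\omega,\max}$ on $S_\omega$; on each of $S_0,S_1$ both $g_0$ and $g_1$ are $L$-Lipschitz. (A5) $\lambda(B(z,\delta)\cap S_\omega)\ge a\lambda(B(z,\delta))$ for $\omega=0,1$, $z\in S_{1-\omega}$, $0<\delta\le\mathrm{diam}(S_\omega)$. (A6) The surface areas of $S_0,S_1$ are at most $H$. (B1) $\mathbb E\mu_\omega(X)^2\le B$ for $\omega=0,1$. (B2) $\mathbb E\varepsilon^2\ge M_l$, and for some $p>0$, $\mathbb E[|Y(\omega)-\mu_\omega(X)|^{4+p}\mid X,D]\le M_u$ a.s. on $\{D=\omega\}$, $\omega=0,1$. (B3) $\mu_0,\mu_1$ are $\lfloor m/2\rfloor+1$ times continuously differentiable on $\mathbb X$. Let $(X_i,D_i,Y_i)$, $i\le n$, be i.i.d. copies of $(X,D,Y)$, $\varepsilon_i=Y_i-\mu_{D_i}(X_i)$, and $1\le M\le n$. Let $\mathcal J^\omega_M(j)$ be the set of $i$ with $D_i=\omega$ and $\#\{l:D_l=\omega,\ \|X_l-X_j\|\le\|X_i-X_j\|\}\le M$, let $K^\omega_M(i)=\#\{j:D_j=1-\omega,\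 i\in\mathcal J^\omega_M(j)\}$, and $$E_n=\frac1n\sum_{i=1}^n(\mu_1(X_i)-\mu_0(X_i))+\frac1n\sum_{i=1}^n(2D_i-1)\Big(1+\frac{K^{D_i}_M(i)}{M}\Big)\varepsilon_i,$$ $$\sigma^2=\mathrm{Var}(\mu_1(X)-\mu_0(X))+\mathbb E\Big(\frac{\sigma_1^2(X)}{e(X)}+\frac{\sigma_0^2(X)}{1-e(X)}\Big).$$ (1) For all $n\ge1$ and $1\le M\le n$, $E_n$ is square integrable and $\mathrm{Var}E_n\ge\big(\sigma_\varepsilon^2+\mathrm{Var}(\mu_1(X)-\mu_0(X))\big)/n$. Let further $C_0,C_1>0$ with $C_0\le\max_{i=0,1}(g_{i,\min}/4)^{m+1}\,V_m/(2L^m)$, where $V_m$ is the volume of the unit ball of $\mathbb R^m$. Let $r_{\mathrm{ratio}}=\max_{i=0,1}g_{i,\min}/g_{i,\max}$, let $r_0\in[r_{\mathrm{ratio}},1]$, and put $\rho=e^{-(1-\log2)M}+e^{M-r_0n\eta-M\log M+M\log(r_0n\eta)}$, $$\delta_{H_1}=\frac1{n^2\eta^4}+\Big(\frac n{M\eta}\Big)^2\rho^2,\quad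 \delta_{H_2}=\Big(\frac M{n\eta}\Big)^{1/m}+\frac1{n\eta}+\frac nM\rho,\quad \delta_{H_3}=\Big(\frac n{M\eta}\Big)^2e^{-(1-\log2)M}.$$ (2) There is $C>0$ depending only on $m$, the structural constants, $C_0$ and $C_1$ (not on $n,M,\eta,p,r_0$ or otherwise on $P$) such that for all $n\ge9$ and $1\le M\le n$ with $M\le C_0n\eta$ and $n\eta^2\ge C_1$, $$|n\mathrm{Var}E_n-\sigma^2|\le C\Big(\frac1\eta\Big(\frac M{n\eta}\Big)^{1/(2m)}+\delta_{H_1}^{1/2}+(\delta_{H_2}^{1/2}+1)\frac1{\eta M^{1/2}}+\delta_{H_3}^{1/2}+\frac1{\eta^3n^{1/3}}\Big).$$ (3) Let $\eta_0>0$. There is $C>0$ depending only on $m$, the structural constants, $C_0$, $C_1$ and $\eta_0$ such that, for every sequence of laws $P_n$, regression functions, $p_n>0$, $\eta_n\ge\eta_0$ and $M_n$ that satisfy all the assumptions of (2) for each $n\ge9$ with the same structural constants, if $M_n^{-1}\log n\to0$ and $n^{-1}M_n\log n\to0$, then for all sufficiently large $n$ $$|n\mathrm{Var}E_n-\sigma^2|\le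 C\Big(\Big(\frac{M_n}n\Big)^{1/(2m)}+\frac1{M_n^{1/2}}+\frac1{n^{1/3}}\Big).$$ -/

import Mathlib

open MeasureTheory ProbabilityTheory Filter Topology

noncomputable section

namespace ATEMatching

/-- Covariate space `ℝ^m` with the Euclidean norm. -/
abbrev Cov (m : ℕ) : Type := EuclideanSpace ℝ (Fin m)

/-- A unit `(X, D, Y(0), Y(1))`; the treatment indicator is a Boolean (`true` is treated).
A population is a probability law `P` on this space, with `X, D, Y(0), Y(1)` the coordinates. -/
abbrev Pop (m : ℕ) : Type := Cov m × Bool × ℝ × ℝ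

/-- The covariate `X`. -/
def cov {m : ℕ} (s : Pop m) : Cov m := s.1

/-- The treatment indicator `D`. -/
def treat {m : ℕ} (s : Pop m) : Bool := s.2.1

/-- The potential outcome `Y(ω)`. -/
def potential {m : ℕ} (ω : Bool) (s : Pop m) : ℝ := if ω then s.2.2.2 else s.2.2.1

/-- The observed outcome `Y = D Y(1) + (1 - D) Y(0)`. -/
def outcome {m : ℕ} (s : Pop m) : ℝ := potential (treat s) s

/-- The regression error `ε = Y - μ_D(X)`. -/
def err {m : ℕ} (μ : Bool → Cov m → ℝ) (s : Pop m) : ℝ := outcome s - μ (treat s) (cov s)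

theorem measurable_cov {m : ℕ} : Measurable (cov : Pop m → Cov m) := measurable_fst

/-- The sigma-algebra generated by `X`. -/
abbrev sigmaX (m : ℕ) : MeasurableSpace (Pop m) := MeasurableSpace.comap cov inferInstance

/-- The sigma-algebra generated by `(X, D)`. -/
abbrev sigmaXD (m : ℕ) : MeasurableSpace (Pop m) :=
  MeasurableSpace.comap (fun s => (cov s, treat s)) inferInstance

theorem sigmaX_le (m : ℕ) : sigmaX m ≤ (inferInstance : MeasurableSpace (Pop m)) :=
  measurable_cov.comap_le

/-- The support `𝕏` of the covariate. -/
def suppX {m : ℕ} (P : Measure (Pop m)) : Set (Cov m) := (P.map cov).support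

/-- The conditional law of `X` given `D = ω`. -/
def condLaw {m : ℕ} (P : Measure (Pop m)) (ω : Bool) : Measure (Cov m) :=
  (ProbabilityTheory.cond P (treat ⁻¹' {ω})).map cov

/-- The support `S_ω` of the conditional law of `X` given `D = ω`. -/
def suppS {m : ℕ} (P : Measure (Pop m)) (ω : Bool) : Set (Cov m) := (condLaw P ω).support

/-- The propensity score `e(X) = ℙ(D = 1 | X)`, as a random variable. -/
def propensity {m : ℕ} (P : Measure (Pop m)) : Pop m → ℝ :=
  P[fun s => if treat s then (1 : ℝ) else 0 | sigmaX m]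

/-- The conditional variance `σ_ω²(X) = 𝔼[(Y(ω) - μ_ω(X))² | X]`, as a random variable. -/
def sigmaSq {m : ℕ} (P : Measure (Pop m)) (μ : Bool → Cov m → ℝ) (ω : Bool) : Pop m → ℝ :=
  P[fun s => (potential ω s - μ ω (cov s)) ^ 2 | sigmaX m]

/-- `μ_ω(x) = 𝔼[Y | X = x, D = ω]` for `ω = 0, 1`: `μ` is a version of the regression function. -/
structure IsRegression {m : ℕ} (P : Measure (Pop m)) (μ : Bool → Cov m → ℝ) : Prop where
  measurable : ∀ ω, Measurable (μ ω)
  integrable : Integrable (outcome : Pop m → ℝ) P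
  condExp_eq : P[outcome | sigmaXD m] =ᵐ[P] fun s => μ (treat s) (cov s)

/-- The numerical constants that occur in the assumptions on the data distribution and on the
regression functions, apart from the overlap constant `η` and the moment exponent `p`. -/
structure Constants where
  /-- lower bound of the density of `X` -/
  gmin : ℝ
  /-- upper bound of the density of `X` -/
  gmax : ℝ
  /-- lower bounds `g_{ω,min}` of the conditional densities -/
  cmin : Bool → ℝ
  /-- upper bounds `g_{ω,max}` of the conditional densities -/
  cmax : Bool → ℝ
  /-- Lipschitz constant of the conditional densities -/
  L : ℝ
  /-- volume fraction constant -/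
  a : ℝ
  /-- bound of the surface areas -/
  H : ℝ
  /-- bound of the second moments of the regression functions -/
  B : ℝ
  /-- lower bound of the second moment of the error -/
  Ml : ℝ
  /-- upper bound of the conditional moments of order `4 + p` of the errors -/
  Mu : ℝ

/-- Assumption set A: the data distribution, with overlap constant `η`. -/
structure AssumptionA {m : ℕ} (c : Constants) (η : ℝ) (P : Measure (Pop m))
    [IsProbabilityMeasure P] : Prop where
  isCompact : IsCompact (suppX P)
  convex : Convex ℝ (suppX P)
  gmin_pos : 0 < c.gmin
  density : ∃ g : Cov m → ℝ, Measurable g ∧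
    P.map cov = volume.withDensity (fun x => ENNReal.ofReal (g x)) ∧
    ∀ x ∈ suppX P, c.gmin ≤ g x ∧ g x ≤ c.gmax
  unconfounded : CondIndepFun (sigmaX m) (sigmaX_le m) (treat : Pop m → Bool)
    (fun s => (potential false s, potential true s)) P
  eta_pos : 0 < η
  eta_le : η ≤ 1 / 2
  overlap : ∀ᵐ s ∂P, η ≤ propensity P s ∧ propensity P s ≤ 1 - η
  cmin_pos : ∀ ω, 0 < c.cmin ω
  L_pos : 0 < c.L
  condDensity : ∃ g : Bool → Cov m → ℝ, (∀ ω, Measurable (g ω)) ∧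
    (∀ ω, condLaw P ω = volume.withDensity (fun x => ENNReal.ofReal (g ω x))) ∧
    (∀ ω, ∀ x ∈ suppS P ω, c.cmin ω ≤ g ω x ∧ g ω x ≤ c.cmax ω) ∧
    (∀ ω', ∀ x ∈ suppS P ω', ∀ z ∈ suppS P ω', ∀ ω, |g ω z - g ω x| ≤ c.L * ‖x - z‖)
  a_pos : 0 < c.a
  a_lt : c.a < 1
  volume_fraction : ∀ ω, ∀ δ : ℝ, 0 < δ → δ ≤ Metric.diam (suppS P ω) → ∀ z ∈ suppS P (!ω),
    ENNReal.ofReal c.a * volume (Metric.closedBall z δ) ≤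
      volume (Metric.closedBall z δ ∩ suppS P ω)
  H_pos : 0 < c.H
  surface : ∀ ω, μHE[m - 1] (frontier (suppS P ω)) ≤ ENNReal.ofReal c.H

/-- Assumption set B, items (1) to (3): the regression functions and the errors, with moment
exponent `4 + p`. -/
structure AssumptionB {m : ℕ} (c : Constants) (p : ℝ) (P : Measure (Pop m))
    (μ : Bool → Cov m → ℝ) : Prop where
  regression : IsRegression P μ
  memLp : ∀ ω, MemLp (fun s => μ ω (cov s)) 2 P
  second_moment : ∀ ω, ∫ s, (μ ω (cov s)) ^ 2 ∂P ≤ c.B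
  Ml_pos : 0 < c.Ml
  err_lower : c.Ml ≤ ∫ s, (err μ s) ^ 2 ∂P
  p_pos : 0 < p
  Mu_pos : 0 < c.Mu
  moment_integrable : ∀ ω,
    Integrable (fun s => |potential ω s - μ ω (cov s)| ^ (4 + p)) P
  moment_le : ∀ ω, ∀ᵐ s ∂P, treat s = ω →
    (P[fun s => |potential ω s - μ ω (cov s)| ^ (4 + p) | sigmaXD m]) s ≤ c.Mu
  smooth : ∀ ω, ContDiffOn ℝ ((m / 2 + 1 : ℕ) : WithTop ℕ∞) (μ ω) (suppX P)

open Classical in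
/-- `𝒥^ω_M(i)`: the indices of the `M` nearest neighbours of `x_i` among the units `j` with
`d_j = ω`. -/
def nnSet {m n : ℕ} (M : ℕ) (ω : Bool) (i : Fin n) (s : Fin n → Pop m) : Finset (Fin n) :=
  Finset.univ.filter fun j => treat (s j) = ω ∧
    (Finset.univ.filter fun l => treat (s l) = ω ∧
      dist (cov (s l)) (cov (s i)) ≤ dist (cov (s j)) (cov (s i))).card ≤ M

open Classical in
/-- `K^ω_M(i)`: the number of units `j` with `d_j = 1 - ω` that have `i` among their `M` nearest
neighbours with label `ω`. -/
def matched {m n : ℕ} (M : ℕ) (ω : Bool) (i : Fin n) (s : Fin n → Pop m) : ℕ :=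
  (Finset.univ.filter fun j => treat (s j) = !ω ∧ i ∈ nnSet M ω j s).card

/-- The main term `E_n` of the bias-corrected matching estimator. -/
def mainTerm {m : ℕ} (n M : ℕ) (μ : Bool → Cov m → ℝ) (s : Fin n → Pop m) : ℝ :=
  (1 / n : ℝ) * ∑ i, (μ true (cov (s i)) - μ false (cov (s i))) +
  (1 / n : ℝ) * ∑ i, (if treat (s i) then (1 : ℝ) else -1) *
    (1 + (matched M (treat (s i)) i s : ℝ) / M) * err μ (s i)

/-- The law of an i.i.d. sample of size `n`. -/
def sampleLaw {m : ℕ} (n : ℕ) (P : Measure (Pop m)) : Measure (Fin n → Pop m) :=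
  Measure.pi fun _ => P

/-- `Var E_n`. -/
def varMain {m : ℕ} (n M : ℕ) (P : Measure (Pop m)) (μ : Bool → Cov m → ℝ) : ℝ :=
  variance (mainTerm n M μ) (sampleLaw n P)

/-- `Var(μ₁(X) - μ₀(X))`. -/
def varCate {m : ℕ} (P : Measure (Pop m)) (μ : Bool → Cov m → ℝ) : ℝ :=
  variance (fun s => μ true (cov s) - μ false (cov s)) P

/-- The limiting variance `σ² = Var(μ₁(X) - μ₀(X)) + 𝔼[σ₁²(X)/e(X) + σ₀²(X)/(1 - e(X))]`. -/
def limitVar {m : ℕ} (P : Measure (Pop m)) (μ : Bool → Cov m → ℝ) : ℝ :=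
  varCate P μ +
    ∫ s, (sigmaSq P μ true s / propensity P s + sigmaSq P μ false s / (1 - propensity P s)) ∂P

/-- `r_ratio`, the maximum of the within density ratios. -/
def rRatio (c : Constants) : ℝ :=
  max (c.cmin false / c.cmax false) (c.cmin true / c.cmax true)

/-- The upper bound imposed on the constant `C₀`. -/
def c0Bound (m : ℕ) (c : Constants) : ℝ :=
  max ((c.cmin false / 4) ^ (m + 1)) ((c.cmin true / 4) ^ (m + 1)) *
    ((volume (Metric.closedBall (0 : Cov m) 1)).toReal / (2 * c.L ^ m))

/-- `e^{-(1 - log 2) M}`. -/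
def expM (M : ℕ) : ℝ := Real.exp (-(1 - Real.log 2) * M)

/-- `e^{M - r₀ n η - M log M + M log (r₀ n η)}`. -/
def expN (r₀ : ℝ) (n M : ℕ) (η : ℝ) : ℝ :=
  Real.exp (M - r₀ * n * η - M * Real.log M + M * Real.log (r₀ * n * η))

/-- The error term `δ_{H_1}`. -/
def deltaH1 (r₀ : ℝ) (n M : ℕ) (η : ℝ) : ℝ :=
  1 / ((n : ℝ) ^ 2 * η ^ 4) + (n / (M * η)) ^ 2 * (expM M + expN r₀ n M η) ^ 2

/-- The error term `δ_{H_2}`. -/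
def deltaH2 (m : ℕ) (r₀ : ℝ) (n M : ℕ) (η : ℝ) : ℝ :=
  (M / (n * η)) ^ (1 / (m : ℝ)) + 1 / (n * η) + (n / M : ℝ) * (expM M + expN r₀ n M η)

/-- The error term `δ_{H_3}`. -/
def deltaH3 (n M : ℕ) (η : ℝ) : ℝ := (n / (M * η)) ^ 2 * expM M

/-- The non-asymptotic variance approximation rate. -/
def varRate (m : ℕ) (r₀ : ℝ) (n M : ℕ) (η : ℝ) : ℝ :=
  1 / η * (M / (n * η)) ^ (1 / (2 * (m : ℝ))) + Real.sqrt (deltaH1 r₀ n M η) +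
    (Real.sqrt (deltaH2 m r₀ n M η) + 1) * (1 / (η * Real.sqrt M)) +
    Real.sqrt (deltaH3 n M η) + 1 / (η ^ 3 * (n : ℝ) ^ (1 / 3 : ℝ))

/-- The simplified rate. -/
def simpleRate (m : ℕ) (n M : ℕ) : ℝ :=
  (M / n : ℝ) ^ (1 / (2 * (m : ℝ))) + 1 / Real.sqrt M + 1 / (n : ℝ) ^ (1 / 3 : ℝ)

end ATEMatching

end

/-!
The variance of the main term is computed, up to the claimed rate, by reducing it to the second
moment of the number of matches of a single unit.

*Variance decomposition.* Given the covariates and treatments of the sample, the errors of distinct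
units are centred and uncorrelated, and so are the regression part and the error part of `E_n`.
Hence `n Var E_n = Var(μ₁(X) - μ₀(X)) + n⁻¹ ∑ᵢ E[(1 + K(i) / M)² εᵢ²]` (`varMain_eq`). Since
`1 + K / M ≥ 1`, this contains the lower bound (`le_varMain`). On the other side, Bayes' rule expresses the
propensity score through the densities `g₀, g₁` of the covariate in the two groups and the
probabilities of the groups. By overlap, both groups have the whole support of `X` as their support.
Writing `odds_w(x) = ℙ(D = 1 - w) g_{1-w}(x) / (ℙ(D = w) g_w(x))`, unconfoundedness turns the
limiting variance into `Var(μ₁(X) - μ₀(X)) + ∑_w E[1_{D = w} (1 + odds_w(X))² (Y(w) - μ_w(X))²]`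
(`limitVar_eq`). It therefore suffices to compare `E[(1 + K(i) / M)² | unit i = (x, w, ·)]` with
`(1 + odds_w(x))²`, on average over the unit.

*Moments of the number of matches.* Unit `j` of the other group is matched to unit `i` when fewer
than `M` further units of group `w` lie in the closed ball around `X_j` through `X_i`. The number of
such units is binomial given `X_j`, so a match has probability `∫ F(t) dβ(t)`, where `F(t)` is the
probability that a unit belongs to the opposite group and the ball around it through `x` contains
units of group `w` with probability less than `t`, and `β` is the law of the `M`-th smallest of
`n - 2` independent uniform variables (`integral_matched`). Likewise, two units are both matched to `i`
with probability at most `∫ F(t)² dβ(t)`, now with `n - 3` variables: the probability of both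
matches, given the two units, is at most that of the match over the ball of larger probability, a
binomial tail at the maximum of two levels (`integral_matched_sq_le`). Together with `(E K)² ≤ E K²`
this pins the second moment from both sides.

*Catchment areas.* The density is Lipschitz and bounded below on the convex compact support `S`, so
`F(t) = odds_w(x) t + O(t δ)` with `δ` of the order of `(t / ℙ(D = w))^{1/m}`, if the ball of radius
`2δ` around `x` stays inside `S`, and `F(t) = O(t)` in any case (`catchment_approx`). By convexity
the exceptional `x` lie among those from which one of `2m` steps of length `O(δ)` along the
coordinate axes leaves `S`; for each step these form a set of volume `O(δ)`, since its translates by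
multiples of the step are disjoint (`volume_real_exit_le`). No regularity of the boundary is needed.
Averaging over `x` and then over the order statistic, whose mean is of order `M / n`, gives
`|n Var E_n - σ²| ≤ (C / η) ((M / (n η))^{1/m} + 1 / M)`
(`Design.abs_varMain_sub_limitVar_le_rate`). When `M / (n η)` is bounded, this implies both stated
rates.
-/

namespace ATEMatching

set_option linter.unusedSectionVars false

/-! ### Binomial tails and order statistics of uniform variables -/

/-- The probability that a binomial variable with parameters `N` and `p` is less than `M`. -/
noncomputable def binCdf (N M : ℕ) (p : ℝ) : ℝ :=
  ∑ k ∈ Finset.range M, (N.choose k : ℝ) * p ^ k * (1 - p) ^ (N - k)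

/-- The density on `[0, 1]` of the `M`-th smallest of `N` independent uniform variables. -/
noncomputable def orderDens (N M : ℕ) (t : ℝ) : ℝ :=
  M * N.choose M * t ^ (M - 1) * (1 - t) ^ (N - M)

/-- The law of the `M`-th smallest of `N` independent uniform variables on `[0, 1]`. -/
noncomputable def orderLaw (N M : ℕ) : Measure ℝ :=
  (volume.restrict (Set.Ioc (0 : ℝ) 1)).withDensity fun t => ENNReal.ofReal (orderDens N M t)

lemma binCdf_zero_right (N : ℕ) (p : ℝ) : binCdf N 0 p = 0 := by simp [binCdf]

lemma binCdf_zero_left (M : ℕ) (p : ℝ) : binCdf 0 (M + 1) p = 1 := by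
  simp [binCdf, Finset.sum_range_succ', Nat.choose]

/-- Conditioning on the outcome of one trial. -/
lemma binCdf_succ (N M : ℕ) (p : ℝ) :
    binCdf (N + 1) (M + 1) p = p * binCdf N M p + (1 - p) * binCdf N (M + 1) p := by
  have key : ∀ k, (N.choose k : ℝ) * p ^ k * (1 - p) ^ (N + 1 - k) =
      (1 - p) * (N.choose k * p ^ k * (1 - p) ^ (N - k)) := by
    intro k
    rcases le_or_gt k N with h | h
    · rw [Nat.succ_sub h, pow_succ]; ring
    · simp [Nat.choose_eq_zero_of_lt h]
  have h1 : ∀ k, ((N + 1).choose (k + 1) : ℝ) * p ^ (k + 1) * (1 - p) ^ (N + 1 - (k + 1)) =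
      p * (N.choose k * p ^ k * (1 - p) ^ (N - k)) +
        (1 - p) * (N.choose (k + 1) * p ^ (k + 1) * (1 - p) ^ (N - (k + 1))) := by
    intro k
    rw [Nat.choose_succ_succ, ← key (k + 1), Nat.add_sub_add_right]
    push_cast
    ring
  unfold binCdf
  rw [Finset.sum_range_succ', Finset.sum_range_succ' _ M]
  simp_rw [h1, Finset.sum_add_distrib, ← Finset.mul_sum]
  simp only [Nat.choose_zero_right, pow_zero, Nat.sub_zero, pow_succ]
  push_cast
  ring

lemma hasDerivAt_binCdf (N M : ℕ) (hM : M ≤ N) (p : ℝ) :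
    HasDerivAt (binCdf N M) (-orderDens N M p) p := by
  induction M with
  | zero =>
    have : binCdf N 0 = fun _ => 0 := by ext; simp [binCdf]
    simpa [this, orderDens] using hasDerivAt_const p (0 : ℝ)
  | succ M ih =>
    have h1 : binCdf N (M + 1) = fun p => binCdf N M p + N.choose M * (p ^ M * (1 - p) ^ (N - M)) := by
      ext q; simp only [binCdf, Finset.sum_range_succ]; ring
    have h2 : HasDerivAt (fun p : ℝ => (1 - p) ^ (N - M))
        ((N - M : ℕ) * (1 - p) ^ (N - M - 1) * (-1)) p := by
      simpa using ((hasDerivAt_id p).const_sub 1).fun_pow (N - M)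
    have h3 := (ih (by omega)).add (((hasDerivAt_pow M p).mul h2).const_mul (N.choose M : ℝ))
    rw [h1]
    refine h3.congr_deriv ?_
    have h4 : ((M + 1 : ℕ) : ℝ) * N.choose (M + 1) = (N - M : ℕ) * N.choose M := by
      have := Nat.choose_succ_right_eq N M
      rw [mul_comm, mul_comm (((N - M : ℕ) : ℝ))]
      exact_mod_cast this
    unfold orderDens
    rw [h4, Nat.add_sub_cancel, show N - (M + 1) = N - M - 1 by omega]
    ring

lemma binCdf_one {N M : ℕ} (hM : M ≤ N) : binCdf N M 1 = 0 := by
  unfold binCdf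
  refine Finset.sum_eq_zero fun k hk => ?_
  have : N - k ≠ 0 := by have := Finset.mem_range.1 hk; omega
  simp [this]

lemma continuous_orderDens (N M : ℕ) : Continuous (orderDens N M) := by
  unfold orderDens; fun_prop

lemma orderDens_nonneg (N M : ℕ) {t : ℝ} (h0 : 0 ≤ t) (h1 : t ≤ 1) : 0 ≤ orderDens N M t := by
  have : 0 ≤ 1 - t := by linarith
  unfold orderDens; positivity

/-- The duality between binomial tails and order statistics. -/
lemma orderLaw_Ioi {N M : ℕ} (hM : M ≤ N) {p : ℝ} (h0 : 0 ≤ p) (h1 : p ≤ 1) :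
    orderLaw N M (Set.Ioi p) = ENNReal.ofReal (binCdf N M p) := by
  have h2 : ∫ t in p..1, orderDens N M t = binCdf N M p := by
    have := intervalIntegral.integral_eq_sub_of_hasDerivAt (a := p) (b := 1)
      (f := fun t => -binCdf N M t) (f' := orderDens N M)
      (fun t _ => by simpa using (hasDerivAt_binCdf N M hM t).fun_neg)
      ((continuous_orderDens N M).intervalIntegrable _ _)
    simpa [binCdf_one hM] using this
  rw [orderLaw, withDensity_apply _ measurableSet_Ioi, Measure.restrict_restrict measurableSet_Ioi,
    ← h2, intervalIntegral.integral_of_le h1, ofReal_integral_eq_lintegral_ofReal]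
  · congr 2
    ext t; simp only [Set.mem_inter_iff, Set.mem_Ioi, Set.mem_Ioc]
    constructor
    · rintro ⟨a, -, b⟩; exact ⟨a, b⟩
    · rintro ⟨a, b⟩; exact ⟨a, by linarith, b⟩
  · exact (continuous_orderDens N M).integrableOn_Ioc
  · filter_upwards [ae_restrict_mem measurableSet_Ioc] with t ht
    exact orderDens_nonneg N M (h0.trans ht.1.le) ht.2

lemma integral_pow_mul_one_sub_pow (a c : ℕ) :
    ∫ t in (0 : ℝ)..1, t ^ a * (1 - t) ^ c = (a.factorial * c.factorial : ℝ) / (a + c + 1).factorial := by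
  induction c generalizing a with
  | zero =>
    simp [integral_pow, Nat.factorial_succ]
    field_simp
  | succ c ih =>
    have h1 : ∀ t : ℝ, HasDerivAt (fun t : ℝ => t ^ (a + 1) * (1 - t) ^ (c + 1))
        ((a + 1) * (t ^ a * (1 - t) ^ (c + 1)) - (c + 1) * (t ^ (a + 1) * (1 - t) ^ c)) t := by
      intro t
      have h2 : HasDerivAt (fun p : ℝ => (1 - p) ^ (c + 1))
          ((c + 1 : ℕ) * (1 - t) ^ c * (-1)) t := by
        simpa using ((hasDerivAt_id t).const_sub 1).fun_pow (c + 1)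
      refine ((hasDerivAt_pow (a + 1) t).mul h2).congr_deriv ?_
      push_cast [Nat.add_sub_cancel]; ring
    have h3 := intervalIntegral.integral_eq_sub_of_hasDerivAt (a := 0) (b := 1) (fun t _ => h1 t)
      (Continuous.intervalIntegrable (by fun_prop) _ _)
    rw [intervalIntegral.integral_sub (Continuous.intervalIntegrable (by fun_prop) _ _)
      (Continuous.intervalIntegrable (by fun_prop) _ _), intervalIntegral.integral_const_mul,
      intervalIntegral.integral_const_mul, ih] at h3
    have h4 : (a + 1 + c + 1).factorial = (a + (c + 1) + 1).factorial := by congr 1; ring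
    rw [h4] at h3
    have h5 : ((a + (c + 1) + 1).factorial : ℝ) ≠ 0 := by positivity
    have h6 : (a + 1 : ℝ) ≠ 0 := by positivity
    simp only [one_pow, sub_self, zero_pow (Nat.succ_ne_zero _), mul_zero, zero_mul, sub_zero] at h3
    rw [eq_div_iff h5]
    rw [Nat.factorial_succ a, Nat.factorial_succ c] at *
    push_cast at *
    field_simp at h3
    have : (a + 1 : ℝ) * ((∫ (t : ℝ) in 0..1, t ^ a * (1 - t) ^ (c + 1)) *
      ((a + (c + 1) + 1).factorial : ℝ)) = (a+1) * (a.factorial * ((c + 1) * c.factorial)) := by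
      linarith
    exact mul_left_cancel₀ h6 this

lemma integral_orderLaw (N M : ℕ) (f : ℝ → ℝ) :
    ∫ t, f t ∂orderLaw N M = ∫ t in Set.Ioc (0 : ℝ) 1, orderDens N M t * f t := by
  rw [orderLaw, integral_withDensity_eq_integral_toReal_smul₀]
  · refine integral_congr_ae ?_
    filter_upwards [ae_restrict_mem measurableSet_Ioc] with t ht
    rw [ENNReal.toReal_ofReal (orderDens_nonneg N M ht.1.le ht.2), smul_eq_mul]
  · exact ((continuous_orderDens N M).measurable.ennreal_ofReal).aemeasurable
  · exact Eventually.of_forall fun _ => ENNReal.ofReal_lt_top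

lemma integral_pow_orderLaw {N M : ℕ} (h1 : 1 ≤ M) (hM : M ≤ N) (j : ℕ) :
    ∫ t, t ^ j ∂orderLaw N M =
      (M + j - 1).factorial * N.factorial / ((M - 1).factorial * (N + j).factorial) := by
  rw [integral_orderLaw, ← intervalIntegral.integral_of_le zero_le_one]
  have : ∀ t : ℝ, orderDens N M t * t ^ j =
      (M * N.choose M) * (t ^ (M + j - 1) * (1 - t) ^ (N - M)) := by
    intro t; rw [orderDens, show M + j - 1 = M - 1 + j by omega, pow_add]; ring
  simp_rw [this]
  rw [intervalIntegral.integral_const_mul, integral_pow_mul_one_sub_pow,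
    show M + j - 1 + (N - M) + 1 = N + j by omega]
  have h2 : (N.choose M : ℝ) * M.factorial * (N - M).factorial = N.factorial := by
    exact_mod_cast Nat.choose_mul_factorial_mul_factorial hM
  have h3 : (M.factorial : ℝ) = M * (M - 1).factorial := by
    rw [← Nat.mul_factorial_pred (by omega)]; push_cast; ring
  have h4 : ((N + j).factorial : ℝ) ≠ 0 := by positivity
  have h5 : ((M - 1).factorial : ℝ) ≠ 0 := by positivity
  rw [← h2, h3]
  field_simp

lemma orderLaw_ae_mem (N M : ℕ) : ∀ᵐ t ∂orderLaw N M, t ∈ Set.Ioc (0 : ℝ) 1 := by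
  rw [orderLaw]
  exact (withDensity_absolutelyContinuous _ _).ae_le (ae_restrict_mem measurableSet_Ioc)

instance (N M : ℕ) : IsFiniteMeasure (orderLaw N M) :=
  isFiniteMeasure_withDensity_ofReal (continuous_orderDens N M).integrableOn_Ioc.hasFiniteIntegral

lemma integrable_orderLaw {N M : ℕ} {f : ℝ → ℝ} (hf : Measurable f) {C : ℝ}
    (hC : ∀ t ∈ Set.Ioc (0 : ℝ) 1, |f t| ≤ C) : Integrable f (orderLaw N M) :=
  Integrable.of_bound hf.aestronglyMeasurable C (by
    filter_upwards [orderLaw_ae_mem N M] with t ht using hC t ht)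

lemma integrable_pow_orderLaw (N M j : ℕ) : Integrable (fun t => t ^ j) (orderLaw N M) :=
  integrable_orderLaw (by fun_prop) (C := 1) fun t ht => by
    rw [abs_of_nonneg (pow_nonneg ht.1.le _)]; exact pow_le_one₀ ht.1.le ht.2

lemma integral_one_orderLaw {N M : ℕ} (h1 : 1 ≤ M) (hM : M ≤ N) :
    ∫ t, t ∂orderLaw N M = M / (N + 1) := by
  have := integral_pow_orderLaw h1 hM 1
  simp only [pow_one] at this
  rw [this, Nat.add_sub_cancel, Nat.factorial_succ]
  have h3 : (M.factorial : ℝ) = M * (M - 1).factorial := by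
    rw [← Nat.mul_factorial_pred (by omega)]; push_cast; ring
  rw [h3]
  push_cast
  field_simp

lemma integral_sq_orderLaw {N M : ℕ} (h1 : 1 ≤ M) (hM : M ≤ N) :
    ∫ t, t ^ 2 ∂orderLaw N M = M * (M + 1) / ((N + 1) * (N + 2)) := by
  obtain ⟨M, rfl⟩ := Nat.exists_eq_add_of_le' h1
  rw [integral_pow_orderLaw h1 hM 2, show M + 1 + 2 - 1 = M + 2 by omega, Nat.add_sub_cancel]
  simp only [Nat.factorial_succ]
  push_cast
  field_simp
  ring

lemma integral_cube_orderLaw {N M : ℕ} (h1 : 1 ≤ M) (hM : M ≤ N) :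
    ∫ t, t ^ 3 ∂orderLaw N M = M * (M + 1) * (M + 2) / ((N + 1) * (N + 2) * (N + 3)) := by
  obtain ⟨M, rfl⟩ := Nat.exists_eq_add_of_le' h1
  rw [integral_pow_orderLaw h1 hM 3, show M + 1 + 3 - 1 = M + 3 by omega, Nat.add_sub_cancel]
  simp only [Nat.factorial_succ]
  push_cast
  field_simp
  ring

/-! ### Volumes of balls and the boundary layer of a convex body -/

/-- The volume `V_m` of the unit ball. -/
noncomputable def ballVol (m : ℕ) : ℝ := volume.real (Metric.closedBall (0 : Cov m) 1)

/-- The radius of a ball of volume `v`. -/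
noncomputable def rad (m : ℕ) (v : ℝ) : ℝ := (v / ballVol m) ^ (1 / (m : ℝ))

lemma ballVol_pos (m : ℕ) : 0 < ballVol m :=
  ENNReal.toReal_pos (Metric.measure_closedBall_pos _ _ one_pos).ne' measure_closedBall_lt_top.ne

lemma volume_real_closedBall {m : ℕ} (x : Cov m) {r : ℝ} (hr : 0 ≤ r) :
    volume.real (Metric.closedBall x r) = ballVol m * r ^ m := by
  rw [Measure.addHaar_real_closedBall _ _ hr, ballVol, Measure.addHaar_real_closedBall _ _ zero_le_one]
  simp [mul_comm]

lemma rad_nonneg {m : ℕ} {v : ℝ} (hv : 0 ≤ v) : 0 ≤ rad m v :=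
  Real.rpow_nonneg (div_nonneg hv (ballVol_pos m).le) _

lemma ballVol_mul_rad_pow {m : ℕ} (hm : 1 ≤ m) {v : ℝ} (hv : 0 ≤ v) :
    ballVol m * rad m v ^ m = v := by
  rw [rad, ← Real.rpow_natCast, ← Real.rpow_mul (div_nonneg hv (ballVol_pos m).le),
    one_div_mul_cancel (by positivity), Real.rpow_one, mul_div_cancel₀ _ (ballVol_pos m).ne']

lemma le_rad_iff {m : ℕ} (hm : 1 ≤ m) {v d : ℝ} (hv : 0 ≤ v) (hd : 0 ≤ d) :
    d ≤ rad m v ↔ ballVol m * d ^ m ≤ v := by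
  conv_rhs => rw [← ballVol_mul_rad_pow hm hv]
  rw [mul_le_mul_iff_right₀ (ballVol_pos m), pow_le_pow_iff_left₀ hd (rad_nonneg hv) (by omega)]

lemma rad_mono {m : ℕ} {v w : ℝ} (hv : 0 ≤ v) (hvw : v ≤ w) : rad m v ≤ rad m w :=
  Real.rpow_le_rpow (div_nonneg hv (ballVol_pos m).le)
    (div_le_div_of_nonneg_right hvw (ballVol_pos m).le) (by positivity)

lemma volume_real_closedBall_rad {m : ℕ} (hm : 1 ≤ m) (x : Cov m) {v : ℝ} (hv : 0 ≤ v) :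
    volume.real (Metric.closedBall x (rad m v)) = v := by
  rw [volume_real_closedBall x (rad_nonneg hv), ballVol_mul_rad_pow hm hv]

lemma volume_real_ball_rad {m : ℕ} (hm : 1 ≤ m) (x : Cov m) {v : ℝ} (hv : 0 ≤ v) :
    volume.real (Metric.ball x (rad m v)) = v := by
  have : Nonempty (Fin m) := ⟨⟨0, hm⟩⟩
  have : Nontrivial (Cov m) := inferInstance
  rw [← Measure.addHaar_real_closedBall_eq_addHaar_real_ball volume]
  exact volume_real_closedBall_rad hm x hv

/-- The points of a bounded convex set that a translation by `u` moves out of it have a volume of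
order `‖u‖`: their translates by multiples of `u` are pairwise disjoint, and of order `1 / ‖u‖`
of these fit into a ball. -/
lemma volume_real_exit_le {m : ℕ} {S : Set (Cov m)} (hS : IsClosed S) (hconv : Convex ℝ S)
    {z : Cov m} {R : ℝ} (hSR : S ⊆ Metric.closedBall z R) (u : Cov m) {c : ℝ}
    (hc : 0 < c) (hu : ‖u‖ ≤ c) :
    volume.real {x | x ∈ S ∧ x + u ∉ S} ≤ c * volume.real (Metric.closedBall z (R + 2)) := by
  set A : Set (Cov m) := {x | x ∈ S ∧ x + u ∉ S}
  have hball : volume (Metric.closedBall z (R + 2)) ≠ ⊤ := measure_closedBall_lt_top.ne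
  have hAm : MeasurableSet A :=
    hS.measurableSet.inter ((hS.measurableSet.preimage (measurable_add_const u)).compl)
  rcases le_or_gt c 1 with hc1 | hc1
  · have hexit : ∀ x ∈ A, ∀ k : ℕ, 1 ≤ k → x + (k : ℝ) • u ∉ S := by
      intro x hx k hk hmem
      refine hx.2 ?_
      have hk' : (1 : ℝ) ≤ k := by exact_mod_cast hk
      have h0 : (0 : ℝ) < k := by linarith
      have := hconv.add_smul_sub_mem hx.1 hmem (t := (k : ℝ)⁻¹)
        ⟨by positivity, inv_le_one_of_one_le₀ hk'⟩
      simpa [smul_smul, h0.ne'] using this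
    set T : ℕ → Set (Cov m) := fun k => (fun y => y + (-((k : ℝ) • u))) ⁻¹' A
    have hT : ∀ k, volume (T k) = volume A := fun k => measure_preimage_add_right _ _ _
    have hTm : ∀ k, MeasurableSet (T k) := fun k => hAm.preimage (measurable_add_const _)
    have hdis : ∀ k l : ℕ, k < l → Disjoint (T k) (T l) := by
      intro k l hkl
      rw [Set.disjoint_left]
      intro y hk hl
      refine hexit _ hl (l - k) (by omega) ?_
      have : y + -((l : ℝ) • u) + ((l - k : ℕ) : ℝ) • u = y + -((k : ℝ) • u) := by
        rw [Nat.cast_sub hkl.le, sub_smul]; abel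
      rw [this]; exact hk.1
    set N := ⌈1 / c⌉₊
    have hN1 : (N : ℝ) < 1 / c + 1 := Nat.ceil_lt_add_one (by positivity)
    have hN2 : 1 / c ≤ N := Nat.le_ceil _
    have hsub : (⋃ k ∈ Finset.range N, T k) ⊆ Metric.closedBall z (R + 2) := by
      intro y hy
      simp only [Set.mem_iUnion, Finset.mem_range] at hy
      obtain ⟨k, hk, hy⟩ := hy
      have h1 := hSR hy.1
      rw [Metric.mem_closedBall] at h1 ⊢
      have h2 : dist y (y + -((k : ℝ) • u)) ≤ 2 := by
        rw [dist_self_add_right, norm_neg, norm_smul, Real.norm_natCast]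
        have hk' : (k : ℝ) ≤ N := by exact_mod_cast hk.le
        calc (k : ℝ) * ‖u‖ ≤ (1 / c + 1) * c := by gcongr; linarith
          _ = 1 + c := by field_simp
          _ ≤ 2 := by linarith
      linarith [dist_triangle y (y + -((k : ℝ) • u)) z]
    have hsum : (N : ℝ) * volume.real A ≤ volume.real (Metric.closedBall z (R + 2)) := by
      have h1 : volume.real (⋃ k ∈ Finset.range N, T k) = ∑ k ∈ Finset.range N, volume.real (T k) := by
        refine measureReal_biUnion_finset ?_ (fun k _ => hTm k) ?_
        · intro k _ l _ hkl
          rcases lt_or_gt_of_ne hkl with h | h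
          · exact hdis k l h
          · exact (hdis l k h).symm
        · intro k hk
          refine ne_top_of_le_ne_top hball (measure_mono ?_)
          exact (Set.subset_biUnion_of_mem (u := T) hk).trans hsub
      have h2 : ∀ k, volume.real (T k) = volume.real A := fun k => by
        rw [measureReal_def, measureReal_def, hT]
      simp_rw [h2, Finset.sum_const, Finset.card_range, nsmul_eq_mul] at h1
      rw [← h1]
      exact measureReal_mono hsub hball
    have : 1 / c * volume.real A ≤ volume.real (Metric.closedBall z (R + 2)) :=
      (mul_le_mul_of_nonneg_right hN2 measureReal_nonneg).trans hsum
    rw [one_div, inv_mul_le_iff₀ hc] at this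
    exact this
  · calc volume.real A ≤ volume.real (Metric.closedBall z (R + 2)) :=
        measureReal_mono (fun x hx => Metric.closedBall_subset_closedBall (by linarith) (hSR hx.1))
          hball
      _ ≤ c * volume.real (Metric.closedBall z (R + 2)) :=
        le_mul_of_one_le_left measureReal_nonneg hc1.le

/-- The point `± m t e_j`, the sign being `+` for `true`. -/
noncomputable def axisPoint (m : ℕ) (t : ℝ) (j : Fin m × Bool) : Cov m :=
  EuclideanSpace.single j.1 (if j.2 then m * t else -(m * t))

lemma norm_axisPoint {m : ℕ} {t : ℝ} (ht : 0 ≤ t) (j : Fin m × Bool) :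
    ‖axisPoint m t j‖ = m * t := by
  have : 0 ≤ m * t := by positivity
  rcases j with ⟨j, _ | _⟩ <;> simp [axisPoint, abs_of_nonneg ht]

/-- If a convex set contains `x` and the vertices of a large cross-polytope around `x`, then it
contains the ball inscribed in the latter. -/
lemma closedBall_subset_of_axisPoint_mem {m : ℕ} (hm : 1 ≤ m) {S : Set (Cov m)}
    (hconv : Convex ℝ S) {x : Cov m} (hx : x ∈ S) {t : ℝ} (ht : 0 ≤ t)
    (h : ∀ j, x + axisPoint m t j ∈ S) : Metric.closedBall x t ⊆ S := by
  rcases ht.eq_or_lt with rfl | ht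
  · simpa using hx
  intro y hy
  have hmt : 0 < m * t := by positivity
  set v : Cov m := y - x
  have hv : ‖v‖ ≤ t := by rwa [Metric.mem_closedBall, dist_eq_norm] at hy
  have hvj : ∀ j, |v j| ≤ t := fun j => (by simpa using PiLp.norm_apply_le v j : |v j| ≤ ‖v‖).trans hv
  have hmain : x + v ∈ S := by
    have hpt : ∀ j, x + ((m : ℝ) * v j) • EuclideanSpace.single j (1 : ℝ) ∈ S := by
      intro j
      have h1 := hconv.add_smul_mem hx (h (j, decide (0 ≤ v j))) (t := |v j| / t)
        ⟨by positivity, div_le_one_of_le₀ (hvj j) ht.le⟩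
      convert h1 using 2
      rw [axisPoint]
      ext i
      by_cases hi : i = j
      · subst hi
        rcases le_or_gt 0 (v i) with h0 | h0
        · simp [h0, abs_of_nonneg h0]; field_simp
        · simp [not_le.2 h0, abs_of_neg h0]; field_simp
      · simp [hi]
    have := hconv.sum_mem (t := Finset.univ) (w := fun _ : Fin m => (m : ℝ)⁻¹) (fun _ _ => by positivity)
      (by simp; field_simp) (fun j _ => hpt j)
    convert this using 1
    simp_rw [smul_add, Finset.sum_add_distrib, smul_smul]
    have hm0 : (m : ℝ) ≠ 0 := by positivity
    have h2 : ∀ j, (m : ℝ)⁻¹ * (m * v j) = v j := fun j => by field_simp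
    simp_rw [h2]
    congr 1
    · simp [← Nat.cast_smul_eq_nsmul ℝ, smul_smul, hm0]
    · ext i; simp [Finset.sum_apply, Pi.single_apply]
  simpa [v] using hmain

/-! ### The catchment area of a point -/

/-- The measure `G` is carried by `S` and has a density `g` that is Lipschitz and bounded above and
below on `S`. -/
structure LipDensity {m : ℕ} (S : Set (Cov m)) (κ Γ L : ℝ) (G : Measure (Cov m))
    (g : Cov m → ℝ) : Prop where
  meas : Measurable g
  eq : G = volume.withDensity (fun x => ENNReal.ofReal (g x))
  null : G Sᶜ = 0
  lower : ∀ x ∈ S, κ ≤ g x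
  upper : ∀ x ∈ S, g x ≤ Γ
  lip : ∀ x ∈ S, ∀ z ∈ S, |g z - g x| ≤ L * ‖x - z‖

namespace LipDensity

variable {m : ℕ} {S : Set (Cov m)} {κ Γ L : ℝ} {G : Measure (Cov m)} {g : Cov m → ℝ}

lemma apply_eq (h : LipDensity S κ Γ L G g) (hS : MeasurableSet S) {A : Set (Cov m)}
    (hA : MeasurableSet A) : G A = ∫⁻ x in A ∩ S, ENNReal.ofReal (g x) := by
  have h1 : G A = G (A ∩ S) := by
    refine le_antisymm ?_ (measure_mono Set.inter_subset_left)
    calc G A ≤ G (A ∩ S ∪ Sᶜ) := measure_mono fun x hx => by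
          by_cases hxS : x ∈ S
          · exact Or.inl ⟨hx, hxS⟩
          · exact Or.inr hxS
      _ ≤ G (A ∩ S) + G Sᶜ := measure_union_le _ _
      _ = G (A ∩ S) := by rw [h.null, add_zero]
  rw [h1, h.eq, withDensity_apply _ (hA.inter hS)]

lemma real_le (h : LipDensity S κ Γ L G g) (hS : MeasurableSet S) (hfin : volume S ≠ ⊤)
    {A : Set (Cov m)} (hA : MeasurableSet A) {c : ℝ} (hc : 0 ≤ c)
    (hg : ∀ z ∈ A ∩ S, g z ≤ c) : G.real A ≤ c * volume.real (A ∩ S) := by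
  have hfin' : volume (A ∩ S) ≠ ⊤ := ne_top_of_le_ne_top hfin (measure_mono Set.inter_subset_right)
  have : G A ≤ ENNReal.ofReal c * volume (A ∩ S) := by
    rw [h.apply_eq hS hA, ← setLIntegral_const]
    exact setLIntegral_mono measurable_const fun z hz => ENNReal.ofReal_le_ofReal (hg z hz)
  have h2 := ENNReal.toReal_mono (ENNReal.mul_ne_top ENNReal.ofReal_ne_top hfin') this
  rwa [ENNReal.toReal_mul, ENNReal.toReal_ofReal hc] at h2

lemma le_real (h : LipDensity S κ Γ L G g) [IsFiniteMeasure G] (hS : MeasurableSet S)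
    {A : Set (Cov m)} (hA : MeasurableSet A) {c : ℝ} (hc : 0 ≤ c)
    (hg : ∀ z ∈ A ∩ S, c ≤ g z) : c * volume.real (A ∩ S) ≤ G.real A := by
  have : ENNReal.ofReal c * volume (A ∩ S) ≤ G A := by
    rw [h.apply_eq hS hA, ← setLIntegral_const]
    exact setLIntegral_mono h.meas.ennreal_ofReal fun z hz => ENNReal.ofReal_le_ofReal (hg z hz)
  have h2 := ENNReal.toReal_mono (measure_ne_top G A) this
  rwa [ENNReal.toReal_mul, ENNReal.toReal_ofReal hc] at h2

end LipDensity

/-- The `G`-mass of the ball around `z` that has `x` on its boundary. -/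
noncomputable def reach {m : ℕ} (G : Measure (Cov m)) (x z : Cov m) : ℝ :=
  G.real (Metric.closedBall z (dist x z))

lemma measurable_reach {m : ℕ} (G : Measure (Cov m)) [IsFiniteMeasure G] :
    Measurable fun q : Cov m × Cov m => reach G q.1 q.2 := by
  have hs : MeasurableSet {w : (Cov m × Cov m) × Cov m | dist w.2 w.1.2 ≤ dist w.1.1 w.1.2} :=
    measurableSet_le (by fun_prop) (by fun_prop)
  exact (measurable_measure_prodMk_left (ν := G) hs).ennreal_toReal

lemma measurable_reach_right {m : ℕ} (G : Measure (Cov m)) [IsFiniteMeasure G] (x : Cov m) :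
    Measurable (reach G x) := by
  have h := (measurable_reach G).comp (measurable_prodMk_left (x := x))
  simpa only [Function.comp_def] using h

lemma measurableSet_reach_lt {m : ℕ} (G : Measure (Cov m)) [IsFiniteMeasure G] (x : Cov m)
    (τ : ℝ) : MeasurableSet {z | reach G x z < τ} :=
  measurableSet_lt (measurable_reach_right G x) measurable_const

/-- The inequalities behind the first-order expansion of the mass of a catchment area: `l` is the
oscillation of the densities `b`, `b'` on the scale of the area. -/
lemma abs_ratio_sub_le {κ Γ l b b' : ℝ} (hκ : 0 < κ) (hb : κ ≤ b) (hbΓ : b ≤ Γ)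
    (hbΓ' : b' ≤ Γ) (hl : 0 ≤ l) (hl2 : 2 * l ≤ κ / 2) :
    (b' + l) / (b - 2 * l) - b' / b ≤ 6 * Γ / κ ^ 2 * l ∧
      b' / b - (b' - l) / (b + 2 * l) ≤ 6 * Γ / κ ^ 2 * l := by
  have hb0 : 0 < b := by linarith
  have h1 : κ / 2 ≤ b - 2 * l := by linarith
  have h2 : 0 < b - 2 * l := by linarith
  have h3 : 0 < b + 2 * l := by linarith
  have hnum : 2 * b' * l + b * l ≤ 3 * Γ * l := by nlinarith
  have hΓ : 0 < Γ := by linarith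
  constructor
  · have : (b' + l) / (b - 2 * l) - b' / b = (2 * b' * l + b * l) / ((b - 2 * l) * b) := by
      rw [div_sub_div _ _ h2.ne' hb0.ne']; congr 1; ring
    rw [this]
    calc (2 * b' * l + b * l) / ((b - 2 * l) * b) ≤ 3 * Γ * l / (κ / 2 * κ) := by gcongr
      _ = 6 * Γ / κ ^ 2 * l := by field_simp; ring
  · have : b' / b - (b' - l) / (b + 2 * l) = (2 * b' * l + b * l) / (b * (b + 2 * l)) := by
      rw [div_sub_div _ _ hb0.ne' h3.ne']; congr 1; ring
    rw [this]
    calc (2 * b' * l + b * l) / (b * (b + 2 * l)) ≤ 3 * Γ * l / (κ * (κ / 2)) := by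
          gcongr; linarith
      _ = 6 * Γ / κ ^ 2 * l := by field_simp; ring

section Catchment

variable {m : ℕ} {S : Set (Cov m)} {κ Γ L a : ℝ} {G G' : Measure (Cov m)} {g g' : Cov m → ℝ}

/-- The points of `S` in the catchment area of `x` are close to `x`, by the volume fraction
condition. -/
lemma dist_le_rad_of_reach_lt (hm : 1 ≤ m) (hS : IsClosed S) (hbd : Bornology.IsBounded S)
    (h : LipDensity S κ Γ L G g) [IsFiniteMeasure G] (hκ : 0 < κ) (ha : 0 < a)
    (hfrac : ∀ z ∈ S, ∀ d, 0 < d → d ≤ Metric.diam S →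
      a * (ballVol m * d ^ m) ≤ volume.real (Metric.closedBall z d ∩ S))
    {x z : Cov m} (hx : x ∈ S) (hz : z ∈ S) {τ : ℝ} (hτ : 0 ≤ τ) (hr : reach G x z < τ) :
    dist x z ≤ rad m (τ / (κ * a)) := by
  rw [le_rad_iff hm (by positivity) dist_nonneg, le_div_iff₀ (by positivity)]
  rcases dist_nonneg (x := x) (y := z) |>.eq_or_lt with h0 | h0
  · rw [← h0, zero_pow (by omega)]; simpa using hτ
  have h1 := hfrac z hz _ h0 (Metric.dist_le_diam_of_mem hbd hx hz)
  have h2 := h.le_real hS.measurableSet (A := Metric.closedBall z (dist x z))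
    measurableSet_closedBall hκ.le (fun y hy => h.lower y hy.2)
  have h3 : κ * (a * (ballVol m * dist x z ^ m)) ≤ reach G x z :=
    (mul_le_mul_of_nonneg_left h1 hκ.le).trans h2
  nlinarith

/-- The mass of the catchment area is at most of the order of its level. -/
lemma catchment_le (hm : 1 ≤ m) (hS : IsClosed S) (hbd : Bornology.IsBounded S)
    (h : LipDensity S κ Γ L G g) (h' : LipDensity S κ Γ L G' g') [IsFiniteMeasure G]
    (hκ : 0 < κ) (hΓ : 0 < Γ) (ha : 0 < a)
    (hfrac : ∀ z ∈ S, ∀ d, 0 < d → d ≤ Metric.diam S →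
      a * (ballVol m * d ^ m) ≤ volume.real (Metric.closedBall z d ∩ S))
    {x : Cov m} (hx : x ∈ S) {τ : ℝ} (hτ : 0 ≤ τ) :
    G'.real {z | reach G x z < τ} ≤ Γ / (κ * a) * τ := by
  have hmeas : MeasurableSet {z | reach G x z < τ} :=
    measurableSet_reach_lt G x τ
  calc G'.real {z | reach G x z < τ} ≤ Γ * volume.real ({z | reach G x z < τ} ∩ S) :=
        h'.real_le hS.measurableSet hbd.measure_lt_top.ne hmeas hΓ.le fun z hz => h'.upper z hz.2
    _ ≤ Γ * volume.real (Metric.closedBall x (rad m (τ / (κ * a)))) := by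
        refine mul_le_mul_of_nonneg_left (measureReal_mono (fun z hz => ?_)
          measure_closedBall_lt_top.ne) hΓ.le
        rw [Metric.mem_closedBall, dist_comm]
        exact dist_le_rad_of_reach_lt hm hS hbd h hκ ha hfrac hx hz.2 hτ hz.1
    _ = Γ / (κ * a) * τ := by rw [volume_real_closedBall_rad hm x (by positivity)]; ring

/-- First-order expansion of the mass of a catchment area away from the boundary. -/
lemma catchment_interior (hm : 1 ≤ m) (hS : IsClosed S) (hbd : Bornology.IsBounded S)
    (h : LipDensity S κ Γ L G g) (h' : LipDensity S κ Γ L G' g') [IsFiniteMeasure G]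
    [IsFiniteMeasure G'] (hκ : 0 < κ) (ha : 0 < a) (ha1 : a < 1) (hL : 0 < L)
    (hfrac : ∀ z ∈ S, ∀ d, 0 < d → d ≤ Metric.diam S →
      a * (ballVol m * d ^ m) ≤ volume.real (Metric.closedBall z d ∩ S))
    {x : Cov m} (hx : x ∈ S) {τ : ℝ} (hτ : 0 ≤ τ)
    (hsub : Metric.closedBall x (2 * rad m (τ / (κ * a))) ⊆ S)
    (hsmall : 2 * (L * rad m (τ / (κ * a))) ≤ κ / 2) :
    |G'.real {z | reach G x z < τ} - g' x / g x * τ| ≤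
      6 * Γ / κ ^ 2 * (L * rad m (τ / (κ * a))) * τ := by
  set δ := rad m (τ / (κ * a))
  have hδ : 0 ≤ δ := rad_nonneg (by positivity)
  set A := {z | reach G x z < τ}
  have hmeas : MeasurableSet A :=
    measurableSet_reach_lt G x τ
  have hb := h.lower x hx
  have hb' := h'.lower x hx
  have hΓ : 0 ≤ Γ := by linarith [h.upper x hx]
  obtain ⟨hup, hlo⟩ := abs_ratio_sub_le hκ hb (h.upper x hx) (h'.upper x hx)
    (l := L * δ) (by positivity) hsmall
  have hlip : ∀ y ∈ S, dist y x ≤ 2 * δ → |g y - g x| ≤ 2 * (L * δ) := by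
    intro y hy hd
    refine (h.lip x hx y hy).trans ?_
    rw [← dist_eq_norm, dist_comm]; nlinarith
  have hlip' : ∀ y ∈ S, dist y x ≤ δ → |g' y - g' x| ≤ L * δ := by
    intro y hy hd
    refine (h'.lip x hx y hy).trans ?_
    rw [← dist_eq_norm, dist_comm]; nlinarith
  -- a ball around a point `z` near `x` that reaches `x` lies in `S`
  have hin : ∀ z, dist x z ≤ δ → ∀ y ∈ Metric.closedBall z (dist x z), dist y x ≤ 2 * δ := by
    intro z hz y hy
    have := dist_triangle y z x
    rw [Metric.mem_closedBall] at hy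
    rw [dist_comm z x] at this
    linarith
  have hball : ∀ z, dist x z ≤ δ → Metric.closedBall z (dist x z) ∩ S =
      Metric.closedBall z (dist x z) := fun z hz =>
    Set.inter_eq_left.2 fun y hy => hsub (Metric.mem_closedBall.2 (hin z hz y hy))
  have hlow : ∀ z, dist x z ≤ δ →
      (g x - 2 * (L * δ)) * (ballVol m * dist x z ^ m) ≤ reach G x z := by
    intro z hz
    have := h.le_real hS.measurableSet (A := Metric.closedBall z (dist x z))
      measurableSet_closedBall (c := g x - 2 * (L * δ)) (by linarith) (fun y hy => by
        have := (abs_le.1 (hlip y hy.2 (hin z hz y hy.1))).1; linarith)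
    rwa [hball z hz, volume_real_closedBall z dist_nonneg] at this
  have hupp : ∀ z, dist x z ≤ δ →
      reach G x z ≤ (g x + 2 * (L * δ)) * (ballVol m * dist x z ^ m) := by
    intro z hz
    have hLδ : 0 ≤ L * δ := by positivity
    have := h.real_le hS.measurableSet hbd.measure_lt_top.ne (A := Metric.closedBall z (dist x z))
      measurableSet_closedBall (c := g x + 2 * (L * δ)) (by linarith) (fun y hy => by
        have := (abs_le.1 (hlip y hy.2 (hin z hz y hy.1))).2; linarith)
    rwa [hball z hz, volume_real_closedBall z dist_nonneg] at this
  have hLδ : 0 ≤ L * δ := by positivity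
  have hgm : 0 < g x - 2 * (L * δ) := by linarith
  have hgp : 0 < g x + 2 * (L * δ) := by linarith
  have hclose : ∀ z ∈ A ∩ S, dist x z ≤ δ := fun z hz =>
    dist_le_rad_of_reach_lt hm hS hbd h hκ ha hfrac hx hz.2 hτ hz.1
  have upper : G'.real A ≤ (g' x + L * δ) * (τ / (g x - 2 * (L * δ))) := by
    calc G'.real A ≤ (g' x + L * δ) * volume.real (A ∩ S) :=
          h'.real_le hS.measurableSet hbd.measure_lt_top.ne hmeas (by linarith) fun z hz => by
            have := (abs_le.1 (hlip' z hz.2 (by rw [dist_comm]; exact hclose z hz))).2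
            linarith
      _ ≤ (g' x + L * δ) * volume.real (Metric.closedBall x (rad m (τ / (g x - 2 * (L * δ))))) := by
          refine mul_le_mul_of_nonneg_left (measureReal_mono (fun z hz => ?_)
            measure_closedBall_lt_top.ne) (by linarith)
          rw [Metric.mem_closedBall, dist_comm, le_rad_iff hm (by positivity) dist_nonneg,
            le_div_iff₀ hgm, mul_comm]
          exact (hlow z (hclose z hz)).trans (le_of_lt hz.1)
      _ = _ := by rw [volume_real_closedBall_rad hm x (by positivity)]
  have lower : (g' x - L * δ) * (τ / (g x + 2 * (L * δ))) ≤ G'.real A := by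
    set U := Metric.ball x (rad m (τ / (g x + 2 * (L * δ))))
    have hUδ : ∀ z ∈ U, dist x z ≤ δ := by
      intro z hz
      rw [Metric.mem_ball, dist_comm] at hz
      refine hz.le.trans (rad_mono (by positivity) ?_)
      gcongr
      nlinarith
    have hUS : U ∩ S = U := Set.inter_eq_left.2 fun z hz =>
      hsub (Metric.mem_closedBall.2 (by rw [dist_comm]; linarith [hUδ z hz]))
    calc (g' x - L * δ) * (τ / (g x + 2 * (L * δ))) = (g' x - L * δ) * volume.real (U ∩ S) := by
          rw [hUS, volume_real_ball_rad hm x (by positivity)]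
      _ ≤ G'.real U := h'.le_real hS.measurableSet measurableSet_ball (by linarith) fun z hz => by
            have := (abs_le.1 (hlip' z hz.2 (by rw [dist_comm]; exact hUδ z hz.1))).1
            linarith
      _ ≤ G'.real A := by
          refine measureReal_mono fun z hz => ?_
          refine (hupp z (hUδ z hz)).trans_lt ?_
          rw [Metric.mem_ball, dist_comm, ← not_le] at hz
          have hz' : dist x z ^ m < rad m (τ / (g x + 2 * (L * δ))) ^ m :=
            pow_lt_pow_left₀ (not_le.1 hz) dist_nonneg (by omega)
          have := ballVol_mul_rad_pow hm (v := τ / (g x + 2 * (L * δ))) (by positivity)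
          calc (g x + 2 * (L * δ)) * (ballVol m * dist x z ^ m)
              < (g x + 2 * (L * δ)) * (ballVol m * rad m (τ / (g x + 2 * (L * δ))) ^ m) := by
                have := ballVol_pos m
                gcongr
            _ = τ := by rw [this, mul_div_assoc', mul_div_cancel_left₀ _ hgp.ne']
  have e1 : (g' x + L * δ) * (τ / (g x - 2 * (L * δ))) =
      (g' x + L * δ) / (g x - 2 * (L * δ)) * τ := by ring
  have e2 : (g' x - L * δ) * (τ / (g x + 2 * (L * δ))) =
      (g' x - L * δ) / (g x + 2 * (L * δ)) * τ := by ring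
  rw [e1] at upper
  rw [e2] at lower
  have u1 := mul_le_mul_of_nonneg_right hup hτ
  have u2 := mul_le_mul_of_nonneg_right hlo hτ
  rw [abs_le]
  constructor <;> nlinarith

/-- The constant in the expansion of the mass of a catchment area. -/
noncomputable def catchConst (κ Γ L a : ℝ) : ℝ :=
  6 * Γ / κ ^ 2 * L + Γ / (κ * a) * (4 * L / κ) + Γ / (κ * a)

open Classical in
/-- Expansion of the mass of a catchment area, with the error term that the boundary requires. -/
lemma catchment_approx (hm : 1 ≤ m) (hS : IsClosed S) (hbd : Bornology.IsBounded S)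
    (h : LipDensity S κ Γ L G g) (h' : LipDensity S κ Γ L G' g') [IsFiniteMeasure G]
    [IsFiniteMeasure G'] (hκ : 0 < κ) (hΓ : 0 < Γ) (ha : 0 < a) (ha1 : a < 1) (hL : 0 < L)
    (hfrac : ∀ z ∈ S, ∀ d, 0 < d → d ≤ Metric.diam S →
      a * (ballVol m * d ^ m) ≤ volume.real (Metric.closedBall z d ∩ S))
    {x : Cov m} (hx : x ∈ S) {τ : ℝ} (hτ : 0 ≤ τ) :
    |G'.real {z | reach G x z < τ} - g' x / g x * τ| ≤
      catchConst κ Γ L a * τ * (rad m (τ / (κ * a)) +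
        if Metric.closedBall x (2 * rad m (τ / (κ * a))) ⊆ S then 0 else 1) := by
  set δ := rad m (τ / (κ * a))
  have hδ : 0 ≤ δ := rad_nonneg (by positivity)
  have hb := h.lower x hx
  have hb' := h'.lower x hx
  have hcrude : |G'.real {z | reach G x z < τ} - g' x / g x * τ| ≤ Γ / (κ * a) * τ := by
    have h1 := catchment_le hm hS hbd h h' hκ hΓ ha hfrac hx hτ
    have h2 : g' x / g x * τ ≤ Γ / (κ * a) * τ := by
      gcongr
      · exact h'.upper x hx
      · nlinarith
    have h3 : 0 ≤ g' x / g x * τ :=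
      mul_nonneg (div_nonneg (hκ.le.trans hb') (hκ.le.trans hb)) hτ
    have h4 : 0 ≤ G'.real {z | reach G x z < τ} := measureReal_nonneg
    rw [abs_le]; constructor <;> linarith
  have c1 : 0 ≤ 6 * Γ / κ ^ 2 * L := by positivity
  have c2 : 0 ≤ Γ / (κ * a) * (4 * L / κ) := by positivity
  have c3 : 0 ≤ Γ / (κ * a) := by positivity
  have hδτ : 0 ≤ τ * δ := by positivity
  unfold catchConst
  split_ifs with hsub
  · rw [add_zero]
    rcases le_or_gt (2 * (L * δ)) (κ / 2) with hs | hs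
    · have := catchment_interior hm hS hbd h h' hκ ha ha1 hL hfrac hx hτ hsub hs
      nlinarith [mul_nonneg c2 hδτ, mul_nonneg c3 hδτ]
    · -- here the radius is bounded below, and the crude bound suffices
      have h1 : 1 ≤ 4 * L / κ * δ := by
        rw [div_mul_eq_mul_div, le_div_iff₀ hκ]; linarith
      have h2 : Γ / (κ * a) * τ ≤ Γ / (κ * a) * τ * (4 * L / κ * δ) :=
        le_mul_of_one_le_right (by positivity) h1
      nlinarith [mul_nonneg c1 hδτ, mul_nonneg c3 hδτ]
  · have : Γ / (κ * a) * τ ≤ Γ / (κ * a) * τ * (δ + 1) :=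
      le_mul_of_one_le_right (by positivity) (by linarith)
    have h3 : 0 ≤ τ * (δ + 1) := by positivity
    nlinarith [mul_nonneg c1 h3, mul_nonneg c2 h3]

end Catchment

/-! ### Resampling one unit of an i.i.d. sample -/

section Resample

variable {α : Type*} [MeasurableSpace α] {n : ℕ} (P : Measure α) [IsProbabilityMeasure P]

lemma measurable_update_prod (i : Fin n) :
    Measurable fun q : α × (Fin n → α) => Function.update q.2 i q.1 := by
  refine measurable_pi_lambda _ fun j => ?_
  by_cases h : j = i
  · subst h; simpa using measurable_fst
  · simpa [h, Function.comp_def] using (measurable_pi_apply (X := fun _ : Fin n => α) j).comp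
      (measurable_snd (α := α))

/-- Replacing one unit of an i.i.d. sample by an independent copy does not change the law. -/
lemma measurePreserving_update (i : Fin n) :
    MeasurePreserving (fun q : α × (Fin n → α) => Function.update q.2 i q.1)
      (P.prod (Measure.pi fun _ => P)) (Measure.pi fun _ => P) := by
  refine ⟨measurable_update_prod i, (Measure.pi_eq fun B hB => ?_).symm⟩
  rw [Measure.map_apply (measurable_update_prod i) (MeasurableSet.univ_pi hB)]
  have : (fun q : α × (Fin n → α) => Function.update q.2 i q.1) ⁻¹' Set.univ.pi B =
      B i ×ˢ Set.univ.pi (Function.update B i Set.univ) := by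
    ext ⟨y, s⟩
    simp only [Set.mem_preimage, Set.mem_pi, Set.mem_univ, true_imp_iff, Set.mem_prod]
    constructor
    · intro h
      refine ⟨by simpa using h i, fun j => ?_⟩
      by_cases hj : j = i
      · subst hj; simp
      · simpa [hj] using h j
    · rintro ⟨h1, h2⟩ j
      by_cases hj : j = i
      · subst hj; simpa using h1
      · simpa [hj] using h2 j
  rw [this, Measure.prod_prod, Measure.pi_pi, ← Finset.mul_prod_erase _ _ (Finset.mem_univ i),
    ← Finset.mul_prod_erase _ _ (Finset.mem_univ i)]
  simp only [Function.update_self, measure_univ, one_mul]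
  congr 1
  refine Finset.prod_congr rfl fun j hj => ?_
  rw [Function.update_of_ne (Finset.ne_of_mem_erase hj)]

variable {P}

lemma Integrable.comp_update {f : (Fin n → α) → ℝ} (hf : Integrable f (Measure.pi fun _ => P))
    (i : Fin n) : Integrable (fun q : α × (Fin n → α) => f (Function.update q.2 i q.1))
      (P.prod (Measure.pi fun _ => P)) :=
  (measurePreserving_update P i).integrable_comp_of_integrable hf

lemma integral_resample {f : (Fin n → α) → ℝ} (hf : Integrable f (Measure.pi fun _ => P))
    (i : Fin n) : ∫ s, f s ∂(Measure.pi fun _ => P) =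
      ∫ y, ∫ s, f (Function.update s i y) ∂(Measure.pi fun _ => P) ∂P := by
  rw [← integral_prod _ (Integrable.comp_update hf i)]
  conv_lhs => rw [← (measurePreserving_update P i).map_eq]
  rw [integral_map (measurable_update_prod i).aemeasurable]
  rw [(measurePreserving_update P i).map_eq]
  exact hf.1

lemma measure_resample {E : Set (Fin n → α)} (hE : MeasurableSet E) (i : Fin n) :
    (Measure.pi fun _ => P) E =
      ∫⁻ y, (Measure.pi fun _ => P) {s | Function.update s i y ∈ E} ∂P := by
  conv_lhs => rw [← (measurePreserving_update P i).map_eq]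
  rw [Measure.map_apply (measurable_update_prod i) hE,
    Measure.prod_apply (measurable_update_prod i hE)]
  rfl

open Classical in
lemma measurableSet_card_lt {Ω : Type*} [MeasurableSpace Ω] {n : ℕ} (T : Finset (Fin n))
    (p : Fin n → Ω → Prop) (hp : ∀ l ∈ T, MeasurableSet {o | p l o}) (M : ℕ) :
    MeasurableSet {o | (T.filter fun l => p l o).card < M} := by
  have : Measurable fun o => (T.filter fun l => p l o).card := by
    simp_rw [Finset.card_filter]
    exact Finset.measurable_fun_sum _ fun l hl =>
      Measurable.ite (hp l hl) measurable_const measurable_const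
  exact this (measurableSet_Iio (a := M))

open Classical in
/-- The number of sample points, among the indices in `T`, that fall in `A` is binomial. -/
lemma measure_card_lt (T : Finset (Fin n)) {A : Set α} (hA : MeasurableSet A) (M : ℕ) :
    (Measure.pi fun _ => P) {s | (T.filter fun l => s l ∈ A).card < M} =
      ENNReal.ofReal (binCdf T.card M (P.real A)) := by
  induction T using Finset.induction_on generalizing M with
  | empty =>
    rcases M with _ | M
    · simp [binCdf_zero_right]
    · simp [binCdf_zero_left]
  | insert a T ha ih =>
    rcases M with _ | M
    · simp [binCdf_zero_right]
    rw [measure_resample (measurableSet_card_lt _ _ (fun l _ => measurable_pi_apply l hA) _) a]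
    have hT : ∀ (y : α) (s : Fin n → α), (T.filter fun l => Function.update s a y l ∈ A) =
        T.filter fun l => s l ∈ A := fun y s => Finset.filter_congr fun l hl => by
      rw [Function.update_of_ne (by rintro rfl; exact ha hl)]
    have h1 : ∀ y, (Measure.pi fun _ => P)
        {s | Function.update s a y ∈
          {s : Fin n → α | ((insert a T).filter fun l => s l ∈ A).card < M + 1}} =
        A.indicator (fun _ => ENNReal.ofReal (binCdf T.card M (P.real A))) y +
        Aᶜ.indicator (fun _ => ENNReal.ofReal (binCdf T.card (M + 1) (P.real A))) y := by
      intro y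
      by_cases hy : y ∈ A
      · rw [Set.indicator_of_mem hy, Set.indicator_of_notMem (by simpa using hy), add_zero, ← ih]
        congr 1; ext s
        simp only [Set.mem_ofPred_eq, Finset.filter_insert, Function.update_self, hy, if_true, hT]
        rw [Finset.card_insert_of_notMem (by simp [ha])]
        omega
      · rw [Set.indicator_of_notMem hy, Set.indicator_of_mem (by simpa using hy), zero_add, ← ih]
        congr 1; ext s
        simp only [Set.mem_ofPred_eq, Finset.filter_insert, Function.update_self, hy, if_false, hT]
    simp_rw [h1]
    have hp0 : 0 ≤ P.real A := measureReal_nonneg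
    have hp1 : P.real A ≤ 1 := measureReal_le_one
    have hq : ∀ N M, 0 ≤ binCdf N M (P.real A) := fun N M => by
      have : 0 ≤ 1 - P.real A := by linarith
      unfold binCdf; positivity
    have hA0 : P A = ENNReal.ofReal (P.real A) := by rw [ofReal_measureReal]
    have hA1 : P Aᶜ = ENNReal.ofReal (1 - P.real A) := by
      rw [prob_compl_eq_one_sub hA, ENNReal.ofReal_sub _ hp0, ENNReal.ofReal_one, ofReal_measureReal]
    rw [lintegral_add_left (measurable_const.indicator hA), lintegral_indicator_const hA,
      lintegral_indicator_const hA.compl, Finset.card_insert_of_notMem ha, binCdf_succ,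
      ENNReal.ofReal_add (mul_nonneg hp0 (hq _ _)) (mul_nonneg (by linarith) (hq _ _)),
      ENNReal.ofReal_mul hp0, ENNReal.ofReal_mul (by linarith), ← hA0, ← hA1, mul_comm,
      mul_comm (P Aᶜ)]

end Resample

/-! ### The number of times a unit is matched -/

lemma measurable_treat {m : ℕ} : Measurable (treat : Pop m → Bool) :=
  measurable_fst.comp measurable_snd

lemma measurableSet_treat_eq {m : ℕ} (w : Bool) : MeasurableSet {u : Pop m | treat u = w} :=
  measurable_treat (measurableSet_singleton w)

/-- The units with label `w` whose covariate is at least as close to `z` as `x` is. -/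
def near {m : ℕ} (w : Bool) (x z : Cov m) : Set (Pop m) :=
  {u | treat u = w ∧ dist (cov u) z ≤ dist x z}

lemma measurableSet_near_pair {m : ℕ} (w : Bool) (x : Cov m) :
    MeasurableSet {q : Pop m × Pop m | q.2 ∈ near w x (cov q.1)} := by
  have h1 : MeasurableSet {q : Pop m × Pop m | treat q.2 = w} :=
    measurable_snd (measurableSet_treat_eq w)
  have hc1 : Measurable fun q : Pop m × Pop m => cov q.1 := measurable_cov.comp measurable_fst
  have hc2 : Measurable fun q : Pop m × Pop m => cov q.2 := measurable_cov.comp measurable_snd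
  exact h1.inter (measurableSet_le (hc2.dist hc1) (measurable_const.dist hc1))

lemma measurableSet_near {m : ℕ} (w : Bool) (x z : Cov m) : MeasurableSet (near w x z) :=
  (measurableSet_treat_eq w).inter
    (measurableSet_le (measurable_cov.dist measurable_const) measurable_const)

lemma measurable_prob_near {m : ℕ} (P : Measure (Pop m)) [IsProbabilityMeasure P] (w : Bool)
    (x : Cov m) : Measurable fun u : Pop m => P.real (near w x (cov u)) :=
  (measurable_measure_prodMk_left (ν := P) (measurableSet_near_pair w x)).ennreal_toReal

/-- The catchment area of `(x, w)` at level `t`: the units with the opposite label from which `x` is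
reached by a ball that contains units with label `w` with probability less than `t`. -/
def catchSet {m : ℕ} (P : Measure (Pop m)) (w : Bool) (x : Cov m) (t : ℝ) : Set (Pop m) :=
  {u | treat u = !w ∧ P.real (near w x (cov u)) < t}

lemma measurableSet_catchSet_pair {m : ℕ} (P : Measure (Pop m)) [IsProbabilityMeasure P] (w : Bool)
    (x : Cov m) : MeasurableSet {q : Pop m × ℝ | q.1 ∈ catchSet P w x q.2} := by
  have h1 : MeasurableSet {q : Pop m × ℝ | treat q.1 = !w} :=
    measurable_fst (measurableSet_treat_eq _)
  exact h1.inter (measurableSet_lt ((measurable_prob_near P w x).comp measurable_fst) measurable_snd)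

lemma measurable_measure_catchSet {m : ℕ} (P : Measure (Pop m)) [IsProbabilityMeasure P] (w : Bool)
    (x : Cov m) : Measurable fun t => P (catchSet P w x t) :=
  measurable_measure_prodMk_right (μ := P) (measurableSet_catchSet_pair P w x)

open Classical in
/-- The event that, in a sample whose unit `i` has covariate `x` and label `w`, unit `i` is among
the `M` nearest neighbours of unit `j`, which has the opposite label. -/
def matchEvent {m n : ℕ} (w : Bool) (x : Cov m) (M : ℕ) (i j : Fin n) : Set (Fin n → Pop m) :=
  {s | treat (s j) = !w ∧
    (((Finset.univ.erase i).erase j).filter fun l => s l ∈ near w x (cov (s j))).card < M}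

open Classical in
lemma matched_update {m n : ℕ} {w : Bool} (M : ℕ) (i : Fin n) (s : Fin n → Pop m) {y : Pop m}
    (hy : treat y = w) : matched M w i (Function.update s i y) =
      ((Finset.univ.erase i).filter fun j => s ∈ matchEvent w (cov y) M i j).card := by
  unfold matched
  congr 1
  ext j
  simp only [Finset.mem_filter, Finset.mem_univ, true_and, Finset.mem_erase, and_true]
  by_cases hji : j = i
  · subst hji
    simp [hy]
  simp only [Function.update_of_ne hji, hji, not_false_eq_true, true_and, ne_eq, matchEvent,
    Set.mem_ofPred_eq]
  refine and_congr_right fun hj => ?_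
  have hset : (Finset.univ.filter fun l => treat (Function.update s i y l) = w ∧
      dist (cov (Function.update s i y l)) (cov (s j)) ≤ dist (cov y) (cov (s j))) =
      insert i (((Finset.univ.erase i).erase j).filter fun l =>
        s l ∈ near w (cov y) (cov (s j))) := by
    ext l
    rw [Finset.mem_insert, Finset.mem_filter, Finset.mem_filter, Finset.mem_erase, Finset.mem_erase]
    simp only [Finset.mem_univ, true_and, and_true, near, Set.mem_ofPred_eq]
    by_cases hli : l = i
    · subst hli; simp [hy]
    · rw [Function.update_of_ne hli]
      by_cases hlj : l = j
      · subst hlj; simp [hj, hli]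
      · simp [hli, hlj]
  simp only [nnSet, Finset.mem_filter, Finset.mem_univ, true_and, Function.update_self, hy,
    Function.update_of_ne hji]
  rw [hset, Finset.card_insert_of_notMem (by simp)]
  omega

section Probabilities

variable {m n : ℕ} (P : Measure (Pop m)) [IsProbabilityMeasure P] (w : Bool) (x : Cov m) (M : ℕ)

lemma measurableSet_matchEvent (i j : Fin n) : MeasurableSet (matchEvent w x M i j) := by
  have h1 : MeasurableSet {s : Fin n → Pop m | treat (s j) = !w} :=
    (measurable_treat.comp (measurable_pi_apply j)) (measurableSet_singleton _)
  refine h1.inter (measurableSet_card_lt _ _ (fun l _ => ?_) M)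
  have : Measurable fun s : Fin n → Pop m => (s j, s l) :=
    (measurable_pi_apply j).prodMk (measurable_pi_apply l)
  exact this (measurableSet_near_pair w x)

variable {M}

lemma orderLaw_Ioi_prob_near {N : ℕ} (hM : M ≤ N) (A : Set (Pop m)) :
    ENNReal.ofReal (binCdf N M (P.real A)) = orderLaw N M (Set.Ioi (P.real A)) :=
  (orderLaw_Ioi hM measureReal_nonneg measureReal_le_one).symm

/-- The probability of a match, in terms of the masses of the catchment areas. -/
lemma measure_matchEvent {i j : Fin n} (hij : j ≠ i) (hM : M ≤ n - 2) :
    sampleLaw n P (matchEvent w x M i j) = ∫⁻ t, P (catchSet P w x t) ∂orderLaw (n - 2) M := by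
  classical
  rw [sampleLaw, measure_resample (measurableSet_matchEvent w x M i j) j]
  have h1 : ∀ u, (Measure.pi fun _ : Fin n => P)
      {s | Function.update s j u ∈ matchEvent w x M i j} =
      orderLaw (n - 2) M (Prod.mk u ⁻¹' {q : Pop m × ℝ | q.1 ∈ catchSet P w x q.2}) := by
    intro u
    by_cases hu : treat u = !w
    · have hT : (((Finset.univ : Finset (Fin n)).erase i).erase j).card = n - 2 := by
        rw [Finset.card_erase_of_mem (by simp [hij]), Finset.card_erase_of_mem (Finset.mem_univ _)]
        simp; omega
      have h2 := measure_card_lt (P := P) ((Finset.univ.erase i).erase j)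
        (measurableSet_near w x (cov u)) M
      rw [hT, orderLaw_Ioi_prob_near P hM] at h2
      convert h2 using 2
      · ext s
        simp only [matchEvent, Set.mem_ofPred_eq, Function.update_self, hu, true_and]
        rw [Finset.filter_congr (fun l hl => by
          rw [Function.update_of_ne (Finset.ne_of_mem_erase hl)])]
      · ext t
        simp [catchSet, hu]
    · simp [matchEvent, catchSet, hu]
  simp_rw [h1]
  rw [← Measure.prod_apply (measurableSet_catchSet_pair P w x),
    Measure.prod_apply_symm (measurableSet_catchSet_pair P w x)]
  rfl

/-- The probability of two simultaneous matches: it is at most the probability of the match over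
the larger distance, with one unit fewer. -/
lemma measure_matchEvent_inter_le {i j k : Fin n} (hij : j ≠ i) (hik : k ≠ i) (hjk : j ≠ k)
    (hM : M ≤ n - 3) :
    sampleLaw n P (matchEvent w x M i j ∩ matchEvent w x M i k) ≤
      ∫⁻ t, P (catchSet P w x t) ^ 2 ∂orderLaw (n - 3) M := by
  classical
  set T : Finset (Fin n) := ((Finset.univ.erase i).erase j).erase k
  have hT : T.card = n - 3 := by
    rw [Finset.card_erase_of_mem (by simp [hik, hjk.symm]), Finset.card_erase_of_mem (by simp [hij]),
      Finset.card_erase_of_mem (Finset.mem_univ _)]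
    simp; omega
  have hE : MeasurableSet (matchEvent w x M i j ∩ matchEvent w x M i k) :=
    (measurableSet_matchEvent w x M i j).inter (measurableSet_matchEvent w x M i k)
  set D : Set ((Pop m × Pop m) × ℝ) :=
    {q | q.1.1 ∈ catchSet P w x q.2 ∧ q.1.2 ∈ catchSet P w x q.2}
  have hD : MeasurableSet D := by
    have m1 : Measurable fun q : (Pop m × Pop m) × ℝ => (q.1.1, q.2) := by fun_prop
    have m2 : Measurable fun q : (Pop m × Pop m) × ℝ => (q.1.2, q.2) := by fun_prop
    exact (m1 (measurableSet_catchSet_pair P w x)).inter (m2 (measurableSet_catchSet_pair P w x))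
  have h1 : ∀ u v, (Measure.pi fun _ : Fin n => P)
      {s | Function.update (Function.update s k v) j u ∈
        matchEvent w x M i j ∩ matchEvent w x M i k} ≤
      orderLaw (n - 3) M (Prod.mk (u, v) ⁻¹' D) := by
    intro u v
    have hupd : ∀ s : Fin n → Pop m, ∀ l ∈ T, Function.update (Function.update s k v) j u l = s l := by
      intro s l hl
      simp only [T, Finset.mem_erase] at hl
      rw [Function.update_of_ne hl.2.1, Function.update_of_ne hl.1]
    have hle : ∀ (b : Fin n) (z : Cov m) (s : Fin n → Pop m), T ⊆ (Finset.univ.erase i).erase b →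
        (((Finset.univ.erase i).erase b).filter fun l =>
          Function.update (Function.update s k v) j u l ∈ near w x z).card < M →
        (T.filter fun l => s l ∈ near w x z).card < M := by
      intro b z s hTb h
      refine lt_of_le_of_lt (Finset.card_le_card fun l hl => ?_) h
      rw [Finset.mem_filter] at hl ⊢
      exact ⟨hTb hl.1, by rw [hupd s l hl.1]; exact hl.2⟩
    by_cases hu : treat u = !w
    swap
    · simp [matchEvent, hu]
    by_cases hv : treat v = !w
    swap
    · simp [matchEvent, hv, hjk.symm]
    have hprob : ∀ z : Cov m, (Measure.pi fun _ : Fin n => P)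
        {s | (T.filter fun l => s l ∈ near w x z).card < M} =
        orderLaw (n - 3) M (Set.Ioi (P.real (near w x z))) := by
      intro z
      rw [measure_card_lt T (measurableSet_near w x z) M, hT, orderLaw_Ioi_prob_near P hM]
    have hDeq : Prod.mk (u, v) ⁻¹' D =
        Set.Ioi (P.real (near w x (cov u))) ∩ Set.Ioi (P.real (near w x (cov v))) := by
      ext t; simp [D, catchSet, hu, hv]
    rw [hDeq, Set.Ioi_inter_Ioi]
    rcases max_choice (P.real (near w x (cov u))) (P.real (near w x (cov v))) with h | h
    · rw [h, ← hprob]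
      refine measure_mono fun s hs => hle j _ s (Finset.erase_subset _ _) ?_
      simpa using hs.1.2
    · rw [h, ← hprob]
      refine measure_mono fun s hs => hle k _ s ?_ ?_
      · intro l hl
        simp only [T, Finset.mem_erase] at hl ⊢
        exact ⟨hl.1, hl.2.2⟩
      · simpa [Function.update_of_ne hjk.symm] using hs.2.2
  have h2 : ∀ u, (Measure.pi fun _ : Fin n => P)
      {s | Function.update s j u ∈ matchEvent w x M i j ∩ matchEvent w x M i k} ≤
      ∫⁻ v, orderLaw (n - 3) M (Prod.mk (u, v) ⁻¹' D) ∂P := by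
    intro u
    have hm : Measurable fun s : Fin n → Pop m => Function.update s j u :=
      (measurable_update_prod j).comp measurable_prodMk_left
    refine (measure_resample (hm hE) k).trans_le ?_
    exact lintegral_mono fun v => h1 u v
  rw [sampleLaw, measure_resample hE j]
  refine (lintegral_mono h2).trans (le_of_eq ?_)
  have hmeas : Measurable fun q : Pop m × Pop m => orderLaw (n - 3) M (Prod.mk q ⁻¹' D) :=
    measurable_measure_prodMk_left hD
  rw [← lintegral_prod (μ := P) (ν := P) (fun q => orderLaw (n - 3) M (Prod.mk q ⁻¹' D))
    hmeas.aemeasurable, ← Measure.prod_apply hD, Measure.prod_apply_symm hD]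
  refine lintegral_congr fun t => ?_
  have : (fun q : Pop m × Pop m => (q, t)) ⁻¹' D = catchSet P w x t ×ˢ catchSet P w x t := by
    ext q; simp [D]
  rw [this, Measure.prod_prod, sq]

end Probabilities

/-! ### The variance of the main term -/

section Measurability

variable {m n : ℕ} {Ω : Type*} [MeasurableSpace Ω] {S : Ω → Fin n → Pop m}

lemma measurable_matched (hc : ∀ l, Measurable fun o => cov (S o l))
    (ht : ∀ l, Measurable fun o => treat (S o l)) (M : ℕ) (w : Bool) (i : Fin n) :
    Measurable fun o => matched M w i (S o) := by
  classical
  have htw : ∀ l w, MeasurableSet {o | treat (S o l) = w} := fun l w =>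
    ht l (measurableSet_singleton w)
  have hnn : ∀ j, MeasurableSet {o | i ∈ nnSet M w j (S o)} := by
    intro j
    have h := measurableSet_card_lt Finset.univ
      (fun l o => treat (S o l) = w ∧ dist (cov (S o l)) (cov (S o j)) ≤
        dist (cov (S o i)) (cov (S o j)))
      (fun l _ => (htw l w).inter (measurableSet_le ((hc l).dist (hc j)) ((hc i).dist (hc j))))
      (M + 1)
    convert (htw i w).inter h using 1
    ext o
    simp only [nnSet, Finset.mem_filter, Finset.mem_univ, true_and, Set.mem_inter_iff,
      Set.mem_ofPred_eq, Nat.lt_succ_iff]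
    congr!
  unfold matched
  simp_rw [Finset.card_filter]
  exact Finset.measurable_fun_sum _ fun j _ =>
    Measurable.ite ((htw j _).inter (hnn j)) measurable_const measurable_const

/-- The weight `(2 D_i - 1) (1 + K_M(i) / M)` of the error of unit `i`. -/
noncomputable def weight (M : ℕ) (i : Fin n) (s : Fin n → Pop m) : ℝ :=
  (if treat (s i) then (1 : ℝ) else -1) * (1 + (matched M (treat (s i)) i s : ℝ) / M)

lemma measurable_weight (hc : ∀ l, Measurable fun o => cov (S o l))
    (ht : ∀ l, Measurable fun o => treat (S o l)) (M : ℕ) (i : Fin n) :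
    Measurable fun o => weight M i (S o) := by
  have h1 : (fun o => weight M i (S o)) = fun o =>
      if treat (S o i) = true then (1 : ℝ) * (1 + (matched M true i (S o) : ℝ) / M)
      else (-1) * (1 + (matched M false i (S o) : ℝ) / M) := by
    ext o
    unfold weight
    cases h : treat (S o i) <;> simp
  have hm : ∀ w, Measurable fun o => ((matched M w i (S o) : ℕ) : ℝ) := fun w =>
    measurable_from_top.comp (measurable_matched hc ht M w i)
  rw [h1]
  exact Measurable.ite (ht i (measurableSet_singleton true))
    (((hm true).div_const _).const_add _ |>.const_mul _)
    (((hm false).div_const _).const_add _ |>.const_mul _)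

lemma matched_le (M : ℕ) (w : Bool) (i : Fin n) (s : Fin n → Pop m) : matched M w i s ≤ n := by
  classical
  unfold matched
  exact (Finset.card_le_univ _).trans (by simp)

lemma weight_sq (M : ℕ) (i : Fin n) (s : Fin n → Pop m) :
    weight M i s ^ 2 = (1 + (matched M (treat (s i)) i s : ℝ) / M) ^ 2 := by
  unfold weight
  split_ifs <;> ring

lemma abs_weight_le {M : ℕ} (hM : 1 ≤ M) (i : Fin n) (s : Fin n → Pop m) :
    |weight M i s| ≤ 1 + n := by
  have hM' : (1 : ℝ) ≤ M := by exact_mod_cast hM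
  have h0 : (0 : ℝ) ≤ (matched M (treat (s i)) i s : ℝ) / M := by positivity
  have h1 : (matched M (treat (s i)) i s : ℝ) / M ≤ n := by
    rw [div_le_iff₀ (by linarith)]
    have : (matched M (treat (s i)) i s : ℝ) ≤ n := by exact_mod_cast matched_le M _ i s
    nlinarith [Nat.cast_nonneg (α := ℝ) n]
  rw [weight, abs_mul, abs_of_nonneg (by linarith : 0 ≤ 1 + (matched M (treat (s i)) i s : ℝ) / M)]
  split_ifs <;> simp <;> linarith

end Measurability

lemma measurable_potential {m : ℕ} (w : Bool) : Measurable (potential w : Pop m → ℝ) := by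
  cases w
  · exact (measurable_fst.comp (measurable_snd.comp measurable_snd) :
      Measurable fun s : Pop m => s.2.2.1)
  · exact (measurable_snd.comp (measurable_snd.comp measurable_snd) :
      Measurable fun s : Pop m => s.2.2.2)

/-- The deviation `Y(w) - μ_w(X)` of a potential outcome. -/
def dev {m : ℕ} (μ : Bool → Cov m → ℝ) (w : Bool) (s : Pop m) : ℝ := potential w s - μ w (cov s)

lemma err_eq_dev {m : ℕ} (μ : Bool → Cov m → ℝ) {s : Pop m} {w : Bool} (h : treat s = w) :
    err μ s = dev μ w s := by
  subst h; rfl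

section Variance

variable {m : ℕ} {P : Measure (Pop m)} [IsProbabilityMeasure P] {μ : Bool → Cov m → ℝ}

lemma measurable_dev (hμ : ∀ w, Measurable (μ w)) (w : Bool) : Measurable (dev μ w) :=
  (measurable_potential w).sub ((hμ w).comp measurable_cov)

lemma measurable_err (hμ : ∀ w, Measurable (μ w)) : Measurable (err μ) := by
  have h1 : err μ = fun s => if treat s = true then dev μ true s else dev μ false s := by
    ext s
    cases h : treat s
    · simp [err_eq_dev μ h]
    · simp [err_eq_dev μ h]
  rw [h1]
  exact Measurable.ite (measurableSet_treat_eq true) (measurable_dev hμ true) (measurable_dev hμ false)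

lemma sq_le_one_add_rpow (t : ℝ) {p : ℝ} (hp : 0 < p) : t ^ 2 ≤ 1 + |t| ^ (4 + p) := by
  have h0 : 0 ≤ |t| ^ (4 + p) := by positivity
  rcases le_or_gt |t| 1 with h | h
  · have : t ^ 2 ≤ 1 := by rw [← sq_abs]; exact pow_le_one₀ (abs_nonneg t) h
    linarith
  · have : |t| ^ (2 : ℝ) ≤ |t| ^ (4 + p) := Real.rpow_le_rpow_of_exponent_le h.le (by linarith)
    rw [Real.rpow_two, sq_abs] at this
    linarith

variable {c : Constants} {p : ℝ}

lemma AssumptionB.memLp_dev (hB : AssumptionB c p P μ) (w : Bool) : MemLp (dev μ w) 2 P := by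
  have hm := measurable_dev hB.regression.measurable w
  rw [memLp_two_iff_integrable_sq hm.aestronglyMeasurable]
  refine ((integrable_const 1).add (hB.moment_integrable w)).mono'
    (hm.pow_const 2).aestronglyMeasurable (Eventually.of_forall fun s => ?_)
  rw [Real.norm_of_nonneg (sq_nonneg _)]
  exact sq_le_one_add_rpow _ hB.p_pos

lemma AssumptionB.memLp_err (hB : AssumptionB c p P μ) : MemLp (err μ) 2 P := by
  have hm := measurable_err hB.regression.measurable
  rw [memLp_two_iff_integrable_sq hm.aestronglyMeasurable]
  refine (((hB.memLp_dev true).integrable_sq).add ((hB.memLp_dev false).integrable_sq)).mono'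
    (hm.pow_const 2).aestronglyMeasurable (Eventually.of_forall fun s => ?_)
  rw [Real.norm_of_nonneg (sq_nonneg _)]
  simp only [Pi.add_apply]
  cases h : treat s
  · rw [err_eq_dev μ h]; nlinarith [sq_nonneg (dev μ true s)]
  · rw [err_eq_dev μ h]; nlinarith [sq_nonneg (dev μ false s)]

lemma sigmaXD_le (m : ℕ) : sigmaXD m ≤ (inferInstance : MeasurableSpace (Pop m)) :=
  (measurable_cov.prodMk measurable_treat).comap_le

lemma measurable_cov_sigmaXD (m : ℕ) : Measurable[sigmaXD m] (cov : Pop m → Cov m) :=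
  fun A hA => ⟨Prod.fst ⁻¹' A, measurable_fst hA, rfl⟩

lemma measurable_treat_sigmaXD (m : ℕ) : Measurable[sigmaXD m] (treat : Pop m → Bool) :=
  fun A hA => ⟨Prod.snd ⁻¹' A, measurable_snd hA, rfl⟩

lemma measurable_regression_sigmaXD (hμ : ∀ w, Measurable (μ w)) :
    Measurable[sigmaXD m] fun s : Pop m => μ (treat s) (cov s) := by
  have h1 : (fun s : Pop m => μ (treat s) (cov s)) =
      fun s => if treat s = true then μ true (cov s) else μ false (cov s) := by
    ext s; cases h : treat s <;> simp
  rw [h1]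
  exact Measurable.ite (measurable_treat_sigmaXD m (measurableSet_singleton true))
    ((hμ true).comp (measurable_cov_sigmaXD m)) ((hμ false).comp (measurable_cov_sigmaXD m))

/-- The error has conditional mean zero given `(X, D)`. -/
lemma IsRegression.condExp_err (h : IsRegression P μ) : P[err μ | sigmaXD m] =ᵐ[P] 0 := by
  have hint : Integrable (fun s : Pop m => μ (treat s) (cov s)) P :=
    integrable_condExp.congr h.condExp_eq
  have h1 : P[err μ | sigmaXD m] =ᵐ[P]
      P[outcome | sigmaXD m] - P[fun s => μ (treat s) (cov s) | sigmaXD m] :=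
    condExp_sub h.integrable hint _
  rw [condExp_of_stronglyMeasurable (sigmaXD_le m)
    (measurable_regression_sigmaXD h.measurable).stronglyMeasurable hint] at h1
  filter_upwards [h1, h.condExp_eq] with s h2 h3
  rw [h2, Pi.sub_apply, h3, sub_self]; rfl

lemma IsRegression.integral_mul_err (h : IsRegression P μ) (herr : Integrable (err μ) P)
    {f : Pop m → ℝ} (hf : Measurable[sigmaXD m] f) : ∫ s, f s * err μ s ∂P = 0 := by
  by_cases hint : Integrable (f * err μ) P
  · have h1 := condExp_mul_of_stronglyMeasurable_left hf.stronglyMeasurable hint herr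
    rw [show ∫ s, f s * err μ s ∂P = ∫ s, (f * err μ) s ∂P from rfl,
      ← integral_condExp (sigmaXD_le m)]
    refine integral_eq_zero_of_ae ?_
    filter_upwards [h1, h.condExp_err] with s h2 h3
    rw [h2, Pi.mul_apply, h3]; simp
  · exact integral_undef hint

variable {n : ℕ}

instance : IsProbabilityMeasure (sampleLaw n P) := by unfold sampleLaw; infer_instance

lemma measurePreserving_unit (i : Fin n) :
    MeasurePreserving (fun s : Fin n → Pop m => s i) (sampleLaw n P) P :=
  measurePreserving_eval (fun _ => P) i

/-- Functions of the sample that depend on unit `i` through its covariate and label only are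
uncorrelated with the error of unit `i`. -/
lemma integral_mul_err_unit (hB : AssumptionB c p P μ) (i : Fin n) {H : (Fin n → Pop m) → ℝ}
    (hint : Integrable (fun s => H s * err μ (s i)) (sampleLaw n P))
    (hH : ∀ s, Measurable[sigmaXD m] fun y => H (Function.update s i y)) :
    ∫ s, H s * err μ (s i) ∂sampleLaw n P = 0 := by
  rw [sampleLaw, integral_resample hint i, integral_integral_swap (Integrable.comp_update hint i)]
  simp only [Function.update_self]
  simp_rw [hB.regression.integral_mul_err (hB.memLp_err.integrable one_le_two) (hH _)]
  simp

lemma measurable_cov_unit (l : Fin n) : Measurable fun s : Fin n → Pop m => cov (s l) :=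
  measurable_cov.comp (measurable_pi_apply l)

lemma measurable_treat_unit (l : Fin n) : Measurable fun s : Fin n → Pop m => treat (s l) :=
  measurable_treat.comp (measurable_pi_apply l)

lemma measurable_cov_update (s : Fin n → Pop m) (i l : Fin n) :
    Measurable[sigmaXD m] fun y => cov (Function.update s i y l) := by
  by_cases h : l = i
  · subst h; simpa using measurable_cov_sigmaXD m
  · simp [h]

lemma measurable_treat_update (s : Fin n → Pop m) (i l : Fin n) :
    Measurable[sigmaXD m] fun y => treat (Function.update s i y l) := by
  by_cases h : l = i
  · subst h; simpa using measurable_treat_sigmaXD m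
  · simp [h]

lemma measurable_weight_update (M : ℕ) (s : Fin n → Pop m) (i k : Fin n) :
    Measurable[sigmaXD m] fun y => weight M k (Function.update s i y) :=
  @measurable_weight m n (Pop m) (sigmaXD m) (fun y => Function.update s i y)
    (measurable_cov_update s i) (measurable_treat_update s i) M k

lemma memLp_weight_mul_err (hB : AssumptionB c p P μ) {M : ℕ} (hM : 1 ≤ M) (i : Fin n) :
    MemLp (fun s => weight M i s * err μ (s i)) 2 (sampleLaw n P) := by
  have h1 : MemLp (fun s : Fin n → Pop m => err μ (s i)) 2 (sampleLaw n P) :=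
    hB.memLp_err.comp_measurePreserving (measurePreserving_unit i)
  refine h1.of_le_mul (c := 1 + n) ?_ (Eventually.of_forall fun s => ?_)
  · exact ((measurable_weight measurable_cov_unit measurable_treat_unit M i).mul
      ((measurable_err hB.regression.measurable).comp (measurable_pi_apply i))).aestronglyMeasurable
  · rw [norm_mul, Real.norm_eq_abs (weight M i s)]
    exact mul_le_mul_of_nonneg_right (abs_weight_le hM i s) (norm_nonneg _)

/-- The conditional average treatment effect `μ₁(X) - μ₀(X)`. -/
def cate (μ : Bool → Cov m → ℝ) (s : Pop m) : ℝ := μ true (cov s) - μ false (cov s)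

lemma AssumptionB.memLp_cate {P : Measure (Pop m)} (hB : AssumptionB c p P μ) : MemLp (cate μ) 2 P :=
  (hB.memLp true).sub (hB.memLp false)

lemma measurable_cate_sigmaXD (hμ : ∀ w, Measurable (μ w)) : Measurable[sigmaXD m] (cate μ) :=
  ((hμ true).comp (measurable_cov_sigmaXD m)).sub ((hμ false).comp (measurable_cov_sigmaXD m))

lemma memLp_cate_unit (hB : AssumptionB c p P μ) (i : Fin n) :
    MemLp (fun s : Fin n → Pop m => cate μ (s i)) 2 (sampleLaw n P) :=
  hB.memLp_cate.comp_measurePreserving (measurePreserving_unit i)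

lemma mainTerm_eq (M : ℕ) : mainTerm n M μ = (fun s => (1 / n : ℝ) * ∑ i, cate μ (s i)) +
    fun s => (1 / n : ℝ) * ∑ i, weight M i s * err μ (s i) := rfl

lemma memLp_mean_cate (hB : AssumptionB c p P μ) :
    MemLp (fun s : Fin n → Pop m => (1 / n : ℝ) * ∑ i, cate μ (s i)) 2 (sampleLaw n P) :=
  (memLp_finsetSum _ fun i _ => memLp_cate_unit hB i).const_mul _

lemma memLp_mean_err (hB : AssumptionB c p P μ) {M : ℕ} (hM : 1 ≤ M) :
    MemLp (fun s : Fin n → Pop m => (1 / n : ℝ) * ∑ i, weight M i s * err μ (s i)) 2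
      (sampleLaw n P) :=
  (memLp_finsetSum _ fun i _ => memLp_weight_mul_err hB hM i).const_mul _

lemma memLp_mainTerm (hB : AssumptionB c p P μ) {M : ℕ} (hM : 1 ≤ M) :
    MemLp (mainTerm n M μ) 2 (sampleLaw n P) := by
  rw [mainTerm_eq]
  exact (memLp_mean_cate hB).add (memLp_mean_err hB hM)

lemma integral_weight_mul_err (hB : AssumptionB c p P μ) {M : ℕ} (hM : 1 ≤ M) (i : Fin n) :
    ∫ s, weight M i s * err μ (s i) ∂sampleLaw n P = 0 :=
  integral_mul_err_unit hB i ((memLp_weight_mul_err hB hM i).integrable one_le_two)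
    fun s => measurable_weight_update M s i i

lemma integral_cate_mul_weight_mul_err (hB : AssumptionB c p P μ) {M : ℕ} (hM : 1 ≤ M)
    (i k : Fin n) : ∫ s, cate μ (s k) * (weight M i s * err μ (s i)) ∂sampleLaw n P = 0 := by
  simp_rw [← mul_assoc]
  refine integral_mul_err_unit hB i (H := fun s => cate μ (s k) * weight M i s) ?_ fun s => ?_
  · simp_rw [mul_assoc]
    exact (memLp_cate_unit hB k).integrable_mul (memLp_weight_mul_err hB hM i)
  · refine Measurable.mul ?_ (measurable_weight_update M s i i)
    by_cases h : k = i
    · subst h; simpa using measurable_cate_sigmaXD hB.regression.measurable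
    · simp [h]

lemma integral_weight_mul_err_mul (hB : AssumptionB c p P μ) {M : ℕ} (hM : 1 ≤ M)
    {i k : Fin n} (hik : k ≠ i) :
    ∫ s, weight M k s * err μ (s k) * (weight M i s * err μ (s i)) ∂sampleLaw n P = 0 := by
  simp_rw [← mul_assoc]
  refine integral_mul_err_unit hB i (H := fun s => weight M k s * err μ (s k) * weight M i s) ?_
    fun s => ?_
  · simp_rw [mul_assoc (weight M k _ * _)]
    exact (memLp_weight_mul_err hB hM k).integrable_mul (memLp_weight_mul_err hB hM i)
  · refine Measurable.mul (Measurable.mul (measurable_weight_update M s i k) ?_)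
      (measurable_weight_update M s i i)
    simp [hik]

lemma integral_sq_mean_err (hB : AssumptionB c p P μ) {M : ℕ} (hM : 1 ≤ M) :
    ∫ s, ((1 / n : ℝ) * ∑ i, weight M i s * err μ (s i)) ^ 2 ∂sampleLaw n P =
      (1 / n : ℝ) ^ 2 * ∑ i, ∫ s, weight M i s ^ 2 * err μ (s i) ^ 2 ∂sampleLaw n P := by
  simp_rw [mul_pow, integral_const_mul]
  congr 1
  have h2 : ∀ s : Fin n → Pop m, (∑ i, weight M i s * err μ (s i)) ^ 2 =
      ∑ k, ∑ i, weight M k s * err μ (s k) * (weight M i s * err μ (s i)) := fun s => by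
    rw [sq, Finset.sum_mul_sum]
  have hint : ∀ k i : Fin n, Integrable
      (fun s => weight M k s * err μ (s k) * (weight M i s * err μ (s i))) (sampleLaw n P) :=
    fun k i => (memLp_weight_mul_err hB hM k).integrable_mul (memLp_weight_mul_err hB hM i)
  simp_rw [h2]
  rw [integral_finsetSum _ fun k _ => integrable_finsetSum _ fun i _ => hint k i]
  refine Finset.sum_congr rfl fun k _ => ?_
  rw [integral_finsetSum _ fun i _ => hint k i, Finset.sum_eq_single k]
  · congr 1; ext s; ring
  · intro i _ hi; exact integral_weight_mul_err_mul hB hM hi.symm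
  · simp

/-- The variance of the main term: the contribution of the covariates, and that of the errors. -/
lemma varMain_eq (hB : AssumptionB c p P μ) (hn : 1 ≤ n) {M : ℕ} (hM : 1 ≤ M) :
    n * varMain n M P μ = varCate P μ +
      (1 / n : ℝ) * ∑ i, ∫ s, weight M i s ^ 2 * err μ (s i) ^ 2 ∂sampleLaw n P := by
  have hn0 : (n : ℝ) ≠ 0 := by positivity
  have hT := memLp_mean_cate (n := n) hB
  have hR := memLp_mean_err (n := n) hB hM
  have hR0 : ∫ s, (1 / n : ℝ) * ∑ i, weight M i s * err μ (s i) ∂sampleLaw n P = 0 := by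
    rw [integral_const_mul, integral_finsetSum _ fun i _ =>
      (memLp_weight_mul_err hB hM i).integrable one_le_two]
    simp [integral_weight_mul_err hB hM]
  have hTR : cov[fun s : Fin n → Pop m => (1 / n : ℝ) * ∑ i, cate μ (s i),
      fun s => (1 / n : ℝ) * ∑ i, weight M i s * err μ (s i); sampleLaw n P] = 0 := by
    rw [covariance_const_mul_left, covariance_const_mul_right, covariance_fun_sum_fun_sum
      (fun i => memLp_cate_unit hB i) (fun i => memLp_weight_mul_err hB hM i)]
    have : ∀ k i : Fin n, cov[fun s => cate μ (s k), fun s => weight M i s * err μ (s i);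
        sampleLaw n P] = 0 := by
      intro k i
      rw [covariance_eq_sub (memLp_cate_unit hB k) (memLp_weight_mul_err hB hM i),
        integral_weight_mul_err hB hM i, mul_zero, sub_zero]
      exact integral_cate_mul_weight_mul_err hB hM i k
    simp [this]
  have hVT : Var[fun s : Fin n → Pop m => (1 / n : ℝ) * ∑ i, cate μ (s i); sampleLaw n P] =
      (1 / n : ℝ) ^ 2 * (n * varCate P μ) := by
    rw [variance_const_mul]
    congr 1
    have := variance_sum_pi (μ := fun _ : Fin n => P) (X := fun _ => cate μ) (fun _ => hB.memLp_cate)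
    have h3 : (fun s : Fin n → Pop m => ∑ i, cate μ (s i)) = ∑ i, fun s => cate μ (s i) := by
      ext s; simp
    rw [sampleLaw, h3, this]
    simp only [Finset.sum_const, Finset.card_univ, Fintype.card_fin, nsmul_eq_mul]
    rfl
  have hVR := variance_of_integral_eq_zero hR.aestronglyMeasurable.aemeasurable hR0
  rw [integral_sq_mean_err hB hM] at hVR
  rw [varMain, mainTerm_eq, variance_add hT hR, hTR, hVT, hVR]
  field_simp
  ring

/-- The lower bound of the variance of the main term. -/
lemma le_varMain (hB : AssumptionB c p P μ) (hn : 1 ≤ n) {M : ℕ} (hM : 1 ≤ M) :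
    (variance (err μ) P + varCate P μ) / n ≤ varMain n M P μ := by
  have hn0 : (0 : ℝ) < n := by positivity
  have h0 : ∫ s, err μ s ∂P = 0 := by
    simpa using hB.regression.integral_mul_err (hB.memLp_err.integrable one_le_two)
      (f := fun _ => 1) measurable_const
  rw [div_le_iff₀ hn0, mul_comm (varMain n M P μ), varMain_eq hB hn hM,
    variance_of_integral_eq_zero hB.memLp_err.aestronglyMeasurable.aemeasurable h0, add_comm]
  have h1 : ∀ i : Fin n, ∫ s, err μ s ^ 2 ∂P ≤
      ∫ s, weight M i s ^ 2 * err μ (s i) ^ 2 ∂sampleLaw n P := by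
    intro i
    have h2 : ∫ s, err μ s ^ 2 ∂P = ∫ s, err μ (s i) ^ 2 ∂sampleLaw n P := by
      conv_lhs => rw [← (measurePreserving_unit (P := P) i).map_eq]
      exact integral_map (measurable_pi_apply i).aemeasurable
        ((measurable_err hB.regression.measurable).pow_const 2).aestronglyMeasurable
    rw [h2]
    have h3 := (memLp_weight_mul_err hB hM i).integrable_sq
    simp_rw [mul_pow] at h3
    refine integral_mono ((hB.memLp_err.comp_measurePreserving
      (measurePreserving_unit i)).integrable_sq) h3 fun s => ?_
    have : 1 ≤ weight M i s ^ 2 := by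
      rw [weight_sq]
      have : (0 : ℝ) ≤ (matched M (treat (s i)) i s : ℝ) / M := by positivity
      nlinarith
    exact le_mul_of_one_le_left (sq_nonneg _) this
  have h4 : (n : ℝ) * ∫ s, err μ s ^ 2 ∂P ≤
      ∑ i : Fin n, ∫ s, weight M i s ^ 2 * err μ (s i) ^ 2 ∂sampleLaw n P := by
    simpa using Finset.sum_le_sum fun i (_ : i ∈ Finset.univ) => h1 i
  have h5 := mul_le_mul_of_nonneg_left h4 (by positivity : (0 : ℝ) ≤ 1 / n)
  rw [← mul_assoc, one_div_mul_cancel hn0.ne', one_mul] at h5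
  linarith

end Variance

/-! ### The design: supports, densities and the propensity score -/

section Design

variable {m : ℕ} {P : Measure (Pop m)} [IsProbabilityMeasure P]

/-- The probability `ℙ(D = w)`. -/
noncomputable def share (P : Measure (Pop m)) (w : Bool) : ℝ := P.real {u | treat u = w}

/-- The conditional probability of the label `w` given `X`, as a random variable. -/
noncomputable def propW (P : Measure (Pop m)) (w : Bool) (s : Pop m) : ℝ :=
  if w then propensity P s else 1 - propensity P s

lemma integrable_propensity : Integrable (propensity P) P := integrable_condExp

lemma integrable_propW (w : Bool) : Integrable (propW P w) P := by
  cases w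
  · exact (integrable_const 1).sub (integrable_propensity (P := P))
  · exact integrable_propensity (P := P)

lemma stronglyMeasurable_propW (w : Bool) : StronglyMeasurable[sigmaX m] (propW P w) := by
  have h : StronglyMeasurable[sigmaX m] (propensity P) := stronglyMeasurable_condExp
  cases w
  · exact stronglyMeasurable_const.sub h
  · exact h

lemma measurableSet_cov_preimage {A : Set (Cov m)} (hA : MeasurableSet A) :
    MeasurableSet[sigmaX m] (cov ⁻¹' A) := ⟨A, hA, rfl⟩

lemma indicator_treat_eq (w : Bool) : (fun s : Pop m => if treat s = w then (1 : ℝ) else 0) =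
    {u | treat u = w}.indicator fun _ => 1 := by
  ext s; simp [Set.indicator_apply]

lemma setIntegral_propW (w : Bool) {A : Set (Cov m)} (hA : MeasurableSet A) :
    ∫ s in cov ⁻¹' A, propW P w s ∂P = P.real ({u | treat u = w} ∩ cov ⁻¹' A) := by
  have h1 : ∫ s in cov ⁻¹' A, propensity P s ∂P = P.real ({u | treat u = true} ∩ cov ⁻¹' A) := by
    unfold propensity
    rw [setIntegral_condExp (sigmaX_le m) _ (measurableSet_cov_preimage hA)]
    · rw [indicator_treat_eq true, setIntegral_indicator (measurableSet_treat_eq _)]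
      simp [Set.inter_comm, measureReal_def]
    · rw [indicator_treat_eq true]
      exact (integrable_const 1).indicator (measurableSet_treat_eq _)
  cases w
  · have h2 : ∫ s in cov ⁻¹' A, propW P false s ∂P =
        P.real (cov ⁻¹' A) - ∫ s in cov ⁻¹' A, propensity P s ∂P := by
      simp only [propW, Bool.false_eq_true, if_false]
      rw [integral_sub (integrable_const 1) integrable_propensity.integrableOn]
      simp
    rw [h2, h1]
    have h3 := measureReal_inter_add_sdiff (μ := P) (s := cov ⁻¹' A) (measurableSet_treat_eq true)
    have h4 : cov ⁻¹' A \ {u : Pop m | treat u = true} = {u | treat u = false} ∩ cov ⁻¹' A := by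
      ext u; simp [and_comm]
    rw [h4, Set.inter_comm] at h3
    linarith
  · simpa [propW] using h1

lemma condLaw_real (w : Bool) {A : Set (Cov m)} (hA : MeasurableSet A) :
    P.real ({u | treat u = w} ∩ cov ⁻¹' A) = share P w * (condLaw P w).real A := by
  have h1 : (condLaw P w) A = (P {u | treat u = w})⁻¹ * P ({u | treat u = w} ∩ cov ⁻¹' A) := by
    rw [condLaw, Measure.map_apply measurable_cov hA]
    exact cond_apply (measurableSet_treat_eq w) P _
  rw [measureReal_def (condLaw P w), h1, ENNReal.toReal_mul, ENNReal.toReal_inv, share]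
  by_cases h0 : P.real {u | treat u = w} = 0
  · rw [h0, zero_mul]
    exact measureReal_mono_null Set.inter_subset_left h0
  · rw [← measureReal_def, ← measureReal_def, mul_inv_cancel_left₀ h0]

instance (w : Bool) : IsFiniteMeasure (condLaw P w) := by unfold condLaw; infer_instance

/-- Both labels have conditional probability at least `η`. -/
def Overlap (P : Measure (Pop m)) (η : ℝ) : Prop := ∀ w, ∀ᵐ s ∂P, η ≤ propW P w s

lemma Overlap.le_real {η : ℝ} (h : Overlap P η) (w : Bool) {A : Set (Cov m)}
    (hA : MeasurableSet A) : η * P.real (cov ⁻¹' A) ≤ P.real ({u | treat u = w} ∩ cov ⁻¹' A) := by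
  rw [← setIntegral_propW w hA]
  calc η * P.real (cov ⁻¹' A) = ∫ s in cov ⁻¹' A, η ∂P := by simp [mul_comm]
    _ ≤ _ := integral_mono_ae (integrable_const _) (integrable_propW w).integrableOn
      (ae_restrict_of_ae (h w))

lemma Overlap.le_share {η : ℝ} (h : Overlap P η) (w : Bool) : η ≤ share P w := by
  simpa [share] using h.le_real w MeasurableSet.univ

lemma isProbabilityMeasure_condLaw {η : ℝ} (h : Overlap P η) (hη : 0 < η) (w : Bool) :
    IsProbabilityMeasure (condLaw P w) := by
  have h0 := condLaw_real (P := P) w MeasurableSet.univ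
  have h1 := h.le_share w
  constructor
  have h2 : (condLaw P w).real Set.univ = 1 := by
    have h3 : share P w ≠ 0 := by linarith
    have : share P w = share P w * (condLaw P w).real Set.univ := by simpa [share] using h0
    exact (mul_left_cancel₀ h3 (by linarith : share P w * 1 = _)).symm
  rw [measureReal_def] at h2
  exact (ENNReal.toReal_eq_one_iff _).1 h2

lemma condLaw_absolutelyContinuous (w : Bool) : condLaw P w ≪ P.map cov := by
  refine Measure.AbsolutelyContinuous.map ?_ measurable_cov
  exact cond_absolutelyContinuous

lemma Overlap.absolutelyContinuous {η : ℝ} (h : Overlap P η) (hη : 0 < η) (w : Bool) :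
    P.map cov ≪ condLaw P w := by
  refine Measure.AbsolutelyContinuous.mk fun A hA h0 => ?_
  have h1 := h.le_real w hA
  rw [condLaw_real w hA, measureReal_def (condLaw P w), h0, ENNReal.toReal_zero, mul_zero] at h1
  rw [Measure.map_apply measurable_cov hA]
  have h2 : P.real (cov ⁻¹' A) = 0 := le_antisymm (by nlinarith) measureReal_nonneg
  exact (measureReal_eq_zero_iff).1 h2

/-- By overlap, the covariates of both groups have the same support. -/
lemma Overlap.suppS_eq {η : ℝ} (h : Overlap P η) (hη : 0 < η) (w : Bool) :
    suppS P w = suppX P :=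
  Set.Subset.antisymm (condLaw_absolutelyContinuous w).support_mono
    (h.absolutelyContinuous hη w).support_mono

/-- What the error bound uses about the distribution of `(X, D)`: the support `S` of the covariate
is a convex body with volume fraction constant `a`, both groups have covariate densities that are
Lipschitz and bounded above and below on `S`, and overlap holds. -/
structure Design (P : Measure (Pop m)) (S : Set (Cov m)) (κ Γ L a η : ℝ) (g : Bool → Cov m → ℝ) :
    Prop where
  closed : IsClosed S
  bounded : Bornology.IsBounded S
  convex : Convex ℝ S
  dens : ∀ w, LipDensity S κ Γ L (condLaw P w) (g w)
  κ_pos : 0 < κ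
  Γ_pos : 0 < Γ
  L_pos : 0 < L
  a_pos : 0 < a
  a_lt : a < 1
  frac : ∀ z ∈ S, ∀ d, 0 < d → d ≤ Metric.diam S →
    a * (ballVol m * d ^ m) ≤ volume.real (Metric.closedBall z d ∩ S)
  η_pos : 0 < η
  overlap : Overlap P η

lemma AssumptionA.overlap' {c : Constants} {η : ℝ} (h : AssumptionA c η P) : Overlap P η := by
  intro w
  filter_upwards [h.overlap] with s hs
  cases w
  · simp only [propW, Bool.false_eq_true, if_false]; linarith [hs.2]
  · simpa [propW] using hs.1

/-- The comparison with `1` in the upper bound of the densities only serves to make it positive. -/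
lemma AssumptionA.design {c : Constants} {η : ℝ} (h : AssumptionA c η P) :
    ∃ g, Design P (suppX P) (min (c.cmin false) (c.cmin true))
      (max 1 (max (c.cmax false) (c.cmax true))) c.L c.a η g := by
  obtain ⟨g, hg1, hg2, hg3, hg4⟩ := h.condDensity
  have hov := h.overlap'
  have hS := hov.suppS_eq h.eta_pos
  have hmin : ∀ w, min (c.cmin false) (c.cmin true) ≤ c.cmin w := by
    intro w; cases w <;> simp
  have hmax : ∀ w, c.cmax w ≤ max 1 (max (c.cmax false) (c.cmax true)) := by
    intro w; cases w <;> simp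
  refine ⟨g, Measure.isClosed_support, h.isCompact.isBounded, h.convex, fun w => ⟨hg1 w, hg2 w, ?_,
    ?_, ?_, ?_⟩, ?_, by positivity, h.L_pos, h.a_pos, h.a_lt, ?_, h.eta_pos, hov⟩
  · rw [← hS w]; exact Measure.measure_compl_support
  · intro x hx; rw [← hS w] at hx; exact (hmin w).trans (hg3 w x hx).1
  · intro x hx; rw [← hS w] at hx; exact (hg3 w x hx).2.trans (hmax w)
  · intro x hx z hz; rw [← hS w] at hx hz; exact hg4 w x hx z hz w
  · exact lt_min (h.cmin_pos _) (h.cmin_pos _)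
  · intro z hz d hd hdd
    have h1 := h.volume_fraction true d hd (by rwa [hS]) z (by rwa [hS])
    rw [hS] at h1
    have h2 := ENNReal.toReal_mono (ne_top_of_le_ne_top (measure_closedBall_lt_top (x := z) (r := d)).ne
      (measure_mono Set.inter_subset_left)) h1
    rw [ENNReal.toReal_mul, ENNReal.toReal_ofReal h.a_pos.le] at h2
    rw [← volume_real_closedBall z hd.le]
    exact h2

variable {S : Set (Cov m)} {κ Γ L a η : ℝ} {g : Bool → Cov m → ℝ}

/-- The odds `ℙ(D ≠ w | X = x) / ℙ(D = w | X = x)`, in terms of the conditional densities. -/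
noncomputable def odds (P : Measure (Pop m)) (g : Bool → Cov m → ℝ) (w : Bool) (x : Cov m) : ℝ :=
  share P (!w) / share P w * (g (!w) x / g w x)

/-- The conditional probability of the label `w` given `X = x`, in terms of the conditional
densities. -/
noncomputable def propF (P : Measure (Pop m)) (g : Bool → Cov m → ℝ) (w : Bool) (x : Cov m) : ℝ :=
  share P w * g w x / (share P w * g w x + share P (!w) * g (!w) x)

lemma share_le_one (w : Bool) : share P w ≤ 1 := measureReal_le_one

namespace Design

variable (h : Design P S κ Γ L a η g)
include h

lemma share_pos (w : Bool) : 0 < share P w := h.η_pos.trans_le (h.overlap.le_share w)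

lemma dens_pos (w : Bool) {x : Cov m} (hx : x ∈ S) : 0 < g w x := h.κ_pos.trans_le ((h.dens w).lower x hx)

lemma measurable_propF (w : Bool) : Measurable (propF P g w) := by
  have := (h.dens w).meas
  have := (h.dens (!w)).meas
  unfold propF; fun_prop

lemma measurable_odds (w : Bool) : Measurable (odds P g w) := by
  have := (h.dens w).meas
  have := (h.dens (!w)).meas
  unfold odds; fun_prop

lemma one_div_propF (w : Bool) {x : Cov m} (hx : x ∈ S) : 1 / propF P g w x = 1 + odds P g w x := by
  have h1 := h.share_pos w
  have h2 := h.dens_pos w hx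
  unfold propF odds
  field_simp

lemma propF_mem (w : Bool) {x : Cov m} (hx : x ∈ S) : 0 < propF P g w x ∧ propF P g w x ≤ 1 := by
  have h1 := mul_pos (h.share_pos w) (h.dens_pos w hx)
  have h2 := mul_pos (h.share_pos (!w)) (h.dens_pos (!w) hx)
  unfold propF
  exact ⟨by positivity, (div_le_one (by positivity)).2 (by linarith)⟩

lemma ae_mem : ∀ᵐ s ∂P, cov s ∈ S := by
  have h1 : P.map cov Sᶜ = 0 := (h.overlap.absolutelyContinuous h.η_pos true) (h.dens true).null
  rw [Measure.map_apply measurable_cov h.closed.measurableSet.compl] at h1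
  exact h1

lemma map_cov (w : Bool) : P.map cov = volume.withDensity fun x =>
    ENNReal.ofReal (share P w) * ENNReal.ofReal (g w x) +
      ENNReal.ofReal (share P (!w)) * ENNReal.ofReal (g (!w) x) := by
  have hm : ∀ w, Measurable fun x => ENNReal.ofReal (g w x) := fun w => (h.dens w).meas.ennreal_ofReal
  have hd : ∀ w, ∀ A, MeasurableSet A →
      ENNReal.ofReal (share P w) * ∫⁻ x in A, ENNReal.ofReal (g w x) =
        P ({u | treat u = w} ∩ cov ⁻¹' A) := by
    intro w A hA
    rw [← withDensity_apply _ hA, ← (h.dens w).eq, ← ofReal_measureReal (μ := condLaw P w),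
      ← ENNReal.ofReal_mul (h.share_pos w).le, ← condLaw_real w hA, ofReal_measureReal]
  ext A hA
  rw [Measure.map_apply measurable_cov hA, withDensity_apply _ hA,
    lintegral_add_left ((hm w).const_mul _), lintegral_const_mul _ (hm w),
    lintegral_const_mul _ (hm (!w)), hd _ A hA, hd _ A hA]
  have h4 : {u : Pop m | treat u = !w} ∩ cov ⁻¹' A = cov ⁻¹' A \ {u | treat u = w} := by
    ext u; cases w <;> simp [and_comm]
  rw [h4, Set.inter_comm]
  exact (measure_inter_add_sdiff _ (measurableSet_treat_eq w)).symm

lemma setIntegral_propF (w : Bool) {A : Set (Cov m)} (hA : MeasurableSet A) :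
    ∫ s in cov ⁻¹' A, propF P g w (cov s) ∂P = P.real ({u | treat u = w} ∩ cov ⁻¹' A) := by
  have hS := h.closed.measurableSet
  have h1 : ∫ s in cov ⁻¹' A, propF P g w (cov s) ∂P =
      ∫ s in cov ⁻¹' (A ∩ S), propF P g w (cov s) ∂P := by
    refine setIntegral_congr_set ?_
    filter_upwards [h.ae_mem] with s hs
    exact propext ⟨fun hA => ⟨hA, hs⟩, fun hA => hA.1⟩
  have h2 : P.real ({u | treat u = w} ∩ cov ⁻¹' A) =
      P.real ({u | treat u = w} ∩ cov ⁻¹' (A ∩ S)) := by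
    refine measureReal_congr ?_
    filter_upwards [h.ae_mem] with s hs
    exact propext ⟨fun hA => ⟨hA.1, hA.2, hs⟩, fun hA => ⟨hA.1, hA.2.1⟩⟩
  have hAS := hA.inter hS
  rw [h1, h2, condLaw_real w hAS, ← setIntegral_map hAS
    (h.measurable_propF w).aestronglyMeasurable measurable_cov.aemeasurable, h.map_cov w,
    measureReal_def, (h.dens w).eq, withDensity_apply _ hAS]
  have hm : ∀ w, Measurable fun x => ENNReal.ofReal (g w x) := fun w => (h.dens w).meas.ennreal_ofReal
  have h3 : ∫ x in A ∩ S, g w x = (∫⁻ x in A ∩ S, ENNReal.ofReal (g w x)).toReal := by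
    refine integral_eq_lintegral_of_nonneg_ae ?_ (h.dens w).meas.aestronglyMeasurable
    filter_upwards [ae_restrict_mem hAS] with x hx using (h.dens_pos w hx.2).le
  have hH : Measurable fun x => ENNReal.ofReal (share P w) * ENNReal.ofReal (g w x) +
      ENNReal.ofReal (share P (!w)) * ENNReal.ofReal (g (!w) x) :=
    ((hm w).const_mul _).add ((hm (!w)).const_mul _)
  rw [← h3, ← integral_const_mul, setIntegral_withDensity_eq_setIntegral_toReal_smul hH
    (Eventually.of_forall fun x => ENNReal.add_lt_top.2
      ⟨ENNReal.mul_lt_top ENNReal.ofReal_lt_top ENNReal.ofReal_lt_top,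
        ENNReal.mul_lt_top ENNReal.ofReal_lt_top ENNReal.ofReal_lt_top⟩) _ hAS]
  refine setIntegral_congr_fun hAS fun x hx => ?_
  have h5 := mul_pos (h.share_pos w) (h.dens_pos w hx.2)
  have h6 := mul_pos (h.share_pos (!w)) (h.dens_pos (!w) hx.2)
  simp only [smul_eq_mul]
  rw [← ENNReal.ofReal_mul (h.share_pos w).le, ← ENNReal.ofReal_mul (h.share_pos (!w)).le,
    ← ENNReal.ofReal_add h5.le h6.le, ENNReal.toReal_ofReal (by positivity), propF,
    mul_div_cancel₀ _ (by positivity)]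

/-- Bayes' formula for the propensity score. -/
lemma propW_ae_eq (w : Bool) : propW P w =ᵐ[P] fun s => propF P g w (cov s) := by
  have hm : Measurable[sigmaX m] fun s : Pop m => propF P g w (cov s) :=
    (h.measurable_propF w).comp (comap_measurable cov)
  have hint : Integrable (fun s => propF P g w (cov s)) P := by
    refine Integrable.of_bound (hm.mono (sigmaX_le m) le_rfl).aestronglyMeasurable 1 ?_
    filter_upwards [h.ae_mem] with s hs
    rw [Real.norm_of_nonneg (h.propF_mem w hs).1.le]
    exact (h.propF_mem w hs).2
  have h1 := ae_eq_condExp_of_forall_setIntegral_eq (sigmaX_le m) (integrable_propW (P := P) w)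
    (g := fun s => propF P g w (cov s)) (fun _ _ _ => hint.integrableOn)
    (by
      rintro _ ⟨A, hA, rfl⟩ -
      rw [h.setIntegral_propF w hA, setIntegral_propW w hA])
    hm.aestronglyMeasurable
  rw [condExp_of_stronglyMeasurable (sigmaX_le m) (stronglyMeasurable_propW w)
    (integrable_propW w)] at h1
  exact h1.symm

lemma one_div_propF_le (w : Bool) : ∀ᵐ s ∂P, 1 / propF P g w (cov s) ≤ 1 / η := by
  filter_upwards [h.propW_ae_eq w, h.overlap w] with s h1 h2
  rw [h1] at h2
  exact one_div_le_one_div_of_le h.η_pos h2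

end Design

/-! ### The limiting variance -/

/-- By unconfoundedness, the restriction of `(X, Y(0), Y(1))` to `D = w` has a density, namely the
probability of `D = w` given `X`. -/
lemma integral_treat_eq (h : Design P S κ Γ L a η g)
    (hu : CondIndepFun (sigmaX m) (sigmaX_le m) (treat : Pop m → Bool)
      (fun s => (potential false s, potential true s)) P) (w : Bool)
    {f : Cov m × ℝ × ℝ → ℝ} (hf : Measurable f) :
    ∫ s in {u | treat u = w}, f (cov s, potential false s, potential true s) ∂P =
      ∫ s, propF P g w (cov s) * f (cov s, potential false s, potential true s) ∂P := by
  set Y : Pop m → ℝ × ℝ := fun s => (potential false s, potential true s)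
  have hY : Measurable Y := (measurable_potential false).prodMk (measurable_potential true)
  have hXY : Measurable fun s => (cov s, Y s) := measurable_cov.prodMk hY
  have hq : Measurable fun s : Pop m => ENNReal.ofReal (propF P g w (cov s)) :=
    ((h.measurable_propF w).comp measurable_cov).ennreal_ofReal
  have hpos : ∀ᵐ s ∂P, 0 ≤ propF P g w (cov s) := by
    filter_upwards [h.ae_mem] with s hs using (h.propF_mem w hs).1.le
  have hint : Integrable (fun s => propF P g w (cov s)) P :=
    (integrable_propW w).congr (h.propW_ae_eq w)
  have key : (P.restrict {u | treat u = w}).map (fun s => (cov s, Y s)) =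
      (P.withDensity fun s => ENNReal.ofReal (propF P g w (cov s))).map (fun s => (cov s, Y s)) := by
    refine Measure.ext_prod fun {A B} hA hB => ?_
    have hAm := measurable_cov hA
    have hBm := hY hB
    have hpre : (fun s => (cov s, Y s)) ⁻¹' (A ×ˢ B) = cov ⁻¹' A ∩ Y ⁻¹' B := rfl
    rw [Measure.map_apply hXY (hA.prod hB), Measure.map_apply hXY (hA.prod hB), hpre,
      Measure.restrict_apply (hAm.inter hBm), withDensity_apply _ (hAm.inter hBm),
      ← ofReal_integral_eq_lintegral_ofReal hint.integrableOn (ae_restrict_of_ae hpos),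
      ← ofReal_measureReal]
    congr 1
    have h1 := (condIndepFun_iff_condExp_inter_preimage_eq_mul measurable_treat hY).1 hu {w} B
      (measurableSet_singleton w) hB
    have hTm : MeasurableSet (treat ⁻¹' {w} : Set (Pop m)) := measurable_treat (measurableSet_singleton w)
    have h2 : P[(treat ⁻¹' {w}).indicator fun _ => (1 : ℝ) | sigmaX m] =ᵐ[P] propW P w := by
      have htrue : P[(treat ⁻¹' {true}).indicator fun _ => (1 : ℝ) | sigmaX m] = propensity P := by
        rw [propensity, indicator_treat_eq true]; rfl
      cases w
      · have h3 : (treat ⁻¹' {false} : Set (Pop m)).indicator (fun _ => (1 : ℝ)) =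
            (fun _ => (1 : ℝ)) - (treat ⁻¹' {true} : Set (Pop m)).indicator fun _ => (1 : ℝ) := by
          ext s; cases hs : treat s <;> simp [hs]
        have h4 := condExp_sub (integrable_const (1 : ℝ)) ((integrable_const (μ := P) (1 : ℝ)).indicator
          (measurable_treat (measurableSet_singleton true))) (sigmaX m)
        rw [← h3, condExp_const (sigmaX_le m), htrue] at h4
        exact h4
      · rw [htrue]; rfl
    have hBint : Integrable ((Y ⁻¹' B).indicator fun _ => (1 : ℝ)) P :=
      (integrable_const 1).indicator hBm
    have hmul : Integrable (propW P w * (Y ⁻¹' B).indicator fun _ => (1 : ℝ)) P := by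
      have : (propW P w * (Y ⁻¹' B).indicator fun _ => (1 : ℝ)) = (Y ⁻¹' B).indicator (propW P w) := by
        ext s; by_cases hs : s ∈ Y ⁻¹' B <;> simp [hs]
      rw [this]
      exact (integrable_propW w).indicator hBm
    have h3 := condExp_mul_of_stronglyMeasurable_left (stronglyMeasurable_propW w) hmul hBint
    have hAX : MeasurableSet[sigmaX m] (cov ⁻¹' A) := measurableSet_cov_preimage hA
    calc P.real (cov ⁻¹' A ∩ Y ⁻¹' B ∩ {u | treat u = w})
        = ∫ s in cov ⁻¹' A, (treat ⁻¹' {w} ∩ Y ⁻¹' B).indicator (fun _ => (1 : ℝ)) s ∂P := by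
          rw [setIntegral_indicator (hTm.inter hBm)]
          simp only [integral_const, smul_eq_mul, mul_one, measureReal_restrict_apply_univ]
          congr 1
          ext s
          simp only [Set.mem_inter_iff, Set.mem_preimage, Set.mem_ofPred_eq, Set.mem_singleton_iff]
          tauto
      _ = ∫ s in cov ⁻¹' A, P[(treat ⁻¹' {w} ∩ Y ⁻¹' B).indicator (fun _ => (1 : ℝ)) | sigmaX m] s ∂P :=
          (setIntegral_condExp (sigmaX_le m) ((integrable_const 1).indicator (hTm.inter hBm)) hAX).symm
      _ = ∫ s in cov ⁻¹' A, P[propW P w * (Y ⁻¹' B).indicator (fun _ => (1 : ℝ)) | sigmaX m] s ∂P := by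
          refine integral_congr_ae (ae_restrict_of_ae ?_)
          filter_upwards [h1, h2, h3] with s e1 e2 e3
          rw [e1, e2, e3, Pi.mul_apply]
      _ = ∫ s in cov ⁻¹' A, (propW P w * (Y ⁻¹' B).indicator (fun _ => (1 : ℝ))) s ∂P :=
          setIntegral_condExp (sigmaX_le m) hmul hAX
      _ = ∫ s in cov ⁻¹' A ∩ Y ⁻¹' B, propW P w s ∂P := by
          rw [← setIntegral_indicator hBm]
          congr 1; ext s
          by_cases hs : s ∈ Y ⁻¹' B <;> simp [hs]
      _ = ∫ s in cov ⁻¹' A ∩ Y ⁻¹' B, propF P g w (cov s) ∂P :=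
          integral_congr_ae (ae_restrict_of_ae (h.propW_ae_eq w))
  have e1 := integral_map (μ := P.restrict {u | treat u = w}) hXY.aemeasurable
    hf.aestronglyMeasurable
  rw [← e1, key, integral_map hXY.aemeasurable hf.aestronglyMeasurable,
    integral_withDensity_eq_integral_toReal_smul hq (Eventually.of_forall fun _ => ENNReal.ofReal_lt_top)]
  refine integral_congr_ae ?_
  filter_upwards [hpos] with s hs
  rw [ENNReal.toReal_ofReal hs, smul_eq_mul]

variable {c : Constants} {p : ℝ} {μ : Bool → Cov m → ℝ}

lemma integral_sigmaSq_div (h : Design P S κ Γ L a η g) (hA : AssumptionA c η P)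
    (hB : AssumptionB c p P μ) (w : Bool) :
    Integrable (fun s => sigmaSq P μ w s / propW P w s) P ∧
    ∫ s, sigmaSq P μ w s / propW P w s ∂P =
      ∫ s in {u | treat u = w}, (1 + odds P g w (cov s)) ^ 2 * dev μ w s ^ 2 ∂P := by
  set q : Pop m → ℝ := fun s => 1 / propF P g w (cov s)
  have hqm : Measurable[sigmaX m] q :=
    ((h.measurable_propF w).comp (comap_measurable cov)).const_div 1
  have hqb : ∀ᵐ s ∂P, ‖q s‖ ≤ 1 / η := by
    filter_upwards [h.one_div_propF_le w, h.ae_mem] with s h1 h2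
    rw [Real.norm_of_nonneg (one_div_nonneg.2 (h.propF_mem w h2).1.le)]
    exact h1
  have hqm' := (hqm.mono (sigmaX_le m) le_rfl).aestronglyMeasurable (μ := P)
  have hdev : Integrable (fun s => dev μ w s ^ 2) P := (hB.memLp_dev w).integrable_sq
  have hmul : Integrable (q * fun s => dev μ w s ^ 2) P := hdev.bdd_mul hqm' hqb
  have h1 := condExp_mul_of_stronglyMeasurable_left hqm.stronglyMeasurable hmul hdev
  have h2 : (fun s => sigmaSq P μ w s / propW P w s) =ᵐ[P] q * sigmaSq P μ w := by
    filter_upwards [h.propW_ae_eq w] with s hs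
    rw [Pi.mul_apply, hs]; simp only [q]; ring
  refine ⟨(Integrable.bdd_mul (integrable_condExp) hqm' hqb).congr h2.symm, ?_⟩
  have hf : Measurable fun z : Cov m × ℝ × ℝ => (1 + odds P g w z.1) ^ 2 *
      ((if w then z.2.2 else z.2.1) - μ w z.1) ^ 2 := by
    have h3 : Measurable fun z : Cov m × ℝ × ℝ => odds P g w z.1 :=
      (h.measurable_odds w).comp measurable_fst
    have h4 : Measurable fun z : Cov m × ℝ × ℝ => μ w z.1 :=
      (hB.regression.measurable w).comp measurable_fst
    have h5 : Measurable fun z : Cov m × ℝ × ℝ => if w then z.2.2 else z.2.1 := by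
      cases w
      · exact measurable_fst.comp measurable_snd
      · exact measurable_snd.comp measurable_snd
    exact ((h3.const_add 1).pow_const 2).mul ((h5.sub h4).pow_const 2)
  have h6 : ∀ s : Pop m, (if w then potential true s else potential false s) = potential w s := by
    intro s; cases w <;> simp
  have h7 := integral_treat_eq h hA.unconfounded w hf
  simp only [h6] at h7
  calc ∫ s, sigmaSq P μ w s / propW P w s ∂P = ∫ s, (q * sigmaSq P μ w) s ∂P := integral_congr_ae h2
    _ = ∫ s, P[q * fun s => dev μ w s ^ 2 | sigmaX m] s ∂P := integral_congr_ae h1.symm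
    _ = ∫ s, q s * dev μ w s ^ 2 ∂P := integral_condExp (sigmaX_le m)
    _ = ∫ s, propF P g w (cov s) *
        ((1 + odds P g w (cov s)) ^ 2 * (potential w s - μ w (cov s)) ^ 2) ∂P := by
        refine integral_congr_ae ?_
        filter_upwards [h.ae_mem] with s hs
        have h8 := (h.propF_mem w hs).1
        rw [← h.one_div_propF w hs]
        simp only [q, dev]
        field_simp
    _ = _ := h7.symm

/-- The limiting variance as a moment of the errors. -/
lemma limitVar_eq (h : Design P S κ Γ L a η g) (hA : AssumptionA c η P)
    (hB : AssumptionB c p P μ) :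
    limitVar P μ = varCate P μ +
      ∑ w : Bool, ∫ s in {u | treat u = w}, (1 + odds P g w (cov s)) ^ 2 * dev μ w s ^ 2 ∂P := by
  obtain ⟨i1, e1⟩ := integral_sigmaSq_div h hA hB true
  obtain ⟨i0, e0⟩ := integral_sigmaSq_div h hA hB false
  rw [limitVar, Fintype.sum_bool, ← e1, ← e0, ← integral_add i1 i0]
  simp [propW]

end Design

/-! ### Moments of the number of matches -/

section Moments

variable {m n M : ℕ} (P : Measure (Pop m)) [IsProbabilityMeasure P] {w : Bool} (x : Cov m)

/-- The probability of the catchment area of `(x, w)` at level `t`. -/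
noncomputable def catchProb (P : Measure (Pop m)) (w : Bool) (x : Cov m) (t : ℝ) : ℝ :=
  P.real (catchSet P w x t)

lemma measurable_catchProb (w : Bool) : Measurable (catchProb P w x) :=
  (measurable_measure_catchSet P w x).ennreal_toReal

lemma catchProb_nonneg (w : Bool) (t : ℝ) : 0 ≤ catchProb P w x t := measureReal_nonneg

lemma catchProb_le_one (w : Bool) (t : ℝ) : catchProb P w x t ≤ 1 := measureReal_le_one

lemma real_matchEvent {i j : Fin n} (hij : j ≠ i) (hM : M ≤ n - 2) :
    (sampleLaw n P).real (matchEvent w x M i j) = ∫ t, catchProb P w x t ∂orderLaw (n - 2) M := by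
  rw [measureReal_def, measure_matchEvent P w x hij hM, ← integral_toReal
    (measurable_measure_catchSet P w x).aemeasurable (Eventually.of_forall fun t => measure_lt_top _ _)]
  rfl

lemma real_matchEvent_inter_le {i j k : Fin n} (hij : j ≠ i) (hik : k ≠ i) (hjk : j ≠ k)
    (hM : M ≤ n - 3) :
    (sampleLaw n P).real (matchEvent w x M i j ∩ matchEvent w x M i k) ≤
      ∫ t, catchProb P w x t ^ 2 ∂orderLaw (n - 3) M := by
  have hfin : ∫⁻ t, P (catchSet P w x t) ^ 2 ∂orderLaw (n - 3) M ≠ ⊤ := by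
    refine ne_top_of_le_ne_top (measure_ne_top (orderLaw (n - 3) M) Set.univ) ?_
    rw [← lintegral_one]
    exact lintegral_mono fun t => pow_le_one₀ zero_le prob_le_one
  have h1 := ENNReal.toReal_mono hfin (measure_matchEvent_inter_le P w x hij hik hjk hM)
  rw [measureReal_def]
  refine h1.trans (le_of_eq ?_)
  rw [← integral_toReal ((measurable_measure_catchSet P w x).pow_const 2).aemeasurable
    (Eventually.of_forall fun t => ENNReal.pow_lt_top (measure_lt_top _ _))]
  simp only [ENNReal.toReal_pow]
  rfl

lemma card_erase_cast (i : Fin n) : ((Finset.univ.erase i).card : ℝ) = n - 1 := by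
  have := i.pos
  rw [Finset.card_erase_of_mem (Finset.mem_univ _), Finset.card_univ, Fintype.card_fin]
  push_cast [Nat.cast_sub (by omega : 1 ≤ n)]
  ring

variable {y : Pop m} (hy : treat y = w) (i : Fin n)

lemma integrable_matched_pow (k : ℕ) :
    Integrable (fun s => (matched M w i (Function.update s i y) : ℝ) ^ k) (sampleLaw n P) := by
  have h1 : ∀ l, Measurable fun s : Fin n → Pop m => Function.update s i y l := fun l =>
    (measurable_pi_apply l).comp ((measurable_update_prod i).comp measurable_prodMk_left)
  have h2 : Measurable fun s : Fin n → Pop m => (matched M w i (Function.update s i y) : ℝ) :=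
    measurable_from_top.comp (measurable_matched (fun l => measurable_cov.comp (h1 l))
      (fun l => measurable_treat.comp (h1 l)) M w i)
  refine Integrable.of_bound (h2.pow_const k).aestronglyMeasurable ((n : ℝ) ^ k)
    (Eventually.of_forall fun s => ?_)
  rw [Real.norm_of_nonneg (by positivity)]
  gcongr
  exact matched_le _ _ _ _

include hy

lemma matched_update_eq_sum (s : Fin n → Pop m) :
    (matched M w i (Function.update s i y) : ℝ) =
      ∑ j ∈ Finset.univ.erase i, (matchEvent w (cov y) M i j).indicator (fun _ => (1 : ℝ)) s := by
  classical
  rw [matched_update M i s hy, Finset.card_filter]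
  push_cast
  exact Finset.sum_congr rfl fun j _ => by simp [Set.indicator_apply]

/-- The expected number of matches. -/
lemma integral_matched (hM : M ≤ n - 2) :
    ∫ s, (matched M w i (Function.update s i y) : ℝ) ∂sampleLaw n P =
      (n - 1) * ∫ t, catchProb P w (cov y) t ∂orderLaw (n - 2) M := by
  simp_rw [matched_update_eq_sum hy i]
  rw [integral_finsetSum _ fun j _ =>
    (integrable_const (1 : ℝ)).indicator (measurableSet_matchEvent w (cov y) M i j)]
  rw [Finset.sum_congr rfl fun j hj => ?_, Finset.sum_const, nsmul_eq_mul, card_erase_cast]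
  rw [integral_indicator_const _ (measurableSet_matchEvent w (cov y) M i j), smul_eq_mul, mul_one,
    real_matchEvent P (cov y) (Finset.ne_of_mem_erase hj) hM]

/-- The second moment of the number of matches. -/
lemma integral_matched_sq_le (hM : M ≤ n - 3) (hn : 3 ≤ n) :
    ∫ s, (matched M w i (Function.update s i y) : ℝ) ^ 2 ∂sampleLaw n P ≤
      (n - 1) * ∫ t, catchProb P w (cov y) t ∂orderLaw (n - 2) M +
        (n - 1) * (n - 2) * ∫ t, catchProb P w (cov y) t ^ 2 ∂orderLaw (n - 3) M := by
  classical
  set E : Fin n → Set (Fin n → Pop m) := matchEvent w (cov y) M i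
  have hE : ∀ j, MeasurableSet (E j) := measurableSet_matchEvent w (cov y) M i
  have h1 : ∀ s, (matched M w i (Function.update s i y) : ℝ) ^ 2 =
      ∑ j ∈ Finset.univ.erase i, ∑ k ∈ Finset.univ.erase i,
        (E j ∩ E k).indicator (fun _ => (1 : ℝ)) s := by
    intro s
    rw [matched_update_eq_sum hy i, sq, Finset.sum_mul_sum]
    refine Finset.sum_congr rfl fun j _ => Finset.sum_congr rfl fun k _ => ?_
    rw [← Set.inter_indicator_mul]
    simp only [mul_one, E]
  have hint : ∀ j k, Integrable ((E j ∩ E k).indicator fun _ => (1 : ℝ)) (sampleLaw n P) :=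
    fun j k => (integrable_const 1).indicator ((hE j).inter (hE k))
  simp_rw [h1]
  rw [integral_finsetSum _ fun j _ => integrable_finsetSum _ fun k _ => hint j k]
  set I1 := ∫ t, catchProb P w (cov y) t ∂orderLaw (n - 2) M
  set I2 := ∫ t, catchProb P w (cov y) t ^ 2 ∂orderLaw (n - 3) M
  have h2 : ∀ j ∈ Finset.univ.erase i, ∫ s, ∑ k ∈ Finset.univ.erase i,
      (E j ∩ E k).indicator (fun _ => (1 : ℝ)) s ∂sampleLaw n P ≤ I1 + (n - 2) * I2 := by
    intro j hj
    rw [integral_finsetSum _ fun k _ => hint j k, ← Finset.add_sum_erase _ _ hj]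
    have hcard : (((Finset.univ.erase i).erase j).card : ℝ) = n - 2 := by
      rw [Finset.card_erase_of_mem hj, Finset.card_erase_of_mem (Finset.mem_univ _),
        Finset.card_univ, Fintype.card_fin, Nat.sub_sub, Nat.cast_sub (by omega)]
      norm_num
    refine add_le_add (le_of_eq ?_) ?_
    · rw [Set.inter_self, integral_indicator_const _ (hE j), smul_eq_mul, mul_one]
      exact real_matchEvent P (cov y) (Finset.ne_of_mem_erase hj) (by omega)
    · rw [← hcard, ← nsmul_eq_mul]
      refine Finset.sum_le_card_nsmul _ _ _ fun k hk => ?_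
      rw [integral_indicator_const _ ((hE j).inter (hE k)), smul_eq_mul, mul_one]
      exact real_matchEvent_inter_le P (cov y) (Finset.ne_of_mem_erase hj)
        (Finset.ne_of_mem_erase (Finset.mem_of_mem_erase hk)) (Finset.ne_of_mem_erase hk).symm hM
  calc _ ≤ ∑ j ∈ Finset.univ.erase i, (I1 + (n - 2) * I2) := Finset.sum_le_sum h2
    _ = _ := by rw [Finset.sum_const, nsmul_eq_mul, card_erase_cast]; ring

/-- The second moment of the number of matches is at least the square of the first. -/
lemma sq_integral_matched_le :
    (∫ s, (matched M w i (Function.update s i y) : ℝ) ∂sampleLaw n P) ^ 2 ≤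
      ∫ s, (matched M w i (Function.update s i y) : ℝ) ^ 2 ∂sampleLaw n P := by
  have h1 := integrable_matched_pow (M := M) (w := w) P (y := y) i 1
  have h2 : MemLp (fun s => (matched M w i (Function.update s i y) : ℝ)) 2 (sampleLaw n P) := by
    rw [memLp_two_iff_integrable_sq]
    · exact integrable_matched_pow P i 2
    · simpa using h1.aestronglyMeasurable
  have h3 := variance_eq_sub h2
  have h4 := variance_nonneg (fun s => (matched M w i (Function.update s i y) : ℝ)) (sampleLaw n P)
  simp only [Pi.pow_apply] at h3
  linarith

end Moments

/-! ### Catchment areas of the design -/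

section CatchDesign

variable {m : ℕ} {P : Measure (Pop m)} [IsProbabilityMeasure P]
  {S : Set (Cov m)} {κ Γ L a η : ℝ} {g : Bool → Cov m → ℝ}

lemma axisPoint_eq_smul (m : ℕ) (t : ℝ) (j : Fin m × Bool) :
    axisPoint m t j = t • axisPoint m 1 j := by
  ext i
  rcases j with ⟨j, _ | _⟩ <;> by_cases h : i = j <;> simp [axisPoint, h, mul_comm]

/-- The relative error of the first-order expansion of the catchment area of `(x, w)` at level `t`:
the radius of the area, and the number of vertices of a cross-polytope of that order around `x` that
lie outside `S`. -/
noncomputable def relErr (P : Measure (Pop m)) (S : Set (Cov m)) (b : ℝ) (w : Bool)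
    (q : ℝ × Cov m) : ℝ :=
  rad m (q.1 / share P w / b) + ∑ j : Fin m × Bool,
    {q : ℝ × Cov m | q.2 + axisPoint m (2 * rad m (q.1 / share P w / b)) j ∉ S}.indicator
      (fun _ => (1 : ℝ)) q

lemma measurable_rad (m : ℕ) : Measurable (rad m) := by
  unfold rad; fun_prop

lemma measurableSet_exit (hS : MeasurableSet S) (b : ℝ) (w : Bool) (j : Fin m × Bool) :
    MeasurableSet {q : ℝ × Cov m |
      q.2 + axisPoint m (2 * rad m (q.1 / share P w / b)) j ∉ S} := by
  have h1 : Measurable fun q : ℝ × Cov m => 2 * rad m (q.1 / share P w / b) :=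
    ((measurable_rad m).comp ((measurable_fst.div_const _).div_const _)).const_mul _
  have : Measurable fun q : ℝ × Cov m =>
      q.2 + axisPoint m (2 * rad m (q.1 / share P w / b)) j := by
    simp_rw [axisPoint_eq_smul m (2 * _)]
    exact measurable_snd.add (h1.smul_const _)
  exact this hS.compl

lemma measurable_relErr (hS : MeasurableSet S) (b : ℝ) (w : Bool) :
    Measurable (relErr P S b w) := by
  have h1 : Measurable fun q : ℝ × Cov m => rad m (q.1 / share P w / b) :=
    (measurable_rad m).comp ((measurable_fst.div_const _).div_const _)
  exact h1.add (Finset.measurable_fun_sum _ fun j _ =>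
    measurable_const.indicator (measurableSet_exit hS b w j))

lemma real_near (w : Bool) (x z : Cov m) :
    P.real (near w x z) = share P w * reach (condLaw P w) x z :=
  condLaw_real w measurableSet_closedBall

/-- The constant in the bound of the mean relative error. -/
noncomputable def layerConst (m : ℕ) (κ Γ a : ℝ) : ℝ :=
  1 + 2 * m * (Γ * (m * 2 * (ballVol m * (rad m (1 / (κ * a)) + 2) ^ m)))

namespace Design

variable (h : Design P S κ Γ L a η g)
include h

lemma catchProb_eq (w : Bool) (x : Cov m) (t : ℝ) : catchProb P w x t =
    share P (!w) * (condLaw P (!w)).real {z | reach (condLaw P w) x z < t / share P w} := by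
  rw [← condLaw_real (!w) (measurableSet_reach_lt _ x _), catchProb]
  congr 1
  ext u
  simp only [catchSet, Set.mem_ofPred_eq, Set.mem_inter_iff, Set.mem_preimage, real_near,
    lt_div_iff₀ (h.share_pos w), mul_comm]

lemma catchProb_le (hm : 1 ≤ m) (w : Bool) {x : Cov m} (hx : x ∈ S) {t : ℝ} (ht : 0 ≤ t) :
    catchProb P w x t ≤ Γ / (κ * a) / share P w * t := by
  have h1 := h.share_pos w
  rw [h.catchProb_eq]
  have h2 := catchment_le hm h.closed h.bounded (h.dens w) (h.dens (!w)) h.κ_pos h.Γ_pos h.a_pos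
    h.frac hx (τ := t / share P w) (by positivity)
  calc _ ≤ 1 * (Γ / (κ * a) * (t / share P w)) :=
        mul_le_mul (share_le_one _) h2 measureReal_nonneg zero_le_one
    _ = _ := by ring

lemma odds_nonneg (w : Bool) {x : Cov m} (hx : x ∈ S) : 0 ≤ odds P g w x :=
  mul_nonneg (div_nonneg (h.share_pos _).le (h.share_pos _).le)
    (div_nonneg (h.dens_pos _ hx).le (h.dens_pos _ hx).le)

lemma odds_le (w : Bool) {x : Cov m} (hx : x ∈ S) : odds P g w x ≤ Γ / (κ * a) / share P w := by
  have h1 := h.share_pos w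
  have h2 := h.κ_pos
  have h3 := h.a_pos
  have h4 := h.Γ_pos
  have h5 : g (!w) x / g w x ≤ Γ / (κ * a) := by
    have := (h.dens w).lower x hx
    gcongr
    · exact (h.dens (!w)).upper x hx
    · nlinarith [h.a_lt]
  calc odds P g w x ≤ 1 / share P w * (Γ / (κ * a)) := by
        unfold odds
        exact mul_le_mul (by gcongr; exact share_le_one _) h5
          (div_nonneg (h.dens_pos _ hx).le (h.dens_pos _ hx).le) (by positivity)
    _ = _ := by ring

open Classical in
/-- The first-order expansion of the probability of a catchment area. -/
lemma abs_catchProb_sub_le (hm : 1 ≤ m) (w : Bool) {x : Cov m} (hx : x ∈ S) {t : ℝ} (ht : 0 ≤ t) :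
    |catchProb P w x t - odds P g w x * t| ≤
      catchConst κ Γ L a / share P w * (t * relErr P S (κ * a) w (t, x)) := by
  have h1 := h.share_pos w
  have hκ := h.κ_pos
  have hΓ := h.Γ_pos
  have ha := h.a_pos
  have hL := h.L_pos
  have hC : 0 ≤ catchConst κ Γ L a := by unfold catchConst; positivity
  have h2 := catchment_approx hm h.closed h.bounded (h.dens w) (h.dens (!w)) hκ hΓ ha h.a_lt hL
    h.frac hx (τ := t / share P w) (by positivity)
  set δ := rad m (t / share P w / (κ * a)) with hδdef
  have hδ : 0 ≤ δ := rad_nonneg (by positivity)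
  have h3 : (if Metric.closedBall x (2 * δ) ⊆ S then (0 : ℝ) else 1) ≤ ∑ j : Fin m × Bool,
      {q : ℝ × Cov m | q.2 + axisPoint m (2 * rad m (q.1 / share P w / (κ * a))) j ∉ S}.indicator
        (fun _ => (1 : ℝ)) (t, x) := by
    have hnn : ∀ j ∈ (Finset.univ : Finset (Fin m × Bool)), 0 ≤
        {q : ℝ × Cov m | q.2 + axisPoint m (2 * rad m (q.1 / share P w / (κ * a))) j ∉ S}.indicator
        (fun _ => (1 : ℝ)) (t, x) := fun j _ => Set.indicator_nonneg (fun _ _ => zero_le_one) _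
    split_ifs with hsub
    · exact Finset.sum_nonneg hnn
    · have : ∃ j, x + axisPoint m (2 * δ) j ∉ S := by
        by_contra hcon
        push Not at hcon
        exact hsub (closedBall_subset_of_axisPoint_mem hm h.convex hx (by positivity) hcon)
      obtain ⟨j, hj⟩ := this
      refine le_trans (le_of_eq ?_) (Finset.single_le_sum hnn (Finset.mem_univ j))
      rw [Set.indicator_of_mem]
      exact hj
  have h4 : δ + (if Metric.closedBall x (2 * δ) ⊆ S then (0 : ℝ) else 1) ≤
      relErr P S (κ * a) w (t, x) := by unfold relErr; linarith
  have e1 : catchProb P w x t - odds P g w x * t = share P (!w) *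
      ((condLaw P (!w)).real {z | reach (condLaw P w) x z < t / share P w} -
        g (!w) x / g w x * (t / share P w)) := by
    rw [h.catchProb_eq, odds]; ring
  rw [e1, abs_mul, abs_of_pos (h.share_pos (!w))]
  calc _ ≤ 1 * (catchConst κ Γ L a * (t / share P w) * relErr P S (κ * a) w (t, x)) := by
        refine mul_le_mul (share_le_one _) (h2.trans ?_) (abs_nonneg _) zero_le_one
        exact mul_le_mul_of_nonneg_left h4 (by positivity)
    _ = _ := by ring

lemma diam_le (hm : 1 ≤ m) : Metric.diam S ≤ rad m (1 / (κ * a)) := by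
  have hκ := h.κ_pos
  have ha := h.a_pos
  rw [le_rad_iff hm (by positivity) Metric.diam_nonneg]
  rcases (Metric.diam_nonneg (s := S)).eq_or_lt with h0 | h0
  · rw [← h0, zero_pow (by omega), mul_zero]; positivity
  have hne : S.Nonempty := by
    by_contra hcon
    rw [Set.not_nonempty_iff_eq_empty] at hcon
    simp [hcon] at h0
  obtain ⟨z, hz⟩ := hne
  have h1 := h.frac z hz _ h0 le_rfl
  have h2 : volume.real (Metric.closedBall z (Metric.diam S) ∩ S) ≤ volume.real S :=
    measureReal_mono Set.inter_subset_right h.bounded.measure_lt_top.ne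
  have h3 := (h.dens true).le_real h.closed.measurableSet (A := S) h.closed.measurableSet hκ.le
    (fun z hz => (h.dens true).lower z hz.1)
  have := isProbabilityMeasure_condLaw h.overlap h.η_pos true
  have h4 : (condLaw P true).real S ≤ 1 := measureReal_le_one
  rw [Set.inter_self] at h3
  rw [le_div_iff₀ (by positivity)]
  nlinarith

/-- The mean relative error is of the order of the radius. -/
lemma setIntegral_relErr_le (hm : 1 ≤ m) (w : Bool) {t : ℝ} (ht : 0 < t) :
    ∫ s in {u | treat u = w}, relErr P S (κ * a) w (t, cov s) ∂P ≤
      share P w * (layerConst m κ Γ a * rad m (t / share P w / (κ * a))) := by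
  have hκ := h.κ_pos
  have hΓ := h.Γ_pos
  have ha := h.a_pos
  have h1 := h.share_pos w
  set δ := rad m (t / share P w / (κ * a)) with hδdef
  have hδ : 0 < δ := Real.rpow_pos_of_pos (div_pos (by positivity) (ballVol_pos m)) _
  have hR := h.diam_le hm
  set R := rad m (1 / (κ * a))
  have hR0 : 0 ≤ R := rad_nonneg (by positivity)
  have hexit : ∀ j, P.real ({u | treat u = w} ∩ cov ⁻¹' {x | x + axisPoint m (2 * δ) j ∉ S}) ≤
      share P w * (Γ * (m * 2 * (ballVol m * (R + 2) ^ m)) * δ) := by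
    intro j
    have hm' : MeasurableSet {x : Cov m | x + axisPoint m (2 * δ) j ∉ S} :=
      (h.closed.measurableSet.preimage (measurable_add_const _)).compl
    rw [condLaw_real w hm']
    refine mul_le_mul_of_nonneg_left ?_ h1.le
    refine ((h.dens w).real_le h.closed.measurableSet h.bounded.measure_lt_top.ne hm' hΓ.le
      fun z hz => (h.dens w).upper z hz.2).trans ?_
    rw [mul_assoc Γ]
    refine mul_le_mul_of_nonneg_left ?_ hΓ.le
    rcases S.eq_empty_or_nonempty with hS | ⟨z, hz⟩
    · rw [hS, Set.inter_empty, measureReal_empty]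
      have := ballVol_pos m
      positivity
    have h2 := volume_real_exit_le h.closed h.convex (z := z) (R := R)
      (fun y hy => (Metric.dist_le_diam_of_mem h.bounded hy hz).trans hR) (axisPoint m (2 * δ) j)
      (c := m * (2 * δ)) (by positivity) (norm_axisPoint (by positivity) j).le
    rw [volume_real_closedBall z (by positivity)] at h2
    refine le_trans (le_of_eq ?_) (h2.trans (le_of_eq (by ring)))
    congr 1
    ext x; simp [and_comm]
  have hsetm : ∀ j, MeasurableSet (cov ⁻¹' {x : Cov m | x + axisPoint m (2 * δ) j ∉ S}) := fun j =>
    measurable_cov ((h.closed.measurableSet.preimage (measurable_add_const _)).compl)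
  have hfun : ∀ s : Pop m, relErr P S (κ * a) w (t, cov s) = δ + ∑ j : Fin m × Bool,
      (cov ⁻¹' {x : Cov m | x + axisPoint m (2 * δ) j ∉ S}).indicator (fun _ => (1 : ℝ)) s :=
    fun s => rfl
  simp_rw [hfun]
  rw [integral_add (integrable_const _) (integrable_finsetSum _ fun j _ =>
    (integrable_const _).indicator (hsetm j)), integral_finsetSum _ fun j _ =>
    (integrable_const _).indicator (hsetm j)]
  have h3 : ∀ j, ∫ s in {u | treat u = w},
      (cov ⁻¹' {x : Cov m | x + axisPoint m (2 * δ) j ∉ S}).indicator (fun _ => (1 : ℝ)) s ∂P =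
      P.real ({u | treat u = w} ∩ cov ⁻¹' {x | x + axisPoint m (2 * δ) j ∉ S}) := by
    intro j
    rw [integral_indicator_const _ (hsetm j), measureReal_restrict_apply (hsetm j), Set.inter_comm]
    simp
  simp_rw [h3]
  have h4 := Finset.sum_le_card_nsmul (Finset.univ : Finset (Fin m × Bool)) _ _ fun j _ => hexit j
  have h5 : ∫ s in {u | treat u = w}, δ ∂P = share P w * δ := by simp [share, mul_comm]
  rw [h5]
  refine (add_le_add_right h4 _).trans (le_of_eq ?_)
  simp only [Finset.card_univ, Fintype.card_prod, Fintype.card_fin, Fintype.card_bool, nsmul_eq_mul]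
  unfold layerConst
  push_cast
  ring

end Design

end CatchDesign

/-! ### The mean error of the squared weights -/

/-- The radius at the volume `t u` is bounded by a linear function of `t`, which reduces the mean
radius at a random volume to the mean volume. -/
lemma rad_mul_le {m : ℕ} (hm : 1 ≤ m) {s t u : ℝ} (hs : 0 < s) (ht : 0 ≤ t) (hu : 0 ≤ u) :
    rad m (t * u) ≤ rad m (s * u) * (1 + t / s) := by
  have hV := ballVol_pos m
  have h1 : (t / s) ^ (1 / (m : ℝ)) ≤ 1 + t / s := by
    have h0 : 0 ≤ t / s := by positivity
    have he : (1 : ℝ) / m ≤ 1 := by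
      rw [div_le_one (by positivity)]; exact_mod_cast hm
    rcases le_or_gt (t / s) 1 with h | h
    · linarith [Real.rpow_le_one h0 h (by positivity : (0 : ℝ) ≤ 1 / m)]
    · have := Real.rpow_le_rpow_of_exponent_le h.le he
      rw [Real.rpow_one] at this
      linarith
  have h2 : t * u / ballVol m = s * u / ballVol m * (t / s) := by field_simp
  rw [rad, h2, Real.mul_rpow (by positivity) (by positivity)]
  exact mul_le_mul_of_nonneg_left h1 (rad_nonneg (by positivity))

section ErrorBound

variable {m : ℕ} {P : Measure (Pop m)} [IsProbabilityMeasure P]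
  {S : Set (Cov m)} {κ Γ L a η : ℝ} {g : Bool → Cov m → ℝ}

/-- The expected squared weight of unit `i`, given that this unit is `y`. -/
noncomputable def meanSq {n : ℕ} (P : Measure (Pop m)) (M : ℕ) (i : Fin n) (y : Pop m) : ℝ :=
  ∫ s, weight M i (Function.update s i y) ^ 2 ∂sampleLaw n P

lemma meanSq_eq {n : ℕ} (M : ℕ) (i : Fin n) {y : Pop m} {w : Bool} (hy : treat y = w) :
    meanSq P M i y = 1 +
      2 * ((∫ s, (matched M w i (Function.update s i y) : ℝ) ∂sampleLaw n P) / M) +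
      (∫ s, (matched M w i (Function.update s i y) : ℝ) ^ 2 ∂sampleLaw n P) / M ^ 2 := by
  have h1 : ∀ s : Fin n → Pop m, weight M i (Function.update s i y) ^ 2 =
      1 + 2 / M * (matched M w i (Function.update s i y) : ℝ) +
        1 / M ^ 2 * (matched M w i (Function.update s i y) : ℝ) ^ 2 := by
    intro s
    rw [weight_sq, Function.update_self, hy]
    ring
  have i1 := integrable_matched_pow (M := M) (w := w) P (y := y) i 1
  simp only [pow_one] at i1
  have i2 := integrable_matched_pow (M := M) (w := w) P (y := y) i 2
  unfold meanSq
  simp_rw [h1]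
  have i3 : Integrable (fun s : Fin n → Pop m =>
      1 + 2 / M * (matched M w i (Function.update s i y) : ℝ)) (sampleLaw n P) :=
    (integrable_const _).add (i1.const_mul _)
  rw [integral_add i3 (i2.const_mul _), integral_add (integrable_const _) (i1.const_mul _),
    integral_const_mul, integral_const_mul]
  simp
  ring

lemma relErr_nonneg {b : ℝ} (hb : 0 ≤ b) (w : Bool) {t : ℝ} (ht : 0 ≤ t) (x : Cov m) :
    0 ≤ relErr P S b w (t, x) :=
  add_nonneg (rad_nonneg (div_nonneg (div_nonneg ht measureReal_nonneg) hb))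
    (Finset.sum_nonneg fun _ _ => Set.indicator_nonneg (fun _ _ => zero_le_one) _)

lemma relErr_le {b : ℝ} (hb : 0 ≤ b) (w : Bool) {t : ℝ} (ht : t ∈ Set.Ioc (0 : ℝ) 1) (x : Cov m) :
    relErr P S b w (t, x) ≤ rad m (1 / share P w / b) + m * 2 := by
  have hsh : 0 ≤ share P w := measureReal_nonneg
  refine add_le_add (rad_mono (div_nonneg (div_nonneg ht.1.le hsh) hb) ?_) ?_
  · gcongr
    exact ht.2
  · refine (Finset.sum_le_card_nsmul _ _ 1 fun j _ => ?_).trans ?_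
    · exact Set.indicator_le_self' (fun _ _ => zero_le_one) _
    · simp

lemma abs_pow_mul_relErr_le {b : ℝ} (hb : 0 ≤ b) (w : Bool) (j : ℕ) {t : ℝ}
    (ht : t ∈ Set.Ioc (0 : ℝ) 1) (x : Cov m) :
    |t ^ j * relErr P S b w (t, x)| ≤ rad m (1 / share P w / b) + m * 2 := by
  have h0 := relErr_nonneg (P := P) (S := S) hb w ht.1.le x
  rw [abs_of_nonneg (mul_nonneg (pow_nonneg ht.1.le _) h0)]
  calc _ ≤ 1 * relErr P S b w (t, x) :=
        mul_le_mul_of_nonneg_right (pow_le_one₀ ht.1.le ht.2) h0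
    _ ≤ _ := by rw [one_mul]; exact relErr_le hb w ht x

lemma measurable_pow_mul_relErr (hS : MeasurableSet S) (b : ℝ) (w : Bool) (j : ℕ) :
    Measurable fun q : ℝ × Cov m => q.1 ^ j * relErr P S b w q :=
  (measurable_fst.pow_const j).mul (measurable_relErr hS b w)

lemma integrable_pow_mul_relErr (hS : MeasurableSet S) {b : ℝ} (hb : 0 ≤ b) (w : Bool) (j : ℕ)
    (x : Cov m) (N M : ℕ) :
    Integrable (fun t => t ^ j * relErr P S b w (t, x)) (orderLaw N M) :=
  integrable_orderLaw ((measurable_pow_mul_relErr hS b w j).comp measurable_prodMk_right)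
    fun _ ht => abs_pow_mul_relErr_le hb w j ht x

/-- The mean of `t ^ j` times the relative error at `x`, over the random level `t`. -/
noncomputable def relMoment (P : Measure (Pop m)) (S : Set (Cov m)) (b : ℝ) (w : Bool)
    (N M j : ℕ) (x : Cov m) : ℝ :=
  ∫ t, t ^ j * relErr P S b w (t, x) ∂orderLaw N M

lemma relMoment_nonneg {b : ℝ} (hb : 0 ≤ b) (w : Bool) (N M j : ℕ) (x : Cov m) :
    0 ≤ relMoment P S b w N M j x := by
  refine integral_nonneg_of_ae ?_
  filter_upwards [orderLaw_ae_mem N M] with t ht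
  exact mul_nonneg (pow_nonneg ht.1.le _) (relErr_nonneg hb w ht.1.le x)

lemma relMoment_le {b : ℝ} (hb : 0 ≤ b) (w : Bool) (N M j : ℕ) (x : Cov m) :
    relMoment P S b w N M j x ≤
      (rad m (1 / share P w / b) + m * 2) * (orderLaw N M).real Set.univ := by
  refine (Real.le_norm_self _).trans (norm_integral_le_of_norm_le_const ?_)
  filter_upwards [orderLaw_ae_mem N M] with t ht
  exact abs_pow_mul_relErr_le hb w j ht x

lemma measurable_relMoment (hS : MeasurableSet S) (b : ℝ) (w : Bool) (N M j : ℕ) :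
    Measurable (relMoment P S b w N M j) :=
  ((measurable_pow_mul_relErr hS b w j).stronglyMeasurable.integral_prod_left').measurable

/-- The bound of the error of the expected squared weight of a unit `(x, w)`. -/
noncomputable def weightErr (P : Measure (Pop m)) (S : Set (Cov m)) (κ Γ L a : ℝ) (n M : ℕ)
    (w : Bool) (x : Cov m) : ℝ :=
  Γ / (κ * a) / share P w * (catchConst κ Γ L a / share P w) *
    (4 * ((n - 1) / M * relMoment P S (κ * a) w (n - 2) M 1 x) +
      2 * ((n - 1) * (n - 2) / M ^ 2 * relMoment P S (κ * a) w (n - 3) M 2 x)) +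
    2 * (Γ / (κ * a) / share P w) ^ 2 / M

namespace Design

variable (h : Design P S κ Γ L a η g)
include h

lemma setIntegral_relMoment_le (hm : 1 ≤ m) (w : Bool) {N M : ℕ} {j : ℕ} {r : ℝ} (hr : 0 < r) :
    ∫ s in {u | treat u = w}, relMoment P S (κ * a) w N M j (cov s) ∂P ≤
      share P w * layerConst m κ Γ a * rad m (r / share P w / (κ * a)) *
        (∫ t, t ^ j ∂orderLaw N M + (∫ t, t ^ (j + 1) ∂orderLaw N M) / r) := by
  have hκ := h.κ_pos
  have hΓ := h.Γ_pos
  have ha := h.a_pos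
  have h1 := h.share_pos w
  have hb : 0 ≤ κ * a := by positivity
  have hlay : 0 ≤ layerConst m κ Γ a := by
    have := ballVol_pos m
    have : 0 ≤ rad m (1 / (κ * a)) := rad_nonneg (by positivity)
    unfold layerConst; positivity
  set μw := P.restrict {u | treat u = w}
  have hmeas : Measurable fun q : Pop m × ℝ => q.2 ^ j * relErr P S (κ * a) w (q.2, cov q.1) :=
    (measurable_pow_mul_relErr h.closed.measurableSet (κ * a) w j).comp
      (measurable_snd.prodMk (measurable_cov.comp measurable_fst))
  have hae : ∀ᵐ q ∂μw.prod (orderLaw N M), q.2 ∈ Set.Ioc (0 : ℝ) 1 :=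
    Measure.quasiMeasurePreserving_snd.ae (orderLaw_ae_mem N M)
  have hint : Integrable (Function.uncurry fun (s : Pop m) t =>
      t ^ j * relErr P S (κ * a) w (t, cov s)) (μw.prod (orderLaw N M)) := by
    refine Integrable.of_bound hmeas.aestronglyMeasurable (rad m (1 / share P w / (κ * a)) + m * 2) ?_
    filter_upwards [hae] with q hq
    exact abs_pow_mul_relErr_le hb w j hq _
  unfold relMoment
  rw [integral_integral_swap hint]
  have hR : 0 ≤ rad m (r / share P w / (κ * a)) := rad_nonneg (by positivity)
  set A := share P w * layerConst m κ Γ a * rad m (r / share P w / (κ * a)) with hA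
  have i1 := integrable_pow_orderLaw N M j
  have i2 := integrable_pow_orderLaw N M (j + 1)
  calc ∫ t, ∫ s, t ^ j * relErr P S (κ * a) w (t, cov s) ∂μw ∂orderLaw N M
      ≤ ∫ t, A * (t ^ j + t ^ (j + 1) / r) ∂orderLaw N M := by
        refine integral_mono_ae hint.integral_prod_right
          ((i1.add (i2.div_const r)).const_mul A) ?_
        filter_upwards [orderLaw_ae_mem N M] with t ht
        have ht0 := ht.1
        rw [integral_const_mul]
        have h2 := h.setIntegral_relErr_le hm w ht0
        have h3 : rad m (t / share P w / (κ * a)) ≤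
            rad m (r / share P w / (κ * a)) * (1 + t / r) := by
          have := rad_mul_le hm (u := 1 / share P w / (κ * a)) hr ht0.le (by positivity)
          convert this using 2 <;> ring_nf
        calc t ^ j * ∫ s, relErr P S (κ * a) w (t, cov s) ∂μw
            ≤ t ^ j * (share P w * (layerConst m κ Γ a *
                (rad m (r / share P w / (κ * a)) * (1 + t / r)))) := by
              refine mul_le_mul_of_nonneg_left (h2.trans ?_) (by positivity)
              gcongr
          _ = A * (t ^ j + t ^ (j + 1) / r) := by rw [hA]; field_simp; ring
    _ = _ := by
        rw [integral_const_mul, integral_add i1 (i2.div_const r), integral_div]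

lemma abs_integral_catchProb_sub_le (hm : 1 ≤ m) (w : Bool) {x : Cov m} (hx : x ∈ S) (N M : ℕ) :
    |∫ t, catchProb P w x t ∂orderLaw N M - odds P g w x * ∫ t, t ∂orderLaw N M| ≤
      catchConst κ Γ L a / share P w * relMoment P S (κ * a) w N M 1 x := by
  have hb : 0 ≤ κ * a := mul_nonneg h.κ_pos.le h.a_pos.le
  have hFi : Integrable (catchProb P w x) (orderLaw N M) :=
    integrable_orderLaw (measurable_catchProb P x w) (C := 1) fun t _ => by
      rw [abs_of_nonneg (catchProb_nonneg P x w t)]; exact catchProb_le_one P x w t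
  have hid : Integrable (fun t : ℝ => t) (orderLaw N M) := by
    simpa using integrable_pow_orderLaw N M 1
  have h1 := integrable_pow_mul_relErr (P := P) h.closed.measurableSet hb w 1 x N M
  rw [← integral_const_mul, ← integral_sub hFi (hid.const_mul _), relMoment, ← integral_const_mul,
    ← Real.norm_eq_abs]
  refine norm_integral_le_of_norm_le (h1.const_mul _) ?_
  filter_upwards [orderLaw_ae_mem N M] with t ht
  rw [pow_one, Real.norm_eq_abs]
  exact h.abs_catchProb_sub_le hm w hx ht.1.le

lemma integral_catchProb_sq_le (hm : 1 ≤ m) (w : Bool) {x : Cov m} (hx : x ∈ S) (N M : ℕ) :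
    ∫ t, catchProb P w x t ^ 2 ∂orderLaw N M ≤ odds P g w x ^ 2 * ∫ t, t ^ 2 ∂orderLaw N M +
      2 * (Γ / (κ * a)) / share P w * (catchConst κ Γ L a / share P w) *
        relMoment P S (κ * a) w N M 2 x := by
  have hb : 0 ≤ κ * a := mul_nonneg h.κ_pos.le h.a_pos.le
  have hFi : Integrable (fun t => catchProb P w x t ^ 2) (orderLaw N M) :=
    integrable_orderLaw ((measurable_catchProb P x w).pow_const 2) (C := 1) fun t _ => by
      rw [abs_of_nonneg (sq_nonneg _)]
      exact pow_le_one₀ (catchProb_nonneg P x w t) (catchProb_le_one P x w t)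
  have h1 := integrable_pow_mul_relErr (P := P) h.closed.measurableSet hb w 2 x N M
  have h2 := (integrable_pow_orderLaw N M 2).const_mul (odds P g w x ^ 2)
  rw [relMoment, ← integral_const_mul, ← integral_const_mul, ← integral_add h2 (h1.const_mul _)]
  refine integral_mono_ae hFi (h2.add (h1.const_mul _)) ?_
  filter_upwards [orderLaw_ae_mem N M] with t ht
  have ht0 := ht.1.le
  have hE := h.abs_catchProb_sub_le hm w hx ht0
  have hF0 := catchProb_nonneg P x w t
  have hF1 := h.catchProb_le hm w hx ht0
  have hr0 := mul_nonneg (h.odds_nonneg w hx) ht0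
  have hr1 := mul_le_mul_of_nonneg_right (h.odds_le w hx) ht0
  show catchProb P w x t ^ 2 ≤ odds P g w x ^ 2 * t ^ 2 + 2 * (Γ / (κ * a)) / share P w *
    (catchConst κ Γ L a / share P w) * (t ^ 2 * relErr P S (κ * a) w (t, x))
  generalize catchProb P w x t = F at *
  generalize odds P g w x = r at *
  generalize relErr P S (κ * a) w (t, x) = R at *
  have e1 : 2 * (Γ / (κ * a)) / share P w * (catchConst κ Γ L a / share P w) * (t ^ 2 * R) =
      2 * (Γ / (κ * a) / share P w * t) * (catchConst κ Γ L a / share P w * (t * R)) := by ring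
  have e2 : (F + r * t) * |F - r * t| ≤
      2 * (Γ / (κ * a) / share P w * t) * (catchConst κ Γ L a / share P w * (t * R)) :=
    mul_le_mul (by linarith) hE (abs_nonneg _) (by linarith)
  have e3 : (F + r * t) * (F - r * t) ≤ (F + r * t) * |F - r * t| :=
    mul_le_mul_of_nonneg_left (le_abs_self _) (by linarith)
  rw [e1]
  linarith

lemma integral_catchProb_le (hm : 1 ≤ m) (w : Bool) {x : Cov m} (hx : x ∈ S) (N M : ℕ) :
    ∫ t, catchProb P w x t ∂orderLaw N M ≤ Γ / (κ * a) / share P w * ∫ t, t ∂orderLaw N M := by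
  have hFi : Integrable (catchProb P w x) (orderLaw N M) :=
    integrable_orderLaw (measurable_catchProb P x w) (C := 1) fun t _ => by
      rw [abs_of_nonneg (catchProb_nonneg P x w t)]; exact catchProb_le_one P x w t
  have hid : Integrable (fun t : ℝ => t) (orderLaw N M) := by
    simpa using integrable_pow_orderLaw N M 1
  rw [← integral_const_mul]
  refine integral_mono_ae hFi (hid.const_mul _) ?_
  filter_upwards [orderLaw_ae_mem N M] with t ht using h.catchProb_le hm w hx ht.1.le

omit h in
/-- The elementary estimate behind `abs_meanSq_sub_le`: `q₁` and `q₂` are the normalized first two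
moments of the number of matches, `b` and `d` the constants of the expansion of the catchment
areas. -/
lemma abs_second_moment_sub_le {q₁ q₂ r b d T₁ T₂ M : ℝ} (hM : 0 < M) (hr : 0 ≤ r) (hrb : r ≤ b)
    (hb : 1 ≤ b) (hd : 0 ≤ d) (hT₁ : 0 ≤ T₁) (hT₂ : 0 ≤ T₂) (hq0 : 0 ≤ q₁) (hqb : q₁ ≤ b)
    (hq₁ : |q₁ - r| ≤ d * T₁) (hlow : q₁ ^ 2 ≤ q₂)
    (hup : q₂ ≤ q₁ / M + r ^ 2 * (1 + 1 / M) + 2 * b * d * T₂) :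
    |1 + 2 * q₁ + q₂ - (1 + r) ^ 2| ≤ b * d * (4 * T₁ + 2 * T₂) + 2 * b ^ 2 / M := by
  have hDT : 0 ≤ d * T₁ := by positivity
  have hsq : |q₁ ^ 2 - r ^ 2| ≤ 2 * b * (d * T₁) := by
    have : q₁ ^ 2 - r ^ 2 = (q₁ + r) * (q₁ - r) := by ring
    rw [this, abs_mul, abs_of_nonneg (by linarith : 0 ≤ q₁ + r)]
    exact mul_le_mul (by linarith) hq₁ (abs_nonneg _) (by linarith)
  have hsmall : q₁ / M + r ^ 2 / M ≤ 2 * b ^ 2 / M := by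
    rw [← add_div]
    gcongr
    nlinarith
  have hlin : 2 * (d * T₁) ≤ 2 * b * (d * T₁) := by nlinarith
  have hnn2 : 0 ≤ 2 * b * d * T₂ := by positivity
  have hnn3 : 0 ≤ 2 * b ^ 2 / M := by positivity
  have hexp : r ^ 2 * (1 + 1 / M) = r ^ 2 + r ^ 2 / M := by ring
  have h1 := abs_le.1 hq₁
  have h2 := abs_le.1 hsq
  rw [abs_le]
  constructor <;> nlinarith [h1.1, h1.2, h2.1, h2.2]

/-- The first-order expansion of the expected squared weight, before averaging over the unit. -/
lemma abs_meanSq_sub_le (hm : 1 ≤ m) {n M : ℕ} (hM1 : 1 ≤ M) (hMn : M + 3 ≤ n) (i : Fin n)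
    {y : Pop m} {w : Bool} (hy : treat y = w) (hx : cov y ∈ S) (hB1 : 1 ≤ Γ / (κ * a)) :
    |meanSq P M i y - (1 + odds P g w (cov y)) ^ 2| ≤
      weightErr P S κ Γ L a n M w (cov y) := by
  have hn3 : (3 : ℝ) ≤ n := by exact_mod_cast (by omega : 3 ≤ n)
  have hM0 : (0 : ℝ) < M := by exact_mod_cast hM1
  have hn1 : (0 : ℝ) < n - 1 := by linarith
  have hn2 : (0 : ℝ) < n - 2 := by linarith
  have hsh := h.share_pos w
  have hb : 0 ≤ κ * a := mul_nonneg h.κ_pos.le h.a_pos.le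
  have hD : 0 ≤ catchConst κ Γ L a / share P w := by
    have := h.κ_pos; have := h.Γ_pos; have := h.a_pos; have := h.L_pos
    unfold catchConst; positivity
  have hR1 := relMoment_nonneg (P := P) (S := S) hb w (n - 2) M 1 (cov y)
  have hR2 := relMoment_nonneg (P := P) (S := S) hb w (n - 3) M 2 (cov y)
  have hr0 := h.odds_nonneg w hx
  have hr1 := h.odds_le w hx
  have hk1 := integral_matched P hy i (M := M) (by omega)
  have hk2 := integral_matched_sq_le P hy i (M := M) (by omega) (by omega)
  have hk12 := sq_integral_matched_le P hy i (M := M)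
  have c2 : ((n - 2 : ℕ) : ℝ) = n - 2 := by push_cast [Nat.cast_sub (by omega : 2 ≤ n)]; ring
  have c3 : ((n - 3 : ℕ) : ℝ) = n - 3 := by push_cast [Nat.cast_sub (by omega : 3 ≤ n)]; ring
  have m1 : ∫ t, t ∂orderLaw (n - 2) M = M / (n - 1) := by
    rw [integral_one_orderLaw hM1 (by omega), c2]; ring
  have m2 : ∫ t, t ^ 2 ∂orderLaw (n - 3) M = M * (M + 1) / ((n - 2) * (n - 1)) := by
    rw [integral_sq_orderLaw hM1 (by omega), c3]; ring
  have e1 := h.abs_integral_catchProb_sub_le hm w hx (n - 2) M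
  have e2 := h.integral_catchProb_sq_le hm w hx (n - 3) M
  have e3 := h.integral_catchProb_le hm w hx (n - 2) M
  have e4 : 0 ≤ ∫ t, catchProb P w (cov y) t ∂orderLaw (n - 2) M :=
    integral_nonneg fun t => catchProb_nonneg P (cov y) w t
  have hBs : 1 ≤ Γ / (κ * a) / share P w := by
    rw [le_div_iff₀ hsh]; linarith [share_le_one (P := P) w]
  rw [m1] at e1 e3
  rw [m2] at e2
  rw [meanSq_eq M i hy, weightErr]
  have e2' : ∫ t, catchProb P w (cov y) t ^ 2 ∂orderLaw (n - 3) M ≤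
      odds P g w (cov y) ^ 2 * (M * (M + 1) / ((n - 2) * (n - 1))) +
      2 * (Γ / (κ * a) / share P w) * (catchConst κ Γ L a / share P w) *
        relMoment P S (κ * a) w (n - 3) M 2 (cov y) := e2.trans (le_of_eq (by ring))
  clear e2
  generalize (∫ s, (matched M w i (Function.update s i y) : ℝ) ∂sampleLaw n P) = k1 at *
  generalize (∫ s, (matched M w i (Function.update s i y) : ℝ) ^ 2 ∂sampleLaw n P) = k2 at *
  generalize (∫ t, catchProb P w (cov y) t ∂orderLaw (n - 2) M) = I1 at *
  generalize (∫ t, catchProb P w (cov y) t ^ 2 ∂orderLaw (n - 3) M) = I2 at *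
  generalize relMoment P S (κ * a) w (n - 2) M 1 (cov y) = R1 at *
  generalize relMoment P S (κ * a) w (n - 3) M 2 (cov y) = R2 at *
  generalize odds P g w (cov y) = r at *
  generalize Γ / (κ * a) / share P w = b at *
  generalize catchConst κ Γ L a / share P w = d at *
  subst hk1
  refine abs_second_moment_sub_le hM0 hr0 hr1 hBs hD (by positivity) (by positivity)
    (by positivity) ?_ ?_ ?_ ?_
  · rw [div_le_iff₀ hM0]
    calc (n - 1) * I1 ≤ (n - 1) * (b * (M / (n - 1))) := mul_le_mul_of_nonneg_left e3 hn1.le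
      _ = b * M := by field_simp
  · have : (n - 1) * I1 / M - r = (n - 1) / M * (I1 - r * (M / (n - 1))) := by field_simp
    rw [this, abs_mul, abs_of_nonneg (by positivity : 0 ≤ ((n : ℝ) - 1) / M)]
    calc _ ≤ (n - 1) / M * (d * R1) := mul_le_mul_of_nonneg_left e1 (by positivity)
      _ = _ := by ring
  · rw [div_pow]; gcongr
  · calc k2 / M ^ 2 ≤ ((n - 1) * I1 + (n - 1) * (n - 2) * I2) / M ^ 2 := by gcongr
      _ = (n - 1) * I1 / M / M + (n - 1) * (n - 2) / M ^ 2 * I2 := by field_simp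
      _ ≤ (n - 1) * I1 / M / M + (n - 1) * (n - 2) / M ^ 2 *
          (r ^ 2 * (M * (M + 1) / ((n - 2) * (n - 1))) + 2 * b * d * R2) := by gcongr
      _ = _ := by field_simp; ring

end Design

end ErrorBound

/-! ### From the squared weights to the variance -/

section Transfer

variable {m n : ℕ} {P : Measure (Pop m)} [IsProbabilityMeasure P] {μ : Bool → Cov m → ℝ}
  {S : Set (Cov m)} {κ Γ L a η p : ℝ} {g : Bool → Cov m → ℝ} {c : Constants}

lemma AssumptionB.integral_mul_moment_le (hB : AssumptionB c p P μ) (w : Bool) {f : Pop m → ℝ}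
    (hf : Measurable[sigmaXD m] f) (hf0 : ∀ s, 0 ≤ f s) {K : ℝ} (hfK : ∀ s, f s ≤ K)
    (hfw : ∀ s, treat s ≠ w → f s = 0) :
    ∫ s, f s * |potential w s - μ w (cov s)| ^ (4 + p) ∂P ≤ c.Mu * ∫ s, f s ∂P := by
  have hfm : Measurable f := hf.mono (sigmaXD_le m) le_rfl
  have hfb : ∀ s, ‖f s‖ ≤ K := fun s => by rw [Real.norm_of_nonneg (hf0 s)]; exact hfK s
  have hfi : Integrable f P := Integrable.of_bound hfm.aestronglyMeasurable K (ae_of_all _ hfb)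
  have hi := (hB.moment_integrable w).bdd_mul hfm.aestronglyMeasurable (ae_of_all _ hfb)
  have h1 := condExp_mul_of_stronglyMeasurable_left hf.stronglyMeasurable hi
    (hB.moment_integrable w)
  rw [← integral_condExp (sigmaXD_le m), ← integral_const_mul]
  refine integral_mono_ae integrable_condExp (hfi.const_mul _) ?_
  filter_upwards [h1, hB.moment_le w] with s hs1 hs2
  have hs1' : (P[fun s => f s * |potential w s - μ w (cov s)| ^ (4 + p) | sigmaXD m]) s =
      f s * (P[fun s => |potential w s - μ w (cov s)| ^ (4 + p) | sigmaXD m]) s := hs1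
  rw [hs1']
  by_cases hw : treat s = w
  · rw [mul_comm]; exact mul_le_mul_of_nonneg_right (hs2 hw) (hf0 s)
  · simp [hfw s hw]

/-- The conditional second moments of the errors are bounded by `1 + M_u`. -/
lemma AssumptionB.setIntegral_mul_sq_dev_le (hB : AssumptionB c p P μ) (w : Bool) {b : Cov m → ℝ}
    (hb : Measurable b) (hb0 : ∀ x, 0 ≤ b x) {K : ℝ} (hbK : ∀ x, b x ≤ K) :
    ∫ s in {u | treat u = w}, b (cov s) * dev μ w s ^ 2 ∂P ≤
      (1 + c.Mu) * ∫ s in {u | treat u = w}, b (cov s) ∂P := by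
  classical
  have hA : MeasurableSet {u : Pop m | treat u = w} := measurableSet_treat_eq w
  set f : Pop m → ℝ := {u : Pop m | treat u = w}.indicator fun s => b (cov s) with hfdef
  have hf : Measurable[sigmaXD m] f :=
    (hb.comp (measurable_cov_sigmaXD m)).indicator
      (measurable_treat_sigmaXD m (measurableSet_singleton w))
  have hf0 : ∀ s, 0 ≤ f s := fun s => Set.indicator_nonneg (fun _ _ => hb0 _) s
  have hfK : ∀ s, f s ≤ K := fun s => (Set.indicator_le_self' (fun _ _ => hb0 _) s).trans (hbK _)
  have hfm : Measurable f := hf.mono (sigmaXD_le m) le_rfl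
  have hfb : ∀ s, ‖f s‖ ≤ K := fun s => by rw [Real.norm_of_nonneg (hf0 s)]; exact hfK s
  have hfi : Integrable f P := Integrable.of_bound hfm.aestronglyMeasurable K (ae_of_all _ hfb)
  have h1 := hB.integral_mul_moment_le w hf hf0 hfK fun s hs =>
    Set.indicator_of_notMem (s := {u : Pop m | treat u = w}) hs _
  have hi1 := (hB.moment_integrable w).bdd_mul hfm.aestronglyMeasurable (ae_of_all _ hfb)
  have hi2 := ((hB.memLp_dev w).integrable_sq).bdd_mul hfm.aestronglyMeasurable (ae_of_all _ hfb)
  have e1 : ∫ s in {u | treat u = w}, b (cov s) * dev μ w s ^ 2 ∂P =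
      ∫ s, f s * dev μ w s ^ 2 ∂P := by
    rw [← integral_indicator hA]
    refine integral_congr_ae (ae_of_all _ fun s => ?_)
    simp only [hfdef, Set.indicator_apply]
    split_ifs <;> simp
  rw [e1, ← integral_indicator hA]
  calc ∫ s, f s * dev μ w s ^ 2 ∂P
      ≤ ∫ s, (f s + f s * |potential w s - μ w (cov s)| ^ (4 + p)) ∂P := by
        refine integral_mono hi2 (hfi.add hi1) fun s => ?_
        have := mul_le_mul_of_nonneg_left (sq_le_one_add_rpow (dev μ w s) hB.p_pos) (hf0 s)
        rw [mul_add, mul_one] at this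
        exact this
    _ = ∫ s, f s ∂P + ∫ s, f s * |potential w s - μ w (cov s)| ^ (4 + p) ∂P :=
        integral_add hfi hi1
    _ ≤ (1 + c.Mu) * ∫ s, f s ∂P := by linarith

/-- Conditioning on unit `i`. -/
lemma integral_weight_sq_mul_err_sq (hB : AssumptionB c p P μ) {M : ℕ} (hM : 1 ≤ M) (i : Fin n) :
    Integrable (fun y => meanSq P M i y * err μ y ^ 2) P ∧
      ∫ s, weight M i s ^ 2 * err μ (s i) ^ 2 ∂sampleLaw n P =
        ∫ y, meanSq P M i y * err μ y ^ 2 ∂P := by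
  have hi : Integrable (fun s => weight M i s ^ 2 * err μ (s i) ^ 2)
      (Measure.pi fun _ : Fin n => P) := by
    have := (memLp_weight_mul_err (n := n) hB hM i).integrable_sq
    simp only [mul_pow] at this
    exact this
  have e : ∀ y, ∫ s, weight M i (Function.update s i y) ^ 2 *
      err μ (Function.update s i y i) ^ 2 ∂(Measure.pi fun _ : Fin n => P) =
      meanSq P M i y * err μ y ^ 2 := by
    intro y
    simp only [Function.update_self]
    rw [integral_mul_const]
    rfl
  refine ⟨?_, ?_⟩
  · have := (Integrable.comp_update hi i).integral_prod_left
    exact this.congr (ae_of_all _ e)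
  · rw [sampleLaw, integral_resample hi i]
    exact integral_congr_ae (ae_of_all _ e)

omit [IsProbabilityMeasure P] in
lemma integral_eq_sum_treat {f : Pop m → ℝ} (hf : Integrable f P) :
    ∫ s, f s ∂P = ∑ w : Bool, ∫ s in {u | treat u = w}, f s ∂P := by
  have h1 : {u : Pop m | treat u = true}ᶜ = {u | treat u = false} := by
    ext u; simp
  rw [Fintype.sum_bool, ← h1, integral_add_compl (measurableSet_treat_eq true) hf]

/-- A bound of the error of the expected squared weights yields one of the error of the variance. -/
lemma Design.abs_varMain_sub_limitVar_le (h : Design P S κ Γ L a η g)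
    (hA : AssumptionA c η P)
    (hB : AssumptionB c p P μ) (hn : 1 ≤ n) {M : ℕ} (hM : 1 ≤ M) {b : Bool → Cov m → ℝ}
    (hbm : ∀ w, Measurable (b w)) (hb0 : ∀ w x, 0 ≤ b w x) {K : ℝ} (hbK : ∀ w x, b w x ≤ K)
    {β : ℝ} (hβ : ∀ w, ∫ s in {u | treat u = w}, b w (cov s) ∂P ≤ β)
    (hsq : ∀ (i : Fin n) (y : Pop m) (w : Bool), treat y = w → cov y ∈ S →
      |meanSq P M i y - (1 + odds P g w (cov y)) ^ 2| ≤ b w (cov y)) :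
    |n * varMain n M P μ - limitVar P μ| ≤ 2 * (1 + c.Mu) * β := by
  have hn0 : (0 : ℝ) < n := by positivity
  have hMu := hB.Mu_pos
  set V : ℝ := ∑ w : Bool,
    ∫ s in {u | treat u = w}, (1 + odds P g w (cov s)) ^ 2 * dev μ w s ^ 2 ∂P
  have hi : ∀ i : Fin n, |∫ s, weight M i s ^ 2 * err μ (s i) ^ 2 ∂sampleLaw n P - V| ≤
      2 * (1 + c.Mu) * β := by
    intro i
    obtain ⟨i1, e1⟩ := integral_weight_sq_mul_err_sq (n := n) hB hM i
    rw [e1, integral_eq_sum_treat i1, ← Finset.sum_sub_distrib]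
    have hw : ∀ w : Bool, |∫ s in {u | treat u = w}, meanSq P M i s * err μ s ^ 2 ∂P -
        ∫ s in {u | treat u = w}, (1 + odds P g w (cov s)) ^ 2 * dev μ w s ^ 2 ∂P| ≤
        (1 + c.Mu) * β := by
      intro w
      have hAw : MeasurableSet {u : Pop m | treat u = w} := measurableSet_treat_eq w
      have hod : Integrable (fun s => (1 + odds P g w (cov s)) ^ 2 * dev μ w s ^ 2) P := by
        refine ((hB.memLp_dev w).integrable_sq).bdd_mul
          (c := (1 + Γ / (κ * a) / share P w) ^ 2)
          (((h.measurable_odds w).comp measurable_cov).const_add 1 |>.pow_const 2).aestronglyMeasurable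
          ?_
        filter_upwards [h.ae_mem] with s hs
        have h1 := h.odds_nonneg w hs
        rw [Real.norm_of_nonneg (sq_nonneg _)]
        have := h.odds_le w hs
        gcongr
      have hdom : Integrable (fun s => b w (cov s) * dev μ w s ^ 2) P := by
        refine ((hB.memLp_dev w).integrable_sq).bdd_mul (c := K)
          ((hbm w).comp measurable_cov).aestronglyMeasurable (ae_of_all _ fun s => ?_)
        rw [Real.norm_of_nonneg (hb0 _ _)]
        exact hbK _ _
      rw [← integral_sub i1.integrableOn hod.integrableOn, ← Real.norm_eq_abs]
      refine (norm_integral_le_of_norm_le hdom.integrableOn ?_).trans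
        ((hB.setIntegral_mul_sq_dev_le w (hbm w) (hb0 w) (hbK w)).trans
          (mul_le_mul_of_nonneg_left (hβ w) (by linarith)))
      filter_upwards [ae_restrict_mem hAw, ae_restrict_of_ae h.ae_mem] with s hs1 hs2
      rw [err_eq_dev μ hs1, ← sub_mul, norm_mul, Real.norm_of_nonneg (sq_nonneg (dev μ w s))]
      exact mul_le_mul_of_nonneg_right (hsq i s w hs1 hs2) (sq_nonneg _)
    refine (Finset.abs_sum_le_sum_abs _ _).trans ?_
    rw [Fintype.sum_bool]
    linarith [hw true, hw false]
  rw [varMain_eq hB hn hM, limitVar_eq h hA hB, add_sub_add_left_eq_sub]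
  have e : (1 / n : ℝ) * ∑ i, ∫ s, weight M i s ^ 2 * err μ (s i) ^ 2 ∂sampleLaw n P - V =
      (1 / n : ℝ) * ∑ i : Fin n,
        (∫ s, weight M i s ^ 2 * err μ (s i) ^ 2 ∂sampleLaw n P - V) := by
    rw [Finset.sum_sub_distrib, mul_sub]
    simp only [Finset.sum_const, Finset.card_univ, Fintype.card_fin, nsmul_eq_mul]
    field_simp
  rw [e, abs_mul, abs_of_pos (by positivity)]
  calc _ ≤ (1 / n : ℝ) * ∑ _i : Fin n, 2 * (1 + c.Mu) * β := by
        gcongr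
        exact (Finset.abs_sum_le_sum_abs _ _).trans (Finset.sum_le_sum fun i _ => hi i)
    _ = _ := by simp; field_simp

end Transfer

/-! ### The rate -/

section Rate

variable {m n : ℕ} {P : Measure (Pop m)} [IsProbabilityMeasure P] {μ : Bool → Cov m → ℝ}
  {S : Set (Cov m)} {κ Γ L a η p : ℝ} {g : Bool → Cov m → ℝ} {c : Constants}

/-- The constant of the rate for the expected squared weights. -/
noncomputable def rateConst (m : ℕ) (κ Γ L a : ℝ) : ℝ :=
  28 * (Γ / (κ * a)) * catchConst κ Γ L a * layerConst m κ Γ a * rad m (1 / (κ * a)) +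
    13 * (Γ / (κ * a)) ^ 2

lemma rad_mul_eq {m : ℕ} {u v : ℝ} (hu : 0 ≤ u) (hv : 0 ≤ v) :
    rad m (u * v) = rad m v * u ^ (1 / (m : ℝ)) := by
  have hV := ballVol_pos m
  rw [rad, rad, mul_div_assoc, Real.mul_rpow hu (by positivity), mul_comm]

lemma layerConst_nonneg (m : ℕ) (hκ : 0 < κ) (hΓ : 0 < Γ) (ha : 0 < a) :
    0 ≤ layerConst m κ Γ a := by
  have := ballVol_pos m
  have : 0 ≤ rad m (1 / (κ * a)) := rad_nonneg (by positivity)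
  unfold layerConst; positivity

lemma catchConst_nonneg (hκ : 0 < κ) (hΓ : 0 < Γ) (hL : 0 < L) (ha : 0 < a) :
    0 ≤ catchConst κ Γ L a := by
  unfold catchConst; positivity

namespace Design

variable (h : Design P S κ Γ L a η g)
include h

lemma one_le_ratio : 1 ≤ Γ / (κ * a) := by
  obtain ⟨s, hs⟩ := h.ae_mem.exists
  have h1 := (h.dens true).lower _ hs
  have h2 := (h.dens true).upper _ hs
  rw [le_div_iff₀ (mul_pos h.κ_pos h.a_pos)]
  nlinarith [h.κ_pos, h.a_lt]

/-- The mean of the bound of the error is of the order of the radius plus `1 / M`. -/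
lemma setIntegral_weightErr_le (hm : 1 ≤ m) {M : ℕ} (hM1 : 1 ≤ M) (hMn : M + 3 ≤ n) (w : Bool) :
    ∫ s in {u | treat u = w}, weightErr P S κ Γ L a n M w (cov s) ∂P ≤
      rateConst m κ Γ L a / η * ((M / (n * η)) ^ (1 / (m : ℝ)) + 1 / M) := by
  have hn3 : (3 : ℝ) ≤ n := by exact_mod_cast (by omega : 3 ≤ n)
  have hM1' : (1 : ℝ) ≤ M := by exact_mod_cast hM1
  have hM0 : (0 : ℝ) < M := by linarith
  have hn1 : (0 : ℝ) < n - 1 := by linarith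
  have hn2 : (0 : ℝ) < n - 2 := by linarith
  have hn0 : (0 : ℝ) < n := by linarith
  have hκ := h.κ_pos
  have ha := h.a_pos
  have hΓ := h.Γ_pos
  have hη := h.η_pos
  have hsh := h.share_pos w
  have hηsh : η ≤ share P w := h.overlap.le_share w
  have hb : 0 ≤ κ * a := by positivity
  have hB := h.one_le_ratio
  have hD := catchConst_nonneg hκ hΓ h.L_pos ha
  have hΛ := layerConst_nonneg m hκ hΓ ha
  have c2 : ((n - 2 : ℕ) : ℝ) = n - 2 := by push_cast [Nat.cast_sub (by omega : 2 ≤ n)]; ring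
  have c3 : ((n - 3 : ℕ) : ℝ) = n - 3 := by push_cast [Nat.cast_sub (by omega : 3 ≤ n)]; ring
  have hr : (0 : ℝ) < M / n := by positivity
  have hR1 := h.setIntegral_relMoment_le hm w (N := n - 2) (M := M) (j := 1) hr
  have hR2 := h.setIntegral_relMoment_le hm w (N := n - 3) (M := M) (j := 2) hr
  have m1 : ∫ t, t ^ 1 ∂orderLaw (n - 2) M = M / (n - 1) := by
    simp only [pow_one]
    rw [integral_one_orderLaw hM1 (by omega), c2]; ring
  have m2 : ∫ t, t ^ (1 + 1) ∂orderLaw (n - 2) M = M * (M + 1) / ((n - 1) * n) := by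
    rw [integral_sq_orderLaw hM1 (by omega), c2]; ring
  have m3 : ∫ t, t ^ 2 ∂orderLaw (n - 3) M = M * (M + 1) / ((n - 2) * (n - 1)) := by
    rw [integral_sq_orderLaw hM1 (by omega), c3]; ring
  have m4 : ∫ t, t ^ (2 + 1) ∂orderLaw (n - 3) M =
      M * (M + 1) * (M + 2) / ((n - 2) * (n - 1) * n) := by
    rw [integral_cube_orderLaw hM1 (by omega), c3]; ring
  rw [m1, m2] at hR1
  rw [m3, m4] at hR2
  have hi : ∀ N j, Integrable (fun s => relMoment P S (κ * a) w N M j (cov s))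
      (P.restrict {u | treat u = w}) := fun N j =>
    Integrable.of_bound
      ((measurable_relMoment h.closed.measurableSet _ w N M j).comp measurable_cov).aestronglyMeasurable
      _ (ae_of_all _ fun s => by
        rw [Real.norm_of_nonneg (relMoment_nonneg hb w N M j _)]
        exact relMoment_le hb w N M j _)
  have hc : ∀ C : ℝ, ∫ _s in {u | treat u = w}, C ∂P = share P w * C := fun C => by
    simp [share, mul_comm]
  have hi1 := ((hi (n - 2) 1).const_mul (((n : ℝ) - 1) / M)).const_mul 4
  have hi2 := ((hi (n - 3) 2).const_mul (((n : ℝ) - 1) * (n - 2) / M ^ 2)).const_mul 2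
  have hi12 : Integrable (fun s => 4 * (((n : ℝ) - 1) / M *
      relMoment P S (κ * a) w (n - 2) M 1 (cov s)) + 2 * (((n : ℝ) - 1) * (n - 2) / M ^ 2 *
      relMoment P S (κ * a) w (n - 3) M 2 (cov s))) (P.restrict {u | treat u = w}) := hi1.add hi2
  unfold weightErr
  rw [integral_add (hi12.const_mul _) (integrable_const _), hc, integral_const_mul,
    integral_add hi1 hi2, integral_const_mul, integral_const_mul, integral_const_mul,
    integral_const_mul]
  have hρ0 : 0 ≤ rad m (M / n / share P w / (κ * a)) := rad_nonneg (by positivity)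
  have hρ : rad m (M / n / share P w / (κ * a)) ≤
      rad m (1 / (κ * a)) * (M / (n * η)) ^ (1 / (m : ℝ)) := by
    rw [← rad_mul_eq (by positivity) (by positivity), mul_one_div]
    refine rad_mono (by positivity) ?_
    rw [div_div (M : ℝ)]
    gcongr
  set T : ℝ := (M / (n * η)) ^ (1 / (m : ℝ)) with hT
  have hT0 : 0 ≤ T := by positivity
  have hρ1 : 0 ≤ rad m (1 / (κ * a)) := rad_nonneg (by positivity)
  unfold rateConst
  generalize (∫ s in {u | treat u = w}, relMoment P S (κ * a) w (n - 2) M 1 (cov s) ∂P) = I1 at *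
  generalize (∫ s in {u | treat u = w}, relMoment P S (κ * a) w (n - 3) M 2 (cov s) ∂P) = I2 at *
  generalize rad m (M / n / share P w / (κ * a)) = ρ at *
  generalize rad m (1 / (κ * a)) = ρ₁ at *
  generalize share P w = sh at *
  generalize Γ / (κ * a) = B at *
  generalize catchConst κ Γ L a = D at *
  generalize layerConst m κ Γ a = Λ at *
  have q1 : ((n : ℝ) - 1) / M * I1 ≤ sh * Λ * ρ * 3 := by
    calc ((n : ℝ) - 1) / M * I1 ≤ ((n : ℝ) - 1) / M * (sh * Λ * ρ *
          (M / (n - 1) + M * (M + 1) / ((n - 1) * n) / (M / n))) := by gcongr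
      _ = sh * Λ * ρ * (1 + (M + 1) / M) := by field_simp
      _ ≤ sh * Λ * ρ * 3 := by
        have : ((M : ℝ) + 1) / M ≤ 2 := by rw [div_le_iff₀ hM0]; linarith
        gcongr
        linarith
  have q2 : ((n : ℝ) - 1) * (n - 2) / M ^ 2 * I2 ≤ sh * Λ * ρ * 8 := by
    calc ((n : ℝ) - 1) * (n - 2) / M ^ 2 * I2 ≤ ((n : ℝ) - 1) * (n - 2) / M ^ 2 * (sh * Λ * ρ *
          (M * (M + 1) / ((n - 2) * (n - 1)) +
            M * (M + 1) * (M + 2) / ((n - 2) * (n - 1) * n) / (M / n))) := by gcongr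
      _ = sh * Λ * ρ * ((M + 1) / M + (M + 1) / M * ((M + 2) / M)) := by field_simp
      _ ≤ sh * Λ * ρ * 8 := by
        have h1 : ((M : ℝ) + 1) / M ≤ 2 := by rw [div_le_iff₀ hM0]; linarith
        have h2 : ((M : ℝ) + 2) / M ≤ 3 := by rw [div_le_iff₀ hM0]; linarith
        have h3 : ((M : ℝ) + 1) / M * ((M + 2) / M) ≤ 2 * 3 :=
          mul_le_mul h1 h2 (by positivity) (by norm_num)
        gcongr
        linarith
  have q3 : (1 : ℝ) / sh ≤ 1 / η := by gcongr
  calc B / sh * (D / sh) * (4 * ((n - 1) / M * I1) + 2 * ((n - 1) * (n - 2) / M ^ 2 * I2)) +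
        sh * (2 * (B / sh) ^ 2 / M)
      ≤ B / sh * (D / sh) * (4 * (sh * Λ * ρ * 3) + 2 * (sh * Λ * ρ * 8)) +
        sh * (2 * (B / sh) ^ 2 / M) := by gcongr
    _ = 1 / sh * (28 * B * D * Λ * ρ + 2 * B ^ 2 * (1 / M)) := by field_simp; ring
    _ ≤ 1 / η * (28 * B * D * Λ * (ρ₁ * T) + 13 * B ^ 2 * (1 / M)) := by
        gcongr
        norm_num
    _ ≤ 1 / η * ((28 * B * D * Λ * ρ₁ + 13 * B ^ 2) * (T + 1 / M)) := by
        refine mul_le_mul_of_nonneg_left ?_ (by positivity)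
        have h1 : 0 ≤ 28 * B * D * Λ * ρ₁ * (1 / M) := by positivity
        have h2 : 0 ≤ 13 * B ^ 2 * T := by positivity
        linarith
    _ = _ := by ring

lemma weightErr_nonneg (hn : 2 ≤ n) (M : ℕ) (w : Bool) (x : Cov m) :
    0 ≤ weightErr P S κ Γ L a n M w x := by
  have hκ := h.κ_pos
  have ha := h.a_pos
  have hΓ := h.Γ_pos
  have hsh := h.share_pos w
  have hb : 0 ≤ κ * a := by positivity
  have hD := catchConst_nonneg hκ hΓ h.L_pos ha
  have h1 := relMoment_nonneg (P := P) (S := S) hb w (n - 2) M 1 x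
  have h2 := relMoment_nonneg (P := P) (S := S) hb w (n - 3) M 2 x
  have hn' : (2 : ℝ) ≤ n := by exact_mod_cast hn
  have h3 : (0 : ℝ) ≤ n - 1 := by linarith
  have h4 : (0 : ℝ) ≤ n - 2 := by linarith
  unfold weightErr
  positivity

lemma exists_weightErr_le (hn : 2 ≤ n) (M : ℕ) :
    ∃ K, ∀ w x, weightErr P S κ Γ L a n M w x ≤ K := by
  have hκ := h.κ_pos
  have ha := h.a_pos
  have hΓ := h.Γ_pos
  have hb : 0 ≤ κ * a := by positivity
  have hD := catchConst_nonneg hκ hΓ h.L_pos ha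
  have hn' : (2 : ℝ) ≤ n := by exact_mod_cast hn
  have h3 : (0 : ℝ) ≤ n - 1 := by linarith
  have h4 : (0 : ℝ) ≤ n - 2 := by linarith
  have hw : ∀ w, ∃ K, ∀ x, weightErr P S κ Γ L a n M w x ≤ K := by
    intro w
    have hsh := h.share_pos w
    refine ⟨Γ / (κ * a) / share P w * (catchConst κ Γ L a / share P w) *
      (4 * ((n - 1) / M * ((rad m (1 / share P w / (κ * a)) + m * 2) *
        (orderLaw (n - 2) M).real Set.univ)) +
      2 * ((n - 1) * (n - 2) / M ^ 2 * ((rad m (1 / share P w / (κ * a)) + m * 2) *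
        (orderLaw (n - 3) M).real Set.univ))) + 2 * (Γ / (κ * a) / share P w) ^ 2 / M,
      fun x => ?_⟩
    unfold weightErr
    gcongr
    · exact relMoment_le hb w _ _ _ x
    · exact relMoment_le hb w _ _ _ x
  choose K hK using hw
  refine ⟨max (K true) (K false), fun w x => (hK w x).trans ?_⟩
  cases w <;> simp

omit h in
lemma meanSq_le {M : ℕ} (hM : 1 ≤ M) (hn : n ≤ 2 * M) (i : Fin n) (y : Pop m) :
    meanSq P M i y ≤ 9 := by
  have hM0 : (0 : ℝ) < M := by exact_mod_cast hM
  have h1 : ∀ s : Fin n → Pop m, ‖weight M i (Function.update s i y) ^ 2‖ ≤ 9 := by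
    intro s
    rw [Real.norm_of_nonneg (sq_nonneg _), weight_sq]
    have h2 : (matched M (treat (Function.update s i y i)) i (Function.update s i y) : ℝ) / M ≤ 2 := by
      rw [div_le_iff₀ hM0]
      exact_mod_cast (matched_le _ _ _ _).trans hn
    have h3 : (0 : ℝ) ≤
        (matched M (treat (Function.update s i y i)) i (Function.update s i y) : ℝ) / M := by
      positivity
    nlinarith
  have := norm_integral_le_of_norm_le_const (μ := sampleLaw n P) (ae_of_all _ h1)
  rw [probReal_univ, mul_one] at this
  exact (Real.le_norm_self _).trans this

/-- The deviation of `n Var E_n` from the limiting variance is of the order of the radius of the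
catchment areas plus `1 / M`. -/
theorem abs_varMain_sub_limitVar_le_rate (hm : 1 ≤ m) (hA : AssumptionA c η P)
    (hB : AssumptionB c p P μ) (hn : 9 ≤ n) {M : ℕ} (hM1 : 1 ≤ M) (hMn : M ≤ n) :
    |n * varMain n M P μ - limitVar P μ| ≤
      2 * (1 + c.Mu) * (rateConst m κ Γ L a / η * ((M / (n * η)) ^ (1 / (m : ℝ)) + 1 / M)) := by
  have hκ := h.κ_pos
  have ha := h.a_pos
  have hη := h.η_pos
  have hB1 := h.one_le_ratio
  rcases le_or_gt (M + 3) n with hlt | hgt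
  · obtain ⟨K, hK⟩ := h.exists_weightErr_le (n := n) (by omega) M
    refine h.abs_varMain_sub_limitVar_le hA hB (by omega) hM1 (b := weightErr P S κ Γ L a n M)
      (fun w => ?_) (h.weightErr_nonneg (by omega) M) hK
      (h.setIntegral_weightErr_le hm hM1 hlt)
      fun i y w hy hx => h.abs_meanSq_sub_le hm hM1 hlt i hy hx hB1
    have h1 := measurable_relMoment (P := P) h.closed.measurableSet (κ * a) w (n - 2) M 1
    have h2 := measurable_relMoment (P := P) h.closed.measurableSet (κ * a) w (n - 3) M 2
    unfold weightErr
    exact ((((h1.const_mul _).const_mul _).add ((h2.const_mul _).const_mul _)).const_mul _).add_const _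
  -- `M` is comparable with `n`, so that all weights are bounded and the rate does not tend to zero
  · have hD := catchConst_nonneg hκ h.Γ_pos h.L_pos ha
    have hΛ := layerConst_nonneg m hκ h.Γ_pos ha
    have hρ1 : 0 ≤ rad m (1 / (κ * a)) := rad_nonneg (by positivity)
    refine h.abs_varMain_sub_limitVar_le hA hB (by omega) hM1
      (b := fun w _ => 13 * (Γ / (κ * a) / share P w) ^ 2) (fun w => measurable_const)
      (fun w _ => by positivity)
      (K := max (13 * (Γ / (κ * a) / share P true) ^ 2) (13 * (Γ / (κ * a) / share P false) ^ 2))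
      (fun w _ => by cases w <;> simp) (fun w => ?_) fun i y w hy hx => ?_
    · have hsh := h.share_pos w
      have hηsh : η ≤ share P w := h.overlap.le_share w
      have e1 : ∫ _s in {u | treat u = w}, 13 * (Γ / (κ * a) / share P w) ^ 2 ∂P =
          13 * (Γ / (κ * a)) ^ 2 / share P w := by
        simp only [integral_const, measureReal_restrict_apply_univ, smul_eq_mul]
        change share P w * _ = _
        field_simp
      have hn' : (9 : ℝ) ≤ n := by exact_mod_cast hn
      have hMn' : (n : ℝ) ≤ M + 2 := by exact_mod_cast (by omega : n ≤ M + 2)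
      have h1 : (1 : ℝ) ≤ (M / (n * η)) ^ (1 / (m : ℝ)) := by
        refine Real.one_le_rpow ?_ (by positivity)
        rw [le_div_iff₀ (by positivity)]
        nlinarith [hA.eta_le]
      have h2 : 13 * (Γ / (κ * a)) ^ 2 ≤ rateConst m κ Γ L a := by
        unfold rateConst
        have : 0 ≤ 28 * (Γ / (κ * a)) * catchConst κ Γ L a * layerConst m κ Γ a *
            rad m (1 / (κ * a)) := by positivity
        linarith
      have h3 : 0 ≤ rateConst m κ Γ L a := le_trans (by positivity) h2
      rw [e1]
      calc 13 * (Γ / (κ * a)) ^ 2 / share P w ≤ rateConst m κ Γ L a / η * 1 := by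
            rw [mul_one]; gcongr
        _ ≤ _ := by
            have : (0 : ℝ) ≤ 1 / M := by positivity
            gcongr
            linarith
    · have hsh := h.share_pos w
      have h1 := h.odds_nonneg w hx
      have h2 := h.odds_le w hx
      have h3 : 1 ≤ Γ / (κ * a) / share P w := by
        rw [le_div_iff₀ hsh]; linarith [share_le_one (P := P) w]
      have h4 : meanSq P M i y ≤ 9 := meanSq_le hM1 (by omega) i y
      have h5 : 0 ≤ meanSq P M i y := integral_nonneg fun s => sq_nonneg _
      rw [abs_le]
      constructor <;> nlinarith

end Design

end Rate

/-! ### Comparison with the stated rates -/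

lemma rpow_inv_le_of_le {m : ℕ} {u K : ℝ} (hu : 0 ≤ u) (huK : u ≤ K) :
    u ^ (1 / (m : ℝ)) ≤ K ^ (1 / (2 * (m : ℝ))) * u ^ (1 / (2 * (m : ℝ))) := by
  have h1 : (1 : ℝ) / m = 1 / (2 * m) + 1 / (2 * m) := by ring
  rw [h1, Real.rpow_add_of_nonneg hu (by positivity) (by positivity)]
  gcongr

lemma one_div_le_one_div_sqrt {M : ℕ} (hM : 1 ≤ M) : (1 : ℝ) / M ≤ 1 / √M := by
  have h1 : (1 : ℝ) ≤ M := by exact_mod_cast hM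
  have h2 : 0 < √(M : ℝ) := Real.sqrt_pos.2 (by linarith)
  gcongr
  exact Real.sqrt_le_iff.2 ⟨by linarith, by nlinarith⟩

/-- The rate, with a constant that depends on the structural constants only. -/
lemma exists_rate_const {m : ℕ} (hm : 1 ≤ m) (c : Constants) {C₀ : ℝ} (hC₀ : 0 < C₀) :
    ∃ C : ℝ, 0 < C ∧ ∀ (η p : ℝ) (P : Measure (Pop m)) [IsProbabilityMeasure P]
      (μ : Bool → Cov m → ℝ), AssumptionA c η P → AssumptionB c p P μ →
      ∀ n M : ℕ, 9 ≤ n → 1 ≤ M → M ≤ n → (M : ℝ) ≤ C₀ * n * η →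
        |n * varMain n M P μ - limitVar P μ| ≤
          C / η * ((M / (n * η)) ^ (1 / (2 * (m : ℝ))) + 1 / √M) := by
  set C' := 2 * (1 + c.Mu) * rateConst m (min (c.cmin false) (c.cmin true))
    (max 1 (max (c.cmax false) (c.cmax true))) c.L c.a
  set K := C₀ ^ (1 / (2 * (m : ℝ)))
  have hK : 0 ≤ K := by positivity
  refine ⟨(|C'| + 1) * (K + 1), by positivity, ?_⟩
  intro η p P _ μ hA hB n M hn hM hMn hMC
  obtain ⟨g, h⟩ := hA.design
  have hη := hA.eta_pos
  have hn0 : (0 : ℝ) < n := by exact_mod_cast (by omega : 0 < n)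
  refine (h.abs_varMain_sub_limitVar_le_rate hm hA hB hn hM hMn).trans ?_
  have h1 : (M / (n * η) : ℝ) ≤ C₀ := by
    rw [div_le_iff₀ (by positivity)]; linarith
  have h2 := rpow_inv_le_of_le (m := m) (by positivity) h1
  have h3 := one_div_le_one_div_sqrt hM
  set u : ℝ := (M / (n * η)) ^ (1 / (2 * (m : ℝ)))
  have hu : 0 ≤ u := by positivity
  set v : ℝ := 1 / √M
  have hv : 0 ≤ v := by positivity
  calc 2 * (1 + c.Mu) * (rateConst m (min (c.cmin false) (c.cmin true))
        (max 1 (max (c.cmax false) (c.cmax true))) c.L c.a / η *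
          ((M / (n * η)) ^ (1 / (m : ℝ)) + 1 / M))
      = C' / η * ((M / (n * η)) ^ (1 / (m : ℝ)) + 1 / M) := by simp only [C']; ring
    _ ≤ (|C'| + 1) / η * (K * u + v) := by
        gcongr
        linarith [le_abs_self C']
    _ ≤ (|C'| + 1) / η * ((K + 1) * (u + v)) := by
        gcongr
        nlinarith [mul_nonneg hK hv]
    _ = _ := by ring

lemma rate_le_varRate {m : ℕ} {r₀ η : ℝ} (hη : 0 < η) (n M : ℕ) :
    1 / η * ((M / (n * η)) ^ (1 / (2 * (m : ℝ))) + 1 / √M) ≤ varRate m r₀ n M η := by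
  have h1 := Real.sqrt_nonneg (deltaH1 r₀ n M η)
  have h2 : 0 ≤ √(deltaH2 m r₀ n M η) * (1 / (η * √M)) := by positivity
  have h3 := Real.sqrt_nonneg (deltaH3 n M η)
  have h4 : 0 ≤ 1 / (η ^ 3 * (n : ℝ) ^ (1 / 3 : ℝ)) := by positivity
  have h5 : 1 / η * (1 / √M) = 1 / (η * √M) := by rw [one_div_mul_one_div]
  unfold varRate
  rw [mul_add, h5]
  linarith

lemma rate_le_simpleRate {m : ℕ} {η η₀ : ℝ} (hη₀ : 0 < η₀) (hη : η₀ ≤ η) (n M : ℕ) :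
    1 / η * ((M / (n * η)) ^ (1 / (2 * (m : ℝ))) + 1 / √M) ≤
      1 / η₀ * ((1 / η₀) ^ (1 / (2 * (m : ℝ))) + 1) * simpleRate m n M := by
  have hη' : 0 < η := by linarith
  set K := (1 / η₀) ^ (1 / (2 * (m : ℝ)))
  have hK : 0 ≤ K := by positivity
  set u : ℝ := (M / n : ℝ) ^ (1 / (2 * (m : ℝ))) with hu
  have hu0 : 0 ≤ u := by positivity
  have hv0 : 0 ≤ 1 / √(M : ℝ) := by positivity
  have hw0 : 0 ≤ 1 / (n : ℝ) ^ (1 / 3 : ℝ) := by positivity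
  have h1 : (M / (n * η) : ℝ) ^ (1 / (2 * (m : ℝ))) ≤ K * u := by
    rw [hu, ← Real.mul_rpow (by positivity) (by positivity)]
    refine Real.rpow_le_rpow (by positivity) ?_ (by positivity)
    rw [← div_div, one_div, mul_comm, ← div_eq_mul_inv]
    gcongr
  have h2 : simpleRate m n M = u + 1 / √M + 1 / (n : ℝ) ^ (1 / 3 : ℝ) := rfl
  rw [h2, mul_assoc]
  gcongr
  nlinarith [mul_nonneg hK hv0, mul_nonneg hK hw0]

end ATEMatching

theorem mainTheorem8 (m : ℕ) (hm : 1 ≤ m) (c : ATEMatching.Constants) :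
    -- lower bound, for every sample size
    (∀ (η p : ℝ) (P : Measure (ATEMatching.Pop m)) [IsProbabilityMeasure P]
        (μ : Bool → ATEMatching.Cov m → ℝ),
        ATEMatching.AssumptionA c η P → ATEMatching.AssumptionB c p P μ →
        ∀ n M : ℕ, 1 ≤ n → 1 ≤ M → M ≤ n →
          MemLp (ATEMatching.mainTerm n M μ) 2 (ATEMatching.sampleLaw n P) ∧
          (variance (ATEMatching.err μ) P + ATEMatching.varCate P μ) / n ≤
            ATEMatching.varMain n M P μ) ∧
    -- non-asymptotic rate, the constant depends only on `m`, `c`, `C₀`, `C₁`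
    (∀ C₀ C₁ : ℝ, 0 < C₀ → 0 < C₁ → C₀ ≤ ATEMatching.c0Bound m c →
      ∃ C : ℝ, 0 < C ∧
        ∀ (η p : ℝ) (P : Measure (ATEMatching.Pop m)) [IsProbabilityMeasure P]
          (μ : Bool → ATEMatching.Cov m → ℝ),
          ATEMatching.AssumptionA c η P → ATEMatching.AssumptionB c p P μ →
          ∀ r₀ : ℝ, ATEMatching.rRatio c ≤ r₀ → r₀ ≤ 1 →
          ∀ n M : ℕ, 9 ≤ n → 1 ≤ M → M ≤ n → (M : ℝ) ≤ C₀ * n * η → C₁ ≤ n * η ^ 2 →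
            |n * ATEMatching.varMain n M P μ - ATEMatching.limitVar P μ| ≤
              C * ATEMatching.varRate m r₀ n M η) ∧
    -- simplified rate under the extra scaling, with `η` bounded away from zero by `η₀`
    (∀ C₀ C₁ η₀ : ℝ, 0 < C₀ → 0 < C₁ → C₀ ≤ ATEMatching.c0Bound m c → 0 < η₀ →
      ∃ C : ℝ, 0 < C ∧
        ∀ (η p : ℕ → ℝ) (P : ℕ → Measure (ATEMatching.Pop m)) [∀ n, IsProbabilityMeasure (P n)]
          (μ : ℕ → Bool → ATEMatching.Cov m → ℝ) (M : ℕ → ℕ),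
          (∀ n, 9 ≤ n →
            ATEMatching.AssumptionA c (η n) (P n) ∧ ATEMatching.AssumptionB c (p n) (P n) (μ n) ∧
            1 ≤ M n ∧ M n ≤ n ∧ (M n : ℝ) ≤ C₀ * n * η n ∧ C₁ ≤ n * η n ^ 2 ∧ η₀ ≤ η n) →
          Tendsto (fun n : ℕ => Real.log n / M n) atTop (𝓝 0) →
          Tendsto (fun n : ℕ => M n * Real.log n / n) atTop (𝓝 0) →
          ∀ᶠ n in atTop,
            |n * ATEMatching.varMain n (M n) (P n) (μ n) - ATEMatching.limitVar (P n) (μ n)| ≤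
              C * ATEMatching.simpleRate m n (M n)) := by
  refine ⟨?_, ?_, ?_⟩
  · intro η p P _ μ _ hB n M hn hM _
    exact ⟨ATEMatching.memLp_mainTerm hB hM, ATEMatching.le_varMain hB hn hM⟩
  · intro C₀ C₁ hC₀ _ _
    obtain ⟨C, hC, h⟩ := ATEMatching.exists_rate_const hm c hC₀
    refine ⟨C, hC, fun η p P _ μ hA hB r₀ _ _ n M hn hM hMn hMC _ =>
      (h η p P μ hA hB n M hn hM hMn hMC).trans ?_⟩
    rw [div_eq_mul_one_div, mul_assoc]
    exact mul_le_mul_of_nonneg_left (ATEMatching.rate_le_varRate hA.eta_pos n M) hC.le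
  · intro C₀ C₁ η₀ hC₀ _ _ hη₀
    obtain ⟨C, hC, h⟩ := ATEMatching.exists_rate_const hm c hC₀
    refine ⟨C * (1 / η₀ * ((1 / η₀) ^ (1 / (2 * (m : ℝ))) + 1)), by positivity, ?_⟩
    intro η p P _ μ M hyp _ _
    filter_upwards [eventually_ge_atTop 9] with n hn
    obtain ⟨hA, hB, hM, hMn, hMC, _, hη⟩ := hyp n hn
    refine (h (η n) (p n) (P n) (μ n) hA hB n (M n) hn hM hMn hMC).trans ?_
    rw [div_eq_mul_one_div, mul_assoc, mul_assoc]
    refine mul_le_mul_of_nonneg_left ?_ hC.le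
    exact ATEMatching.rate_le_simpleRate hη₀ hη n (M n)
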